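/- **Theorem (correctness of MultiBagsPlus).** *Executions.* A program with general futures is executed in depth-first eager order. Besides reads and writes of memory locations, the execution issues the following control instructions: $\mathtt{spawn}$ and $\mathtt{create}$ (call a function instance, respectively a future, whose body is executed at once, before the continuation of the caller); return; $\mathtt{sync}$ (join the most recently spawned child that the current function has not yet joined; a sync of several children is a succession of such binary ones); and $\mathtt{get}(h)$ (wait for the future $h$, which is already completed; a future may be gotten any number of times, from anywhere). A function joins all its spawned children before it returns. Each control instruction ends the current strand and begins a new one. The nodes of the computation dag are the strands. Its edges are: from the strand ending with a spawn or create to the first strand of the callee (spawn, create edge) and to the continuation strand (continue edge); from the last strand before a sync (continue edge) and from the last strand of the joined child (join edge) to the strand after the sync; from the last strand before a get (continue edge) and from the last strand of the future (get edge) to the strand after the get. Write $u\prec v$ if there is a nonempty path from $u$ to $v$ in the full computation dag; distinct strands $u,v$ are logically parallel if neither $u\prec v$ nor $v\prec u$. *Data structures.* $D_{SP}$ is a partition of the executed strands into bags, each marked $S$ or $P$; $D_{NSP}$ is a partition of them into sets, each attached or unattached; $\mathcal R$ is a dag on the attached sets. An unattached set $U$ has an attached predecessor $\mathrm{attPred}(U)$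 and possibly an attached successor $\mathrm{attSucc}(U)$; for an attached set $A$ put $\mathrm{attPred}(A)=\mathrm{attSucc}(A)=A$. For a strand $u$, $A_u$ is the set containing it, $\mathrm{attPred}(u)=\mathrm{attPred}(A_u)$ and $\mathrm{attSucc}(u)=\mathrm{attSucc}(A_u)$. $\mathrm{Attachify}(u)$ does nothing if $A_u$ is attached; otherwise it makes $A_u$ attached and adds the arc $(\mathrm{attPred}(A_u),A_u)$ to $\mathcal R$. Initially the first strand is in the $S$-bag of the main function and forms an attached set. *Updates of $D_{SP}$.* When $G$ is spawned or created, an $S$-bag $S_G$ containing its first strand is made; every further strand of a function $F$ is put into $S_F$ when it begins; when $G$ returns, $S_G$ becomes the $P$-bag $P_G$; when $F$ syncs with $G$, $P_G$ is merged into $S_F$; a get merges no bags. *Updates of $D_{NSP}$ and $\mathcal R$* (each strand is entered when it begins). - Strand $u$ spawns: the first strand of the callee and the continuation strand become unattached singletons with attached predecessor $\mathrm{attPred}(u)$. - Strand $u$ creates a future: $\mathrm{Attachify}(u)$; the first strand $v$ of the future and the continuation strand $w$ become attached singletons, with arcs $(A_u,A_v)$ and $(A_u,A_w)$. - Strand $u$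 gets a future with last strand $t$: $\mathrm{Attachify}(u)$; the strand $v$ after the get becomes an attached singleton, with arcs $(A_u,A_v)$ and $(A_t,A_v)$. - A sync with join strand $j$ joins two subdags with sources $s_1,s_2$ and sinks $t_1,t_2$ that were forked by the strand $f$. If $A_{t_1},A_{t_2}$ are both unattached, they and $j$ are merged into $A_f$. If both are attached, then $\mathrm{Attachify}(f)$, arcs $(A_f,A_{s_1})$ and $(A_f,A_{s_2})$ are added, and $j$ becomes an attached singleton, with arcs $(A_{t_1},A_j)$ and $(A_{t_2},A_j)$. If exactly one is attached, say $A_{t_a}$ and not $A_{t_b}$, $\{a,b\}=\{1,2\}$, then $A_f$ is merged into $A_{s_a}$ if it is unattached, $j$ is added to $A_{t_a}$, and $\mathrm{attSucc}(A_{t_b}):=A_j$. *Query.* $\mathrm{Query}(u,v)$ answers yes if $u$ is in an $S$-bag. Otherwise it answers no if $u$ is in an unattached set without attached successor, and else answers whether there is a (possibly empty) path in $\mathcal R$ from $\mathrm{attSucc}(u)$ to $\mathrm{attPred}(v)$. *Detector.* For each location $\ell$ the detector stores its last writer and the strands that have read it since. When the current strand $v$ reads $\ell$, it reports a race on $\ell$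 between $v$ and the last writer $u$ if $\mathrm{Query}(u,v)$ answers no, and stores $v$ as a reader. When $v$ writes $\ell$, it reports a race between $v$ and each such $u$ among the last writer and the stored readers, makes $v$ the last writer and empties the list of readers. *Claim.* At every point of the execution: 1. if $v$ is the currently executing strand and $u$ is any strand executed earlier, then $\mathrm{Query}(u,v)$ answers yes if and only if $u\prec v$; 2. whenever the detector has reported a race on $\ell$ between $u$ and $v$, the strands $u$ and $v$ are logically parallel and have made accesses to $\ell$ at least one of which is a write; and for every location $\ell$, the detector has reported a race on $\ell$ if and only if two logically parallel strands have made accesses to $\ell$ at least one of which is a write. -/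

import Mathlib

namespace MultiBagsPlus

/-! ## Programs with futures, executed in depth-first eager order

The depth-first eager execution of a program with general futures issues a sequence of
instructions: memory accesses and the parallel control instructions `spawn`, `create`, `ret`,
`sync`, `get`. A strand is a maximal piece of the execution without parallel control, so each
control instruction ends the current strand and begins a new one. Strands are numbered in the
order in which they are executed, function instances in the order in which they are called;
strand `0` is the first strand of the main function `0`. -/

/-- The instructions issued by an execution. `get h` waits for the future computed by the function
instance `h`; a future may be gotten any number of times, from anywhere. `sync` joins the most
recently spawned child that the current function has not joined yet (a `sync` that joins several
children is a succession of such binary ones). -/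
inductive Instr (Loc : Type*) where
  | read (l : Loc)
  | write (l : Loc)
  | spawn
  | create
  | ret
  | sync
  | get (h : ℕ)

/-- The kinds of edges of the computation dag. -/
inductive EdgeKind where
  | spawn
  | create
  | cont
  | join
  | get
  deriving DecidableEq

/-- An edge of the computation dag. -/
structure Edge where
  src : ℕ
  kind : EdgeKind
  dst : ℕ
  deriving DecidableEq

/-- The two ways of starting a parallel function instance. -/
inductive CallKind where
  | spawn
  | create
  deriving DecidableEq

/-- A spawned child that has returned and has not been joined yet: the instance `child`, the
strand `f` that ended with the spawn, the first strand `s₁` and the last strand `t₁` of the child,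
and the first strand `s₂` of the continuation of the parent. -/
structure Fork where
  child : ℕ
  f : ℕ
  s₁ : ℕ
  t₁ : ℕ
  s₂ : ℕ

/-- A suspended function instance `fn`: its strand `caller` ended with a call of kind `kind`, the
callee began with the strand `first`, and `pending` are its children that are still to be joined,
the most recent one first. -/
structure Frame where
  fn : ℕ
  caller : ℕ
  kind : CallKind
  first : ℕ
  pending : List Fork

/-- A memory access: strand, location, and whether it is a write. -/
structure Access (Loc : Type*) where
  strand : ℕ
  loc : Loc
  isWrite : Bool

/-- The state of a depth-first eager execution, with the part of the computation dag and the
memory accesses seen so far. -/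
structure Exec (Loc : Type*) where
  /-- the currently executing strand -/
  cur : ℕ
  /-- the function instance it belongs to -/
  fn : ℕ
  /-- the returned and unjoined spawned children of `fn`, the most recent one first -/
  pending : List Fork
  /-- the suspended ancestors of `fn`, innermost first -/
  stack : List Frame
  /-- the number of function instances so far -/
  numFns : ℕ
  /-- the last strand of each completed future -/
  futureLast : ℕ → Option ℕ
  /-- the edges of the computation dag -/
  edges : List Edge
  /-- the memory accesses, the most recent one first -/
  accesses : List (Access Loc)

namespace Exec

variable {Loc : Type*}

/-- The start of the execution: the first strand of the main function. -/
def init : Exec Loc where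
  cur := 0
  fn := 0
  pending := []
  stack := []
  numFns := 1
  futureLast := fun _ => none
  edges := []
  accesses := []

/-- A call executes the callee eagerly: its first strand is executed next, and the caller is
suspended. -/
def call (E : Exec Loc) (k : CallKind) (e : EdgeKind) : Exec Loc :=
  { E with
    cur := E.cur + 1
    fn := E.numFns
    pending := []
    stack := ⟨E.fn, E.cur, k, E.cur + 1, E.pending⟩ :: E.stack
    numFns := E.numFns + 1
    edges := ⟨E.cur, e, E.cur + 1⟩ :: E.edges }

/-- One instruction; `none` if it is not possible. A function returns only after it has joined all
its spawned children, and in depth-first eager order a `get` finds its future completed. -/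
def step (E : Exec Loc) : Instr Loc → Option (Exec Loc)
  | .read l => some { E with accesses := ⟨E.cur, l, false⟩ :: E.accesses }
  | .write l => some { E with accesses := ⟨E.cur, l, true⟩ :: E.accesses }
  | .spawn => some (E.call .spawn .spawn)
  | .create => some (E.call .create .create)
  | .ret =>
    match E.pending, E.stack with
    | [], fr :: stack =>
      match fr.kind with
      | .spawn => some { E with
          cur := E.cur + 1
          fn := fr.fn
          pending := ⟨E.fn, fr.caller, fr.first, E.cur, E.cur + 1⟩ :: fr.pending
          stack := stack
          edges := ⟨fr.caller, .cont, E.cur + 1⟩ :: E.edges }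
      | .create => some { E with
          cur := E.cur + 1
          fn := fr.fn
          pending := fr.pending
          stack := stack
          futureLast := Function.update E.futureLast E.fn (some E.cur)
          edges := ⟨fr.caller, .cont, E.cur + 1⟩ :: E.edges }
    | _, _ => none
  | .sync =>
    match E.pending with
    | k :: pending => some { E with
        cur := E.cur + 1
        pending := pending
        edges := ⟨E.cur, .cont, E.cur + 1⟩ :: ⟨k.t₁, .join, E.cur + 1⟩ :: E.edges }
    | [] => none
  | .get h =>
    match E.futureLast h with
    | some t => some { E with
        cur := E.cur + 1
        edges := ⟨E.cur, .cont, E.cur + 1⟩ :: ⟨t, .get, E.cur + 1⟩ :: E.edges }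
    | none => none

/-- The execution of a sequence of instructions. -/
def run (p : List (Instr Loc)) : Option (Exec Loc) :=
  p.foldlM step init

/-- `u ≺ v`: there is a nonempty path from `u` to `v` in the computation dag, along edges of any
kind. -/
def Precedes (E : Exec Loc) (u v : ℕ) : Prop :=
  Relation.TransGen (fun a b => ∃ e ∈ E.edges, e.src = a ∧ e.dst = b) u v

/-- Logically parallel strands. -/
def Parallel (E : Exec Loc) (u v : ℕ) : Prop :=
  u ≠ v ∧ ¬ E.Precedes u v ∧ ¬ E.Precedes v u

end Exec

/-! ## The data structures of MultiBagsPlus -/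

/-- In a labelling of disjoint sets, merge the set labelled `b` into the set labelled `a`. -/
def relabel (a b c : ℕ) : ℕ := if c = b then a else c

/-- The two kinds of bags. -/
inductive BagKind where
  | S
  | P
  deriving DecidableEq

/-- The disjoint-set structure `D_SP` over strands. Every set is the bag of one function instance,
which serves as its label; `find u` is the label of the bag that holds `u`. -/
structure DSP where
  find : ℕ → ℕ
  kind : ℕ → BagKind

namespace DSP

/-- Put the new strand `v` into the bag of `F`. -/
def add (D : DSP) (F v : ℕ) : DSP :=
  { D with find := Function.update D.find v F }

/-- Create the bag `S_G`, containing the first strand `v` of `G`. -/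
def makeS (D : DSP) (G v : ℕ) : DSP where
  find := Function.update D.find v G
  kind := Function.update D.kind G .S

/-- The bag `S_G` becomes `P_G`. -/
def toP (D : DSP) (G : ℕ) : DSP :=
  { D with kind := Function.update D.kind G .P }

/-- Merge the bag of `G` into the bag of `F`. -/
def union (D : DSP) (F G : ℕ) : DSP :=
  { D with find := fun x => relabel F G (D.find x) }

end DSP

/-- The disjoint-set structure `D_NSP` over strands, with its attached and unattached sets, and the
reachability dag `R` over the attached sets. Sets are labelled by natural numbers, and `find u` is
the label of the set that holds `u`. An unattached set has an attached predecessor, and it may have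
an attached successor. `R` is kept transitively closed: it holds the pairs `(A, B)` of
attached sets that are joined by a nonempty path. -/
structure DNSP where
  find : ℕ → ℕ
  attached : ℕ → Bool
  attPred : ℕ → ℕ
  attSucc : ℕ → Option ℕ
  R : Finset (ℕ × ℕ)

namespace DNSP

/-- Make the set `{v}`, unattached, with attached predecessor `A`. -/
def makeUnattached (D : DNSP) (v A : ℕ) : DNSP :=
  { D with
    find := Function.update D.find v v
    attached := Function.update D.attached v false
    attPred := Function.update D.attPred v A
    attSucc := Function.update D.attSucc v none }

/-- Make the set `{v}`, attached. -/
def makeAttached (D : DNSP) (v : ℕ) : DNSP :=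
  { D with
    find := Function.update D.find v v
    attached := Function.update D.attached v true }

/-- Merge the set of `b` into the set of `a`, which keeps its label and its attributes. -/
def union (D : DNSP) (a b : ℕ) : DNSP :=
  { D with find := fun x => relabel (D.find a) (D.find b) (D.find x) }

/-- Put the new strand `v` into the set of `a`. -/
def add (D : DNSP) (a v : ℕ) : DNSP :=
  { D with find := Function.update D.find v (D.find a) }

/-- Add the arc `(A, B)` to `R`, and restore the transitive closure. -/
def arcSets (D : DNSP) (A B : ℕ) : DNSP :=
  { D with R := D.R ∪
      insert A ((D.R.filter fun e => e.2 = A).image Prod.fst) ×ˢ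
        insert B ((D.R.filter fun e => e.1 = B).image Prod.snd) }

/-- Add to `R` the arc from the set of `a` to the set of `b`. -/
def arc (D : DNSP) (a b : ℕ) : DNSP :=
  D.arcSets (D.find a) (D.find b)

/-- Is the set of `u` attached? -/
def isAttached (D : DNSP) (u : ℕ) : Bool :=
  D.attached (D.find u)

/-- The attached set that stands for `v` as the target of a query: the set of `v` if it is attached,
and its attached predecessor otherwise. -/
def predOf (D : DNSP) (v : ℕ) : ℕ :=
  if D.isAttached v then D.find v else D.attPred (D.find v)

/-- The attached set, if there is one, that stands for `u` as the source of a query: the set of `u`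
if it is attached, and its attached successor otherwise. -/
def succOf (D : DNSP) (u : ℕ) : Option ℕ :=
  if D.isAttached u then some (D.find u) else D.attSucc (D.find u)

/-- Turn the set of `u` into an attached set, with an arc in `R` from its attached predecessor;
nothing happens if it is attached already. -/
def attachify (D : DNSP) (u : ℕ) : DNSP :=
  if D.isAttached u then D
  else
    { D with attached := Function.update D.attached (D.find u) true }.arcSets
      (D.attPred (D.find u)) (D.find u)

/-- The strand `u` spawns a function with first strand `v`, or `v` is the first strand of the
continuation of `u` after a spawn. -/
def onSpawnEdge (D : DNSP) (u v : ℕ) : DNSP :=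
  D.makeUnattached v (D.predOf u)

/-- The strand `u` creates a future with first strand `v`. -/
def onCreate (D : DNSP) (u v : ℕ) : DNSP :=
  ((D.attachify u).makeAttached v).arc u v

/-- `v` is the first strand of the continuation of the strand `u`, which created a future. -/
def onCreateCont (D : DNSP) (u v : ℕ) : DNSP :=
  (D.makeAttached v).arc u v

/-- The strand `u` gets a future with last strand `t`; the strand after the get is `v`. -/
def onGet (D : DNSP) (u t v : ℕ) : DNSP :=
  (((D.attachify u).makeAttached v).arc u v).arc t v

/-- Join of two parallel subdags with sinks `tA` (attached) and `tU` (unattached), at the join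
strand `j`; `sA` is the source of the attached subdag and `f` the strand that spawned. -/
def joinOne (D : DNSP) (f sA tA tU j : ℕ) : DNSP :=
  let D₁ := if D.isAttached f then D else D.union sA f
  let D₂ := D₁.add tA j
  { D₂ with attSucc := Function.update D₂.attSucc (D₂.find tU) (some (D₂.find j)) }

/-- Join, at the strand `j`, of the two parallel subdags with sources `s₁`, `s₂` and sinks `t₁`,
`t₂` that were forked by the strand `f`. -/
def onSync (D : DNSP) (f s₁ t₁ s₂ t₂ j : ℕ) : DNSP :=
  match D.isAttached t₁, D.isAttached t₂ with
  | false, false => ((D.union f t₁).union f t₂).add f j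
  | true, true =>
    ((((((D.attachify f).arc f s₁).arc f s₂).makeAttached j).arc t₁ j).arc t₂ j)
  | true, false => D.joinOne f s₁ t₁ t₂ j
  | false, true => D.joinOne f s₂ t₂ t₁ j

end DNSP

/-- A reported race: the location, the earlier strand and the later strand. -/
structure Race (Loc : Type*) where
  loc : Loc
  fst : ℕ
  snd : ℕ

/-- The state of the race detector: the reachability structures, the access history (the last
writer of each location and its readers since then), and the reported races. -/
structure Detector (Loc : Type*) where
  sp : DSP
  nsp : DNSP
  lastWriter : Loc → Option ℕ
  readers : Loc → List ℕ
  races : List (Race Loc)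

namespace Detector

variable {Loc : Type*}

/-- At the start, the first strand is in the `S`-bag of the main function and in an attached set. -/
def init : Detector Loc where
  sp := ⟨fun _ => 0, fun _ => .S⟩
  nsp := ⟨id, fun A => decide (A = 0), fun _ => 0, fun _ => none, ∅⟩
  lastWriter := fun _ => none
  readers := fun _ => []
  races := []

/-- The query whether `u` precedes the currently executing strand `v`: yes if `u` is in an `S`-bag;
otherwise, no if the set of `u` is unattached without an attached successor, and else whether `R`
has a path from the attached set that stands for `u` to the one that stands for `v`. -/
def query (D : Detector Loc) (u v : ℕ) : Bool :=
  if D.sp.kind (D.sp.find u) = .S then true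
  else
    match D.nsp.succOf u with
    | none => false
    | some A => decide (A = D.nsp.predOf v ∨ (A, D.nsp.predOf v) ∈ D.nsp.R)

/-- The races between an access to `l` by the current strand `v` and the earlier accesses by the
strands in `us`. -/
def check (D : Detector Loc) (l : Loc) (v : ℕ) (us : List ℕ) : List (Race Loc) :=
  (us.filter fun u => !D.query u v).map fun u => ⟨l, u, v⟩

/-- The action of the detector on an instruction that is issued in the state `E` of the execution.
Each strand is entered into `D_SP` and `D_NSP` when it begins. -/
def step [DecidableEq Loc] (E : Exec Loc) (D : Detector Loc) : Instr Loc → Detector Loc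
  | .read l =>
    { D with
      readers := Function.update D.readers l (E.cur :: D.readers l)
      races := D.check l E.cur (D.lastWriter l).toList ++ D.races }
  | .write l =>
    { D with
      lastWriter := Function.update D.lastWriter l (some E.cur)
      readers := Function.update D.readers l []
      races := D.check l E.cur ((D.lastWriter l).toList ++ D.readers l) ++ D.races }
  | .spawn =>
    { D with
      sp := D.sp.makeS E.numFns (E.cur + 1)
      nsp := D.nsp.onSpawnEdge E.cur (E.cur + 1) }
  | .create =>
    { D with
      sp := D.sp.makeS E.numFns (E.cur + 1)
      nsp := D.nsp.onCreate E.cur (E.cur + 1) }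
  | .ret =>
    match E.stack with
    | fr :: _ =>
      { D with
        sp := (D.sp.toP E.fn).add fr.fn (E.cur + 1)
        nsp := match fr.kind with
          | .spawn => D.nsp.onSpawnEdge fr.caller (E.cur + 1)
          | .create => D.nsp.onCreateCont fr.caller (E.cur + 1) }
    | [] => D
  | .sync =>
    match E.pending with
    | k :: _ =>
      { D with
        sp := (D.sp.union E.fn k.child).add E.fn (E.cur + 1)
        nsp := D.nsp.onSync k.f k.s₁ k.t₁ k.s₂ E.cur (E.cur + 1) }
    | [] => D
  | .get h =>
    match E.futureLast h with
    | some t =>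
      { D with
        sp := D.sp.add E.fn (E.cur + 1)
        nsp := D.nsp.onGet E.cur t (E.cur + 1) }
    | none => D

/-- The execution of a sequence of instructions together with the detector. -/
def run [DecidableEq Loc] (p : List (Instr Loc)) : Option (Exec Loc × Detector Loc) :=
  p.foldlM (fun s i => (s.1.step i).map fun E => (E, s.2.step s.1 i)) (Exec.init, init)

end Detector

/-- Two accesses in `as` to the location `l`, by the strands `u` and `v`, conflict: at least one of
them is a write. -/
def Conflict {Loc : Type*} (as : List (Access Loc)) (l : Loc) (u v : ℕ) : Prop :=
  ∃ a ∈ as, ∃ b ∈ as, a.loc = l ∧ b.loc = l ∧ a.strand = u ∧ b.strand = v ∧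
    (a.isWrite = true ∨ b.isWrite = true)

end MultiBagsPlus

namespace MultiBagsPlus

/-! Every edge of the dag goes from a smaller strand number to a larger one, and all edges into a
strand are present when that strand begins. Reachability among the executed strands is therefore
never revised, and the proof can fix a single relation `r`, reachability in the full dag. It uses
only that `r` is a `StrandOrder` and that the immediate predecessors of each new strand are known
(`NewStrand`).

The executed strands are cut into consecutive blocks (`Sink`), with cuts at the calls and returns
that are still unfinished or unjoined. Each block has a source and a sink. Two facts drive
everything: the set of a sink can be left towards a live strand only through the exits of its block,
and an exit can be entered only from the sink (`Sink.Inv.out`, `Sink.Inv.exits`).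

For `D_NSP` the invariant is `DNSP.Inv`. The closed relation `R` is exactly reachability between
labels of attached sets; a path between two such labels gives paths between all members (`uniform`);
and a path from `u` to a live `v` either stays in one set or is witnessed by a path from the
attached successor of `u` to the attached predecessor of `v` (`complete`). If `u` has no attached
successor, it lies in an open sink set. Either that block is a returned child, from which nothing
live outside its set is reachable, or the whole block lies in an `S`-bag, by the invariant `Bags` of
`D_SP`. `Detector.Inv.query` combines these facts.

The invariants survive each instruction. Adding a singleton is handled by `Inv.addAttached` and
`Inv.addUnattached`, Attachify by `Core.attachify`, and the joins that merge sets by `JoinAt.one`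
and `JoinAt.both_unattached`.

Race detection then follows by transitivity (`History`): while no race on a location is reported,
each earlier access precedes the last writer or is a stored read, so a comparison with the stored
strands covers all conflicts. -/

/-- A reflexive and transitive relation on strands that respects the order of execution. -/
structure StrandOrder (r : ℕ → ℕ → Prop) : Prop where
  refl : ∀ x, r x x
  trans : ∀ {x y z}, r x y → r y z → r x z
  le : ∀ {x y}, r x y → x ≤ y

theorem StrandOrder.antisymm {r : ℕ → ℕ → Prop} (hr : StrandOrder r) {x y : ℕ} (hxy : r x y)
    (hyx : r y x) : x = y :=
  le_antisymm (hr.le hxy) (hr.le hyx)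

/-- The strand `n + 1` has the immediate predecessors `ps`. -/
def NewStrand (r : ℕ → ℕ → Prop) (n : ℕ) (ps : List ℕ) : Prop :=
  ∀ x, r x (n + 1) ↔ x = n + 1 ∨ ∃ p ∈ ps, r x p

/-! ### The invariant of `D_NSP` and the addition of a singleton. -/

namespace DNSP

/-- The set of `v` is attached, or it has no attached successor yet. -/
def Live (D : DNSP) (v : ℕ) : Prop :=
  D.isAttached v = true ∨ D.attSucc (D.find v) = none

theorem predOf_of_att {D : DNSP} {v : ℕ} (h : D.isAttached v = true) : D.predOf v = D.find v := by
  simp [predOf, h]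

theorem predOf_of_unatt {D : DNSP} {v : ℕ} (h : D.isAttached v = false) :
    D.predOf v = D.attPred (D.find v) := by
  simp [predOf, h]

theorem succOf_of_att {D : DNSP} {v : ℕ} (h : D.isAttached v = true) :
    D.succOf v = some (D.find v) := by
  simp [succOf, h]

theorem succOf_of_unatt {D : DNSP} {v : ℕ} (h : D.isAttached v = false) :
    D.succOf v = D.attSucc (D.find v) := by
  simp [succOf, h]

theorem isAttached_congr {D : DNSP} {x y : ℕ} (h : D.find x = D.find y) :
    D.isAttached x = D.isAttached y := by
  simp [isAttached, h]

theorem live_congr {D : DNSP} {x y : ℕ} (h : D.find x = D.find y) : D.Live x ↔ D.Live y := by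
  simp [Live, isAttached, h]

theorem predOf_congr {D : DNSP} {x y : ℕ} (h : D.find x = D.find y) : D.predOf x = D.predOf y := by
  unfold predOf isAttached; rw [h]

theorem succOf_congr {D : DNSP} {x y : ℕ} (h : D.find x = D.find y) : D.succOf x = D.succOf y := by
  unfold succOf isAttached; rw [h]

/-- The arcs of `R` are exactly the pairs of attached sets whose labels are related. -/
def ExactR (r : ℕ → ℕ → Prop) (D : DNSP) : Prop :=
  ∀ A B, (A, B) ∈ D.R ↔ D.attached A = true ∧ D.attached B = true ∧ A ≠ B ∧ r A B

/-- The disjoint-set structure reflects the relation `r` on the strands up to `n`. -/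
structure Inv (r : ℕ → ℕ → Prop) (n : ℕ) (D : DNSP) : Prop where
  find_le : ∀ x ≤ n, D.find x ≤ n
  find_find : ∀ x ≤ n, D.find (D.find x) = D.find x
  label : ∀ A, D.attached A = true → A ≤ n ∧ D.find A = A
  exact : D.ExactR r
  -- Labels stand for whole sets: one path between the labels of distinct attached sets forces a
  -- path between any two members.
  uniform : ∀ x ≤ n, ∀ y ≤ n, D.isAttached x = true → D.isAttached y = true →
    D.find x ≠ D.find y → r (D.find x) (D.find y) → r x y
  -- Restricted to sets without attached successor: once closed, a set is never again the target of
  -- a query, and its recorded predecessor need not be maintained.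
  pred_att : ∀ v ≤ n, D.isAttached v = false → D.attSucc (D.find v) = none →
    D.attached (D.attPred (D.find v)) = true
  pred_le : ∀ v ≤ n, D.isAttached v = false → D.attSucc (D.find v) = none →
    ∀ x ≤ n, D.find x = D.attPred (D.find v) → r x v
  succ_att : ∀ u ≤ n, ∀ A, D.isAttached u = false → D.attSucc (D.find u) = some A →
    D.attached A = true ∧ ∃ y ≤ n, D.find y = A ∧ r u y
  -- As `r` is reflexive, the second alternative includes equality of the two attached sets.
  complete : ∀ u ≤ n, ∀ v ≤ n, ∀ A, r u v → D.Live v → D.succOf u = some A →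
    D.find u = D.find v ∨ r A (D.predOf v)

/-- `D'` arises from `D` by adding the singleton `{n + 1}`. -/
structure AddSingleton (n : ℕ) (D D' : DNSP) : Prop where
  find_new : D'.find (n + 1) = n + 1
  find_old : ∀ x ≤ n, D'.find x = D.find x
  -- The attributes of the new label and the relation `R` are left free, so that attached and
  -- unattached singletons share this description.
  attached_old : ∀ A, A ≠ n + 1 → D'.attached A = D.attached A
  attPred_old : ∀ A ≤ n, D'.attPred A = D.attPred A
  attSucc_old : ∀ A ≤ n, D'.attSucc A = D.attSucc A

namespace Inv

variable {r : ℕ → ℕ → Prop} {n : ℕ} {D D' : DNSP}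

theorem isAttached_label (h : D.Inv r n) {A : ℕ} (hA : D.attached A = true) :
    D.isAttached A = true := by
  rw [isAttached, (h.label A hA).2, hA]

theorem complete_att (h : D.Inv r n) {u v : ℕ} (hu : u ≤ n) (hv : v ≤ n)
    (hua : D.isAttached u = true) (huv : r u v) (hl : D.Live v) :
    D.find u = D.find v ∨ r (D.find u) (D.predOf v) :=
  h.complete u hu v hv _ huv hl (succOf_of_att hua)

/-- An attached label is a member of its own set, so completeness applies to it as a source. -/
theorem complete_label (h : D.Inv r n) {A v : ℕ} (hA : D.attached A = true) (hv : v ≤ n)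
    (huv : r A v) (hl : D.Live v) : A = D.find v ∨ r A (D.predOf v) := by
  have := h.complete_att (h.label A hA).1 hv (h.isAttached_label hA) huv hl
  rwa [(h.label A hA).2] at this

end Inv

section AddSingleton

variable {r : ℕ → ℕ → Prop} {n : ℕ} {D D' : DNSP}

theorem AddSingleton.isAttached_old (h : AddSingleton n D D') (hD : D.Inv r n) {x : ℕ}
    (hx : x ≤ n) : D'.isAttached x = D.isAttached x := by
  have := hD.find_le x hx
  rw [isAttached, h.find_old x hx, h.attached_old _ (by omega), isAttached]

theorem AddSingleton.live_old (h : AddSingleton n D D') (hD : D.Inv r n) {x : ℕ}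
    (hx : x ≤ n) : D'.Live x ↔ D.Live x := by
  rw [Live, Live, h.isAttached_old hD hx, h.find_old x hx, h.attSucc_old _ (hD.find_le x hx)]

theorem AddSingleton.predOf_old (h : AddSingleton n D D') (hD : D.Inv r n) {x : ℕ}
    (hx : x ≤ n) : D'.predOf x = D.predOf x := by
  rw [predOf, predOf, h.isAttached_old hD hx, h.find_old x hx, h.attPred_old _ (hD.find_le x hx)]

theorem AddSingleton.succOf_old (h : AddSingleton n D D') (hD : D.Inv r n) {x : ℕ}
    (hx : x ≤ n) : D'.succOf x = D.succOf x := by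
  rw [succOf, succOf, h.isAttached_old hD hx, h.find_old x hx, h.attSucc_old _ (hD.find_le x hx)]

theorem AddSingleton.eq_new (h : AddSingleton n D D') (hD : D.Inv r n) {x : ℕ} (hx : x ≤ n + 1)
    (he : D'.find x = n + 1) : x = n + 1 := by
  by_contra hne
  have := hD.find_le x (by omega)
  rw [h.find_old x (by omega)] at he
  omega

/-- Adding an attached singleton whose immediate predecessors are the last strands of attached
sets. -/
theorem Inv.addAttached (hr : StrandOrder r) (hD : D.Inv r n) (h : AddSingleton n D D')
    (hatt : D'.attached (n + 1) = true) (hR : D'.ExactR r) {ps : List ℕ} (hps : NewStrand r n ps)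
    (hp : ∀ p ∈ ps, p ≤ n ∧ D.isAttached p = true ∧ ∀ x ≤ n, D.find x = D.find p → r x p) :
    D'.Inv r (n + 1) := by
  have hnew : D'.isAttached (n + 1) = true := by rw [isAttached, h.find_new, hatt]
  have hlast : ∀ x, ∀ p ∈ ps, r x p → r x (n + 1) := fun x p hp hx =>
    (hps x).2 (Or.inr ⟨p, hp, hx⟩)
  have split : ∀ x ≤ n + 1, x ≤ n ∨ x = n + 1 := fun x hx => by omega
  refine ⟨?_, ?_, ?_, hR, ?_, ?_, ?_, ?_, ?_⟩
  · intro x hx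
    rcases split x hx with hx | rfl
    · rw [h.find_old x hx]; have := hD.find_le x hx; omega
    · rw [h.find_new]
  · intro x hx
    rcases split x hx with hx | rfl
    · rw [h.find_old x hx, h.find_old _ (hD.find_le x hx), hD.find_find x hx]
    · rw [h.find_new, h.find_new]
  · intro A hA
    by_cases hAn : A = n + 1
    · subst hAn; exact ⟨le_rfl, h.find_new⟩
    · rw [h.attached_old A hAn] at hA
      obtain ⟨h1, h2⟩ := hD.label A hA
      exact ⟨by omega, by rw [h.find_old A h1, h2]⟩
  · intro x hx y hy hxa hya hne hxy
    rcases split x hx with hx | rfl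
    · rw [h.isAttached_old hD hx] at hxa
      rcases split y hy with hy | rfl
      · rw [h.isAttached_old hD hy] at hya
        rw [h.find_old x hx, h.find_old y hy] at hne hxy
        exact hD.uniform x hx y hy hxa hya hne hxy
      · rw [h.find_new, h.find_old x hx] at hxy
        have hl := hD.find_le x hx
        -- The path from the label of `x` passes through some `p`. Completeness turns it into a path
        -- between labels, and uniformity extends that to `x` and `p`.
        rcases (hps _).1 hxy with he | ⟨p, hpp, hp'⟩
        · omega
        · obtain ⟨hpn, hpa, hpm⟩ := hp p hpp
          apply hlast x p hpp
          rcases hD.complete_label hxa hpn hp' (Or.inl hpa) with he | hl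
          · exact hpm x hx he
          · rw [predOf_of_att hpa] at hl
            by_cases he : D.find x = D.find p
            · exact hpm x hx he
            · exact hD.uniform x hx p hpn hxa hpa he hl
    · rcases split y hy with hy | rfl
      · rw [h.find_new, h.find_old y hy] at hxy
        have := hr.le hxy
        have := hD.find_le y hy
        omega
      · exact hr.refl _
  · intro v hv hva hvs
    rcases split v hv with hv | rfl
    · have hf := hD.find_le v hv
      rw [h.isAttached_old hD hv] at hva
      rw [h.find_old v hv, h.attSucc_old _ hf] at hvs
      have := hD.pred_att v hv hva hvs
      rw [h.find_old v hv, h.attPred_old _ hf, h.attached_old, this]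
      have := (hD.label _ this).1
      omega
    · simp [hnew] at hva
  · intro v hv hva hvs x hx hxv
    rcases split v hv with hv | rfl
    · have hf := hD.find_le v hv
      rw [h.isAttached_old hD hv] at hva
      rw [h.find_old v hv, h.attSucc_old _ hf] at hvs
      rw [h.find_old v hv, h.attPred_old _ hf] at hxv
      rcases split x hx with hx | rfl
      · rw [h.find_old x hx] at hxv
        exact hD.pred_le v hv hva hvs x hx hxv
      · have := (hD.label _ (hD.pred_att v hv hva hvs)).1
        rw [h.find_new] at hxv
        omega
    · simp [hnew] at hva
  · intro u hu A hua hus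
    rcases split u hu with hu | rfl
    · have hf := hD.find_le u hu
      rw [h.isAttached_old hD hu] at hua
      rw [h.find_old u hu, h.attSucc_old _ hf] at hus
      obtain ⟨h1, y, hy, h2, h3⟩ := hD.succ_att u hu A hua hus
      refine ⟨?_, y, by omega, by rw [h.find_old y hy, h2], h3⟩
      rw [h.attached_old, h1]
      have := (hD.label _ h1).1
      omega
    · simp [hnew] at hua
  · intro u hu v hv A huv hl hs
    rcases split u hu with hu | rfl
    · rw [h.succOf_old hD hu] at hs
      rcases split v hv with hv | rfl
      · rw [h.live_old hD hv] at hl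
        rw [h.find_old u hu, h.find_old v hv, h.predOf_old hD hv]
        exact hD.complete u hu v hv A huv hl hs
      · right
        rw [predOf_of_att hnew, h.find_new]
        rcases (hps _).1 huv with he | ⟨p, hpp, hp'⟩
        · omega
        · obtain ⟨hpn, hpa, hpm⟩ := hp p hpp
          apply hlast A p hpp
          have hfp : r (D.find p) p :=
            hpm _ (hD.find_le p hpn) (hD.find_find p hpn)
          rcases hD.complete u hu p hpn A hp' (Or.inl hpa) hs with he | hl'
          · rw [succOf_congr he, succOf_of_att hpa, Option.some.injEq] at hs
            rwa [← hs]
          · rw [predOf_of_att hpa] at hl'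
            exact hr.trans hl' hfp
    · have := hr.le huv
      obtain rfl : v = n + 1 := by omega
      left; rfl

/-- Adding an unattached singleton whose only immediate predecessor is `p`. -/
theorem Inv.addUnattached (hr : StrandOrder r) (hD : D.Inv r n) (h : AddSingleton n D D')
    (hatt : D'.attached (n + 1) = false) (hR : D'.R = D.R) {p : ℕ}
    (hpred : D'.attPred (n + 1) = D.predOf p) (hsucc : D'.attSucc (n + 1) = none)
    (hps : NewStrand r n [p]) (hpn : p ≤ n) (hpl : D.Live p)
    (hpm : ∀ x ≤ n, D.find x = D.find p → r x p) :
    D'.Inv r (n + 1) := by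
  have hnew : D'.isAttached (n + 1) = false := by rw [isAttached, h.find_new, hatt]
  have hlast : ∀ x, r x p → r x (n + 1) := fun x hx =>
    (hps x).2 (Or.inr ⟨p, by simp, hx⟩)
  have hpre : ∀ x ≤ n, r x (n + 1) → r x p := fun x hxn hx => by
    rcases (hps x).1 hx with he | ⟨q, hq, hxq⟩
    · omega
    · simp only [List.mem_singleton] at hq
      rwa [← hq]
  have split : ∀ x ≤ n + 1, x ≤ n ∨ x = n + 1 := fun x hx => by omega
  -- Attached labels are at most `n`, so the entry written at `n + 1` does not change `attached` as
  -- a function.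
  have hn : D.attached (n + 1) = false := by
    by_contra hne
    have := (hD.label (n + 1) (by simpa using hne)).1
    omega
  have hatt' : D'.attached = D.attached := by
    funext A
    by_cases hA : A = n + 1
    · rw [hA, hatt, hn]
    · exact h.attached_old A hA
  have hpatt : D.attached (D.predOf p) = true := by
    by_cases ha : D.isAttached p = true
    · rw [predOf_of_att ha]; exact ha
    · have ha' : D.isAttached p = false := by simpa using ha
      rw [predOf_of_unatt ha']
      exact hD.pred_att p hpn ha' (hpl.resolve_left ha)
  refine ⟨?_, ?_, ?_, ?_, ?_, ?_, ?_, ?_, ?_⟩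
  · intro x hx
    rcases split x hx with hx | rfl
    · rw [h.find_old x hx]; have := hD.find_le x hx; omega
    · rw [h.find_new]
  · intro x hx
    rcases split x hx with hx | rfl
    · rw [h.find_old x hx, h.find_old _ (hD.find_le x hx), hD.find_find x hx]
    · rw [h.find_new, h.find_new]
  · intro A hA
    rw [hatt'] at hA
    obtain ⟨h1, h2⟩ := hD.label A hA
    exact ⟨by omega, by rw [h.find_old A h1, h2]⟩
  · intro A B
    rw [hR, hatt']
    exact hD.exact A B
  · intro x hx y hy hxa hya hne hxy
    rcases split x hx with hx | rfl
    · rw [h.isAttached_old hD hx] at hxa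
      rcases split y hy with hy | rfl
      · rw [h.isAttached_old hD hy] at hya
        rw [h.find_old x hx, h.find_old y hy] at hne hxy
        exact hD.uniform x hx y hy hxa hya hne hxy
      · simp [hnew] at hya
    · simp [hnew] at hxa
  · intro v hv hva hvs
    rw [hatt']
    rcases split v hv with hv | rfl
    · have hf := hD.find_le v hv
      rw [h.isAttached_old hD hv] at hva
      rw [h.find_old v hv, h.attSucc_old _ hf] at hvs
      rw [h.find_old v hv, h.attPred_old _ hf]
      exact hD.pred_att v hv hva hvs
    · rwa [h.find_new, hpred]
  · intro v hv hva hvs x hx hxv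
    rcases split v hv with hv | rfl
    · have hf := hD.find_le v hv
      rw [h.isAttached_old hD hv] at hva
      rw [h.find_old v hv, h.attSucc_old _ hf] at hvs
      rw [h.find_old v hv, h.attPred_old _ hf] at hxv
      rcases split x hx with hx | rfl
      · rw [h.find_old x hx] at hxv
        exact hD.pred_le v hv hva hvs x hx hxv
      · have := (hD.label _ (hD.pred_att v hv hva hvs)).1
        rw [h.find_new] at hxv
        omega
    · rw [h.find_new, hpred] at hxv
      rcases split x hx with hx | rfl
      · apply hlast
        rw [h.find_old x hx] at hxv
        by_cases ha : D.isAttached p = true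
        · rw [predOf_of_att ha] at hxv
          exact hpm x hx hxv
        · have ha' : D.isAttached p = false := by simpa using ha
          rw [predOf_of_unatt ha'] at hxv
          exact hD.pred_le p hpn ha' (hpl.resolve_left ha) x hx hxv
      · exact hr.refl _
  · intro u hu A hua hus
    rw [hatt']
    rcases split u hu with hu | rfl
    · have hf := hD.find_le u hu
      rw [h.isAttached_old hD hu] at hua
      rw [h.find_old u hu, h.attSucc_old _ hf] at hus
      obtain ⟨h1, y, hy, h2, h3⟩ := hD.succ_att u hu A hua hus
      exact ⟨h1, y, by omega, by rw [h.find_old y hy, h2], h3⟩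
    · rw [h.find_new, hsucc] at hus
      simp at hus
  · intro u hu v hv A huv hl hs
    rcases split u hu with hu | rfl
    · rw [h.succOf_old hD hu] at hs
      rcases split v hv with hv | rfl
      · rw [h.live_old hD hv] at hl
        rw [h.find_old u hu, h.find_old v hv, h.predOf_old hD hv]
        exact hD.complete u hu v hv A huv hl hs
      · right
        rw [predOf_of_unatt hnew, h.find_new, hpred]
        -- The new strand shares the attached predecessor of `p`, its only way in, so completeness
        -- at `p` carries over. If `u` is in the set of `p`, that set must be attached, because an
        -- open one provides no `A`.
        rcases hD.complete u hu p hpn A (hpre u hu huv) hpl hs with he | hl'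
        · rw [succOf_congr he] at hs
          by_cases ha : D.isAttached p = true
          · rw [succOf_of_att ha, Option.some.injEq] at hs
            rw [predOf_of_att ha, hs]
            exact hr.refl _
          · have ha' : D.isAttached p = false := by simpa using ha
            rw [succOf_of_unatt ha', hpl.resolve_left ha] at hs
            simp at hs
        · exact hl'
    · have := hr.le huv
      obtain rfl : v = n + 1 := by omega
      left; rfl

end AddSingleton

end DNSP

/-! ### Blocks, their sinks and their exits. -/

/-- The state of a block of strands of a function instance: it is the one being executed or
suspended by a call, it ended with a spawn whose child has returned and is not joined yet, or it
makes up a whole spawned child that has returned and is not joined yet. -/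
inductive Status where
  | running
  | forked
  | returned
  deriving DecidableEq

/-- A block of strands of the instance `fn` from the strand `src` to the strand `snk`, which has the
edges to the strands in `exits`; `base` tells that `src` is the first strand of `fn`. -/
structure Sink where
  fn : ℕ
  src : ℕ
  snk : ℕ
  exits : List ℕ
  base : Bool
  status : Status

/-- The block `d` was left, or suspended, before the block `e` began. -/
structure Sink.After (r : ℕ → ℕ → Prop) (e d : Sink) : Prop where
  lt : d.snk < e.src
  -- The sink of a returned, unjoined child need not precede what follows it.
  rel : d.status ≠ .returned → r d.snk e.src
  -- An instance can own several blocks: all but its latest are forked, and only its first is a base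
  -- block.
  base : e.base = true → e.fn ≠ d.fn
  top : d.status ≠ .forked → e.fn ≠ d.fn

/-- How the sets of the source and of the sink of a block lie in the computation dag. -/
structure Sink.Inv (r : ℕ → ℕ → Prop) (n : ℕ) (D : DNSP) (e : Sink) : Prop where
  rel : r e.src e.snk
  snk_le : e.snk ≤ n
  src_min : ∀ x ≤ n, D.find x = D.find e.src → r e.src x
  snk_min : ∀ x ≤ n, D.find x = D.find e.snk → r e.src x
  snk_max : ∀ x ≤ n, D.find x = D.find e.snk → r x e.snk
  -- While a block with unattached source meets no create or get, its joins keep source and sink in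
  -- one open set.
  unatt : D.isAttached e.snk = false →
    D.find e.src = D.find e.snk ∧ D.attSucc (D.find e.snk) = none
  att : D.isAttached e.snk = true → D.isAttached e.src = true
  -- The separation property behind all later arguments. Targets in closed sets are exempt: those
  -- sets are no longer left by new paths that matter to a query.
  out : ∀ x ≤ n, ∀ y ≤ n, D.find x = D.find e.snk → r x y → D.Live y →
    D.find y = D.find e.snk ∨ ∃ s ∈ e.exits, r s y
  -- The sink is the only way into an exit. This later pushes paths that arrive at a source back to
  -- the fork.
  exits : ∀ s ∈ e.exits, r e.snk s ∧ ∀ x, r x s → x = s ∨ r x e.snk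
  returned : e.status = .returned → e.exits = []

namespace Sink

variable {r : ℕ → ℕ → Prop} {n : ℕ} {D D' : DNSP} {e e' : Sink}

theorem Inv.live (h : e.Inv r n D) : D.Live e.snk := by
  by_cases ha : D.isAttached e.snk = true
  · exact Or.inl ha
  · exact Or.inr (h.unatt (by simpa using ha)).2

/-- Applied to a returning future, whose first strand was entered as attached, this shows that its
last strand is attached. -/
theorem Inv.att_iff (h : e.Inv r n D) : D.isAttached e.src = D.isAttached e.snk := by
  by_cases ha : D.isAttached e.snk = true
  · rw [ha, h.att ha]
  · exact DNSP.isAttached_congr (h.unatt (by simpa using ha)).1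

theorem Inv.src_le (hr : StrandOrder r) (h : e.Inv r n D) : e.src ≤ n :=
  (hr.le h.rel).trans h.snk_le

/-- Strands from the source of a later block on are not in the set of an earlier sink. -/
theorem Inv.find_ne (hr : StrandOrder r) (h : e'.Inv r n D) (ha : e.After r e') {z : ℕ}
    (hz : z ≤ n) (hez : e.src ≤ z) : D.find z ≠ D.find e'.snk := by
  intro hf
  have := hr.le (h.snk_max z hz hf)
  have := ha.lt
  omega

/-- The invariant of a block is kept if its sink set does not change, up to new exits. -/
theorem Inv.mono {n' : ℕ} (h : e.Inv r n D) (hn : n ≤ n') (hsrc : e'.src = e.src)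
    (hsnk : e'.snk = e.snk)
    (hex : ∀ s ∈ e.exits, s ∈ e'.exits)
    (hex' : ∀ s ∈ e'.exits, r e.snk s ∧ ∀ x, r x s → x = s ∨ r x e.snk)
    (hret : e'.status = .returned → e'.exits = [])
    (hset : ∀ x ≤ n', D'.find x = D'.find e.snk ↔ x ≤ n ∧ D.find x = D.find e.snk)
    (hatt : D'.isAttached e.snk = D.isAttached e.snk)
    (hsucc : D.isAttached e.snk = false → D'.attSucc (D'.find e.snk) = D.attSucc (D.find e.snk))
    (hsatt : D.isAttached e.src = true → D'.isAttached e.src = true)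
    (hmin : ∀ x ≤ n', D'.find x = D'.find e.src → r e.src x)
    -- Sets may lose liveness but do not regain it, so `out` has no new old targets.
    (hlive : ∀ y ≤ n, D'.Live y → D.Live y)
    (hnew : ∀ x ≤ n, ∀ y ≤ n', n < y → D.find x = D.find e.snk → r x y →
      ∃ s ∈ e'.exits, r s y)
    (hle : e.src ≤ n) :
    e'.Inv r n' D' := by
  constructor
  · rw [hsrc, hsnk]; exact h.rel
  · rw [hsnk]; exact h.snk_le.trans hn
  · rw [hsrc]; exact hmin
  · intro x hx hf
    rw [hsnk, hset x hx] at hf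
    rw [hsrc]; exact h.snk_min x hf.1 hf.2
  · intro x hx hf
    rw [hsnk, hset x hx] at hf
    rw [hsnk]; exact h.snk_max x hf.1 hf.2
  · intro ha
    rw [hsnk, hatt] at ha
    obtain ⟨h1, h2⟩ := h.unatt ha
    rw [hsnk, hsrc, hset _ (hle.trans hn), hsucc ha]
    exact ⟨⟨hle, h1⟩, h2⟩
  · intro ha
    rw [hsnk, hatt] at ha
    rw [hsrc]; exact hsatt (h.att ha)
  · intro x hx y hy hf hxy hl
    rw [hsnk, hset x hx] at hf
    rw [hsnk, hset y hy]
    by_cases hyn : y ≤ n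
    · rcases h.out x hf.1 y hyn hf.2 hxy (hlive y hyn hl) with h1 | ⟨s, hs, hsy⟩
      · exact Or.inl ⟨hyn, h1⟩
      · exact Or.inr ⟨s, hex s hs, hsy⟩
    · exact Or.inr (hnew x hf.1 y hy (by omega) hf.2 hxy)
  · rw [hsnk]; exact hex'
  · exact hret

/-- Adding a singleton keeps the invariant of a block, up to new exits. -/
theorem Inv.addSingleton (h : e.Inv r n D) (hr : StrandOrder r) (hD : D.Inv r n)
    (hA : DNSP.AddSingleton n D D') (hsrc : e'.src = e.src)
    (hsnk : e'.snk = e.snk)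
    (hex : ∀ s ∈ e.exits, s ∈ e'.exits)
    (hex' : ∀ s ∈ e'.exits, r e.snk s ∧ ∀ x, r x s → x = s ∨ r x e.snk)
    (hret : e'.status = .returned → e'.exits = []) {ps : List ℕ} (hps : NewStrand r n ps)
    (hp : ∀ p ∈ ps, p ≤ n ∧ D.Live p ∧ (D.find p ≠ D.find e.snk ∨ n + 1 ∈ e'.exits)) :
    e'.Inv r (n + 1) D' := by
  have hl := h.src_le hr
  have hset : ∀ z ≤ n, ∀ x ≤ n + 1,
      D'.find x = D'.find z ↔ x ≤ n ∧ D.find x = D.find z := by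
    intro z hz x hx
    rw [hA.find_old z hz]
    by_cases hxn : x ≤ n
    · rw [hA.find_old x hxn]; simp [hxn]
    · obtain rfl : x = n + 1 := by omega
      have := hD.find_le z hz
      rw [hA.find_new]
      simp only [hxn, false_and, iff_false]
      omega
  refine h.mono (by omega) hsrc hsnk hex hex' hret (hset _ h.snk_le)
    (hA.isAttached_old hD h.snk_le) ?_ ?_ ?_ (fun y hy => (hA.live_old hD hy).1) ?_ hl
  · intro _
    rw [hA.find_old _ h.snk_le, hA.attSucc_old _ (hD.find_le _ h.snk_le)]
  · rw [hA.isAttached_old hD hl]; exact id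
  · intro x hx hf
    rw [hset _ hl x hx] at hf
    exact h.src_min x hf.1 hf.2
  · intro x hx y hy hny hf hxy
    obtain rfl : y = n + 1 := by omega
    -- A path into the new strand arrives through some `p`. If `p` is outside the sink set, an exit
    -- lies on the way already; otherwise the new strand is itself an exit.
    rcases (hps x).1 hxy with he | ⟨p, hpp, hxp⟩
    · omega
    · obtain ⟨hpn, hpl, hpf⟩ := hp p hpp
      rcases hpf with hpf | hpf
      · rcases h.out x hx p hpn hf hxp hpl with h1 | ⟨s, hs, hsp⟩
        · exact absurd h1 hpf
        · exact ⟨s, hex s hs, (hps s).2 (Or.inr ⟨p, hpp, hsp⟩)⟩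
      · exact ⟨n + 1, hpf, hr.refl _⟩

/-- A block that consists of the new strand only. -/
theorem Inv.singleton (hr : StrandOrder r) (hD : D.Inv r n) (hA : DNSP.AddSingleton n D D')
    (hsrc : e.src = n + 1) (hsnk : e.snk = n + 1) (hex : e.exits = [])
    (hsucc : D'.attached (n + 1) = false → D'.attSucc (n + 1) = none) :
    e.Inv r (n + 1) D' := by
  have hone : ∀ x ≤ n + 1, D'.find x = D'.find (n + 1) → x = n + 1 := fun x hx hf =>
    hA.eq_new hD hx (hf.trans hA.find_new)
  have hone' : ∀ x ≤ n + 1, D'.find x = D'.find (n + 1) → r (n + 1) x ∧ r x (n + 1) := by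
    intro x hx hf
    obtain rfl := hone x hx hf
    exact ⟨hr.refl _, hr.refl _⟩
  constructor
  · rw [hsrc, hsnk]; exact hr.refl _
  · rw [hsnk]
  · rw [hsrc]; exact fun x hx hf => (hone' x hx hf).1
  · rw [hsrc, hsnk]; exact fun x hx hf => (hone' x hx hf).1
  · rw [hsnk]; exact fun x hx hf => (hone' x hx hf).2
  · rw [hsrc, hsnk, DNSP.isAttached, hA.find_new]
    exact fun ha => ⟨rfl, hsucc ha⟩
  · rw [hsrc, hsnk]; exact id
  · intro x hx y hy hf hxy _
    rw [hsnk] at hf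
    obtain rfl := hone x hx hf
    have := hr.le hxy
    obtain rfl : y = n + 1 := by omega
    rw [hsnk]; exact Or.inl rfl
  · simp [hex]
  · exact fun _ => hex

/-- A block with attached source, extended by the new strand as an attached singleton. -/
theorem Inv.extend (h : e.Inv r n D) (hr : StrandOrder r) (hD : D.Inv r n)
    (hA : DNSP.AddSingleton n D D') (hatt : D'.attached (n + 1) = true)
    (hsrc : e'.src = e.src) (hsnk : e'.snk = n + 1) (hex : e'.exits = [])
    (hsatt : D.isAttached e.src = true) (hnew : r e.src (n + 1)) :
    e'.Inv r (n + 1) D' := by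
  have hone : ∀ x ≤ n + 1, D'.find x = D'.find (n + 1) → x = n + 1 := fun x hx hf =>
    hA.eq_new hD hx (hf.trans hA.find_new)
  have hl := h.src_le hr
  constructor
  · rw [hsrc, hsnk]; exact hnew
  · rw [hsnk]
  · intro x hx hf
    rw [hsrc] at hf ⊢
    by_cases hxn : x ≤ n
    · rw [hA.find_old x hxn, hA.find_old _ hl] at hf
      exact h.src_min x hxn hf
    · obtain rfl : x = n + 1 := by omega
      exact hnew
  · intro x hx hf
    rw [hsnk] at hf
    obtain rfl := hone x hx hf
    rw [hsrc]; exact hnew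
  · intro x hx hf
    rw [hsnk] at hf
    obtain rfl := hone x hx hf
    rw [hsnk]; exact hr.refl _
  · rw [hsnk, DNSP.isAttached, hA.find_new, hatt]
    intro ha; simp at ha
  · intro _
    rw [hsrc, hA.isAttached_old hD hl]; exact hsatt
  · intro x hx y hy hf hxy _
    rw [hsnk] at hf
    obtain rfl := hone x hx hf
    have := hr.le hxy
    obtain rfl : y = n + 1 := by omega
    rw [hsnk]; exact Or.inl rfl
  · simp [hex]
  · exact fun _ => hex

end Sink

/-! ### The joint invariant of all blocks, and attaching a sink set. -/

/-- The invariant of `D_NSP` with respect to the blocks `L` of the execution, the most recent one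
first, and the last strands `fut` of the completed futures. -/
structure Core (r : ℕ → ℕ → Prop) (n : ℕ) (L : List Sink) (fut : Set ℕ) (D : DNSP) : Prop where
  nsp : D.Inv r n
  sink : ∀ e ∈ L, e.Inv r n D
  order : L.Pairwise (Sink.After r)
  -- A negative answer for lack of an attached successor can thus be analysed block by block.
  open_sink : ∀ u ≤ n, D.isAttached u = false → D.attSucc (D.find u) = none →
    ∃ e ∈ L, D.find u = D.find e.snk
  fut_le : ∀ t ∈ fut, t ≤ n
  fut_att : ∀ t ∈ fut, D.isAttached t = true
  fut_max : ∀ t ∈ fut, ∀ x ≤ n, D.find x = D.find t → r x t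
  -- Together with `fut_max` this keeps completed futures out of all sink sets, so a get opens no
  -- unrecorded way out of one.
  fut_ne : ∀ t ∈ fut, ∀ e ∈ L, e.snk ≠ t

namespace Core

variable {D D' : DNSP} {r : ℕ → ℕ → Prop} {n : ℕ} {L L' : List Sink} {fut fut' : Set ℕ}

/-- A completed future is not in the set of a sink. -/
theorem fut_find_ne (h : Core r n L fut D) (hr : StrandOrder r) {t : ℕ} (ht : t ∈ fut) {e : Sink}
    (he : e ∈ L) : D.find t ≠ D.find e.snk := fun hf =>
  h.fut_ne t ht e he (hr.antisymm (h.fut_max t ht _ (h.sink e he).snk_le hf.symm)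
    ((h.sink e he).snk_max t (h.fut_le t ht) hf))

/-- The sets of two sinks are distinct. -/
theorem find_snk_inj (h : Core r n L fut D) (hr : StrandOrder r) {e e' : Sink}
    (he : e ∈ L) (he' : e' ∈ L) (hne : e.snk ≠ e'.snk) : D.find e.snk ≠ D.find e'.snk := fun hf =>
  hne (hr.antisymm ((h.sink e' he').snk_max _ (h.sink e he).snk_le hf)
    ((h.sink e he).snk_max _ (h.sink e' he').snk_le hf.symm))

/-- Making the set of a sink attached, if all exits of the block are in attached sets. -/
theorem attach (h : Core r n L fut D) (hr : StrandOrder r) {e : Sink} (he : e ∈ L)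
    (hua : D.isAttached e.snk = false)
    (hex : ∀ s ∈ e.exits, s ≤ n ∧ D.isAttached s = true ∧
      ∀ x ≤ n, D.find x = D.find s → r s x)
    (hfind : D'.find = D.find)
    (hatt : D'.attached = Function.update D.attached (D.find e.snk) true)
    (hpred : D'.attPred = D.attPred) (hsucc : D'.attSucc = D.attSucc) (hR : D'.ExactR r) :
    Core r n L fut D' := by
  have hD := h.nsp
  have hE := h.sink e he
  have hUn := hD.find_le _ hE.snk_le
  have hUU := hD.find_find _ hE.snk_le
  set U := D.find e.snk with hU
  have hUna : D.attached U = false := hua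
  have hnosucc : D.attSucc U = none := (hE.unatt hua).2
  have hA : ∀ x, D'.isAttached x = if D.find x = U then true else D.isAttached x := by
    intro x
    rw [DNSP.isAttached, hfind, hatt, Function.update_apply]; rfl
  have hattne : ∀ x, D.isAttached x = true → D.find x ≠ U := by
    intro x hx hf
    rw [DNSP.isAttached, hf, hUna] at hx
    simp at hx
  have hA1 : ∀ x, D.find x ≠ U → D'.isAttached x = D.isAttached x := fun x hx => by
    rw [hA, if_neg hx]
  have hA2 : ∀ x, D.isAttached x = true → D'.isAttached x = true := fun x hx => by
    rw [hA1 x (hattne x hx), hx]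
  have hA3 : ∀ x, D'.isAttached x = false → D.isAttached x = false ∧ D.find x ≠ U := by
    intro x hx
    rw [hA] at hx
    by_cases hf : D.find x = U
    · simp [hf] at hx
    · simpa [hf] using hx
  have hlab : ∀ A, D.attached A = true → D'.attached A = true := fun A hA => by
    rw [hatt, Function.update_apply]; split <;> simp [hA]
  -- The sink set had no attached successor, so it was live already and attaching it changes no
  -- liveness.
  have hlive : ∀ y, D'.Live y ↔ D.Live y := by
    intro y
    rw [DNSP.Live, DNSP.Live, hA, hfind, hsucc]
    by_cases hf : D.find y = U
    · simp [hf, hnosucc]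
    · simp [hf]
  have hUlive : D.Live U := Or.inr (by rw [hUU, hnosucc])
  have hUunatt : D.isAttached U = false := by rw [DNSP.isAttached, hUU, hUna]
  have hPatt := hD.pred_att _ hE.snk_le hua hnosucc
  have hPle := hD.pred_le U hUn hUunatt (by rw [hUU, hnosucc])
  rw [hUU] at hPle
  have hpredU : D.predOf U = D.attPred U := by rw [DNSP.predOf_of_unatt hUunatt, hUU]
  have hPU : r (D.attPred U) U := hPle _ (hD.label _ hPatt).1 (hD.label _ hPatt).2
  have hpo : ∀ v, D.find v ≠ U → D'.predOf v = D.predOf v := by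
    intro v hv
    rw [DNSP.predOf, DNSP.predOf, hA1 v hv, hfind, hpred]
  have hso : ∀ v, D.find v ≠ U → D'.succOf v = D.succOf v := by
    intro v hv
    rw [DNSP.succOf, DNSP.succOf, hA1 v hv, hfind, hsucc]
  have hUsnk : r U e.snk := hE.snk_max U hUn hUU
  have hnsp : D'.Inv r n := by
    refine ⟨by rw [hfind]; exact hD.find_le, by rw [hfind]; exact hD.find_find, ?_, hR, ?_, ?_, ?_,
      ?_, ?_⟩
    · intro A hAA
      rw [hfind]
      by_cases hAU : A = U
      · rw [hAU]; exact ⟨hUn, hUU⟩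
      · rw [hatt, Function.update_of_ne hAU] at hAA
        exact hD.label A hAA
    · intro x hx y hy hxa hya hne hxy
      rw [hfind] at hne hxy
      by_cases hxU : D.find x = U
      · have hyU : D.find y ≠ U := fun hf => hne (hxU.trans hf.symm)
        rw [hA1 y hyU] at hya
        have hyl := hD.label _ hya
        rw [hxU] at hxy
        -- A path from `U` to another attached label passes an exit `s`. The set of `s` is attached
        -- and all of it follows `s`, so uniformity between the sets of `s` and `y` finishes the
        -- case.
        rcases hE.out U hUn _ hyl.1 hUU hxy (Or.inl (hD.isAttached_label hya)) with h1 | ⟨s, hs, hsy⟩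
        · rw [hyl.2] at h1; exact absurd h1 hyU
        · obtain ⟨hsn, hsa, hsm⟩ := hex s hs
          have hxs : r x s := hr.trans (hE.snk_max x hx hxU) (hE.exits s hs).1
          refine hr.trans hxs ?_
          by_cases hsy' : D.find s = D.find y
          · exact hsm y hy hsy'.symm
          · rcases hD.complete_att hsn hyl.1 hsa hsy (Or.inl (hD.isAttached_label hya)) with h1 | h1
            · rw [hyl.2] at h1; exact absurd h1 hsy'
            · rw [DNSP.predOf_of_att (hD.isAttached_label hya), hyl.2] at h1
              exact hD.uniform s hsn y hy hsa hya hsy' h1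
      · rw [hA1 x hxU] at hxa
        by_cases hyU : D.find y = U
        -- A path from another attached label into `U` comes through the attached predecessor of
        -- `U`, all of whose set precedes each member of `U`.
        · have hP : r (D.find x) (D.attPred U) := by
            rw [hyU] at hxy
            rcases hD.complete_label hxa hUn hxy hUlive with h1 | h1
            · rw [hUU] at h1; exact absurd h1 hxU
            · rwa [hpredU] at h1
          have hyl : D.isAttached y = false := by rw [DNSP.isAttached, hyU, hUna]
          have hyP := hD.pred_le y hy hyl (by rw [hyU, hnosucc])
          rw [hyU] at hyP
          by_cases hxP : D.find x = D.attPred U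
          · exact hyP x hx hxP
          · have hPl := hD.label _ hPatt
            have := hD.uniform x hx _ hPl.1 hxa (hD.isAttached_label hPatt)
              (by rwa [hPl.2]) (by rwa [hPl.2])
            exact hr.trans this (hyP _ hPl.1 hPl.2)
        · rw [hA1 y hyU] at hya
          exact hD.uniform x hx y hy hxa hya hne hxy
    · intro v hv hva hvs
      rw [hfind, hsucc] at hvs
      rw [hfind, hpred]
      exact hlab _ (hD.pred_att v hv (hA3 v hva).1 hvs)
    · intro v hv hva hvs
      rw [hfind, hsucc] at hvs
      rw [hfind, hpred]
      exact hD.pred_le v hv (hA3 v hva).1 hvs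
    · intro u hu A hua' hus
      rw [hfind, hsucc] at hus
      rw [hfind]
      obtain ⟨h1, h2⟩ := hD.succ_att u hu A (hA3 u hua').1 hus
      exact ⟨hlab _ h1, h2⟩
    · intro u hu v hv A huv hl hs
      rw [hlive] at hl
      rw [hfind]
      by_cases huU : D.find u = U
      · have hu' : D'.isAttached u = true := by rw [hA, if_pos huU]
        rw [DNSP.succOf_of_att hu', hfind, huU, Option.some.injEq] at hs
        subst hs
        by_cases hvU : D.find v = U
        · exact Or.inl (huU.trans hvU.symm)
        · right
          rw [hpo v hvU]
          rcases hE.out u hu v hv huU huv hl with h1 | ⟨s, hs, hsv⟩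
          · exact absurd h1 hvU
          · obtain ⟨hsn, hsa, hsm⟩ := hex s hs
            have hUs : r U (D.find s) := hr.trans (hr.trans hUsnk (hE.exits s hs).1)
              (hsm _ (hD.find_le s hsn) (hD.find_find s hsn))
            rcases hD.complete_att hsn hv hsa hsv hl with h1 | h1
            · rw [DNSP.predOf_of_att (DNSP.isAttached_congr h1 ▸ hsa), ← h1]
              exact hUs
            · exact hr.trans hUs h1
      · rw [hso u huU] at hs
        by_cases hvU : D.find v = U
        · right
          have hv' : D'.isAttached v = true := by rw [hA, if_pos hvU]
          rw [DNSP.predOf_of_att hv', hfind, hvU]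
          rcases hD.complete u hu v hv A huv hl hs with h1 | h1
          · exact absurd (h1.trans hvU) huU
          · rw [DNSP.predOf_congr (hvU.trans hUU.symm), hpredU] at h1
            exact hr.trans h1 hPU
        · rw [hpo v hvU]
          exact hD.complete u hu v hv A huv hl hs
  refine ⟨hnsp, ?_, h.order, ?_, h.fut_le, fun t ht => hA2 t (h.fut_att t ht), ?_, h.fut_ne⟩
  · intro e' he'
    have hE' := h.sink e' he'
    constructor
    · exact hE'.rel
    · exact hE'.snk_le
    · rw [hfind]; exact hE'.src_min
    · rw [hfind]; exact hE'.snk_min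
    · rw [hfind]; exact hE'.snk_max
    · intro ha
      rw [hfind, hsucc]
      exact hE'.unatt (hA3 _ ha).1
    · intro ha
      by_cases hf : D.find e'.snk = U
      · have : D.isAttached e'.snk = false := by rw [DNSP.isAttached, hf, hUna]
        rw [hA, (hE'.unatt this).1, if_pos hf]
      · rw [hA1 _ hf] at ha
        exact hA2 _ (hE'.att ha)
    · intro x hx y hy hf hxy hl
      rw [hlive] at hl
      rw [hfind] at hf ⊢
      exact hE'.out x hx y hy hf hxy hl
    · exact hE'.exits
    · exact hE'.returned
  · intro u hu hua' hus
    rw [hfind, hsucc] at hus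
    rw [hfind]
    exact h.open_sink u hu (hA3 u hua').1 hus
  · rw [hfind]; exact h.fut_max

end Core

/-! ### Joins that merge sets. -/

/-- The strand `n + 1` joins the blocks `a` and `b` that were forked by the block `f`; `rest` are the
other blocks. -/
structure JoinAt (r : ℕ → ℕ → Prop) (n : ℕ) (L : List Sink) (a b f : Sink) (rest : List Sink) :
    Prop where
  mem_a : a ∈ L
  mem_b : b ∈ L
  mem_f : f ∈ L
  mem_rest : ∀ e ∈ rest, e ∈ L
  cover : ∀ e ∈ L, e = a ∨ e = b ∨ e = f ∨ e ∈ rest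
  exits_a : a.exits = []
  exits_b : b.exits = []
  exits_f : ∀ s, s ∈ f.exits ↔ s = a.src ∨ s = b.src
  lt_a : f.snk < a.src
  lt_b : f.snk < b.src
  ne : a.snk ≠ b.snk
  after : ∀ e ∈ rest, f.After r e
  order : rest.Pairwise (Sink.After r)
  new : ∀ x, r x (n + 1) ↔ x = n + 1 ∨ r x a.snk ∨ r x b.snk

namespace JoinAt

variable {r : ℕ → ℕ → Prop} {n : ℕ} {L rest : List Sink} {fut : Set ℕ} {D D' : DNSP}
  {a b f : Sink}

/-- The mixed join is proved only for attached `a` and unattached `b`; the other orientation is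
obtained from this symmetry. -/
theorem symm (J : JoinAt r n L a b f rest) : JoinAt r n L b a f rest where
  mem_a := J.mem_b
  mem_b := J.mem_a
  mem_f := J.mem_f
  mem_rest := J.mem_rest
  cover e he := by rcases J.cover e he with h | h | h | h <;> simp [h]
  exits_a := J.exits_b
  exits_b := J.exits_a
  exits_f s := by rw [J.exits_f, or_comm]
  lt_a := J.lt_b
  lt_b := J.lt_a
  ne := J.ne.symm
  after := J.after
  order := J.order
  new x := by rw [J.new, or_comm (a := r x a.snk)]

/-- The strands whose sets take part in the join. -/
def Part (a b f : Sink) (z : ℕ) : Prop :=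
  z = f.snk ∨ z = a.snk ∨ z = b.snk ∨ z = a.src ∨ z = b.src

/-- The other blocks end before `f` begins, while all strands that take part are at or after
`f.src`. The minima and maxima of the sets then keep them apart. -/
theorem find_ne (J : JoinAt r n L a b f rest) (hr : StrandOrder r) (h : Core r n L fut D)
    {z : ℕ} (hz : Part a b f z) {e : Sink} (he : e ∈ rest) :
    D.find z ≠ D.find e.snk ∧ D.find e.src ≠ D.find z := by
  have hf := h.sink f J.mem_f
  have ha := h.sink a J.mem_a
  have hb := h.sink b J.mem_b
  have hE := h.sink e (J.mem_rest e he)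
  have h1 := hr.le hf.rel
  have h2 := hr.le ha.rel
  have h3 := hr.le hb.rel
  have h4 := hr.le hE.rel
  have h5 := (J.after e he).lt
  have h6 := J.lt_a
  have h7 := J.lt_b
  have h8 := hf.snk_le
  have h9 := ha.snk_le
  have h10 := hb.snk_le
  refine ⟨hE.find_ne hr (J.after e he) ?_ ?_, ?_⟩
  · rcases hz with rfl | rfl | rfl | rfl | rfl <;> omega
  · rcases hz with rfl | rfl | rfl | rfl | rfl <;> omega
  · intro hfe
    rcases hz with rfl | rfl | rfl | rfl | rfl
    · have := hr.le (hf.snk_min e.src (by omega) hfe); omega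
    · have := hr.le (ha.snk_min e.src (by omega) hfe); omega
    · have := hr.le (hb.snk_min e.src (by omega) hfe); omega
    · have := hr.le (ha.src_min e.src (by omega) hfe); omega
    · have := hr.le (hb.src_min e.src (by omega) hfe); omega

/-- The join keeps the invariants of the other blocks. -/
theorem sink_rest (J : JoinAt r n L a b f rest) (hr : StrandOrder r) (h : Core r n L fut D)
    -- Labels may move only among the sets that take part, a condition met by both merging joins.
    (hold : ∀ x ≤ n, D'.find x = D.find x ∨
      ∃ z z', Part a b f z ∧ Part a b f z' ∧ D.find x = D.find z' ∧ D'.find x = D.find z)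
    (hnew : ∃ z, Part a b f z ∧ D'.find (n + 1) = D.find z)
    (hatt : D'.attached = D.attached)
    (hsucc : ∀ A, (∀ z, Part a b f z → A ≠ D.find z) → D'.attSucc A = D.attSucc A)
    (hsatt : ∀ x ≤ n, D.isAttached x = true → D'.isAttached x = true)
    (hlive : ∀ y ≤ n, D'.Live y → D.Live y) {e : Sink} (he : e ∈ rest) :
    e.Inv r (n + 1) D' := by
  have hE := h.sink e (J.mem_rest e he)
  have hne := fun z hz => J.find_ne hr h (z := z) hz he
  have hl := hE.src_le hr
  have hsnk : D'.find e.snk = D.find e.snk := by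
    rcases hold _ hE.snk_le with h1 | ⟨z, z', _, hz', h1, _⟩
    · exact h1
    · exact absurd h1.symm (hne z' hz').1
  have hsrc : D'.find e.src = D.find e.src := by
    rcases hold _ hl with h1 | ⟨z, z', _, hz', h1, _⟩
    · exact h1
    · exact absurd h1 (hne z' hz').2
  have hset : ∀ x ≤ n + 1, D'.find x = D'.find e.snk ↔ x ≤ n ∧ D.find x = D.find e.snk := by
    intro x hx
    rw [hsnk]
    by_cases hxn : x ≤ n
    · rcases hold x hxn with h1 | ⟨z, z', hz, hz', h1, h2⟩
      · rw [h1]; simp [hxn]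
      · rw [h1, h2]
        exact iff_of_false (hne z hz).1 fun hc => (hne z' hz').1 hc.2
    · obtain rfl : x = n + 1 := by omega
      obtain ⟨z, hz, hz'⟩ := hnew
      rw [hz']
      exact iff_of_false (hne z hz).1 fun hc => hxn hc.1
  refine hE.mono (by omega) rfl rfl (fun _ => id) hE.exits hE.returned hset ?_ ?_ (hsatt _ hl) ?_
    hlive ?_ hl
  · rw [DNSP.isAttached, DNSP.isAttached, hsnk, hatt]
  · intro _
    rw [hsnk, hsucc _ fun z hz => (hne z hz).1.symm]
  · intro x hx hf
    rw [hsrc] at hf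
    by_cases hxn : x ≤ n
    · rcases hold x hxn with h1 | ⟨z, z', hz, hz', h1, h2⟩
      · exact hE.src_min x hxn (h1 ▸ hf)
      · exact absurd (hf.symm.trans h2) (hne z hz).2
    · obtain rfl : x = n + 1 := by omega
      obtain ⟨z, hz, hz'⟩ := hnew
      exact absurd (hf.symm.trans hz') (hne z hz).2
  · intro x hx y hy hny hf hxy
    obtain rfl : y = n + 1 := by omega
    -- A path from the sink set of `e` to the join strand passes the sink of `a` or `b`. That sink
    -- is live and outside the set, so an exit of `e` already lies on the path.
    have key : ∀ c ∈ L, Part a b f c.snk → r x c.snk → r c.snk (n + 1) →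
        ∃ s ∈ e.exits, r s (n + 1) := by
      intro c hc hp hxc hcn
      have hC := h.sink c hc
      rcases hE.out x hx c.snk hC.snk_le hf hxc hC.live with h1 | ⟨s, hs, hsc⟩
      · exact absurd h1 (hne _ hp).1
      · exact ⟨s, hs, hr.trans hsc hcn⟩
    rcases (J.new x).1 hxy with h1 | h1 | h1
    · omega
    · exact key a J.mem_a (by simp [Part]) h1 ((J.new _).2 (Or.inr (Or.inl (hr.refl _))))
    · exact key b J.mem_b (by simp [Part]) h1 ((J.new _).2 (Or.inr (Or.inr (hr.refl _))))

/-- The joined block keeps the source, the instance and the base flag of `f`, and `Sink.After` reads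
nothing else of its later block. -/
theorem after_new (J : JoinAt r n L a b f rest) {e : Sink} (hfn : e.fn = f.fn)
    (hsrc : e.src = f.src) (hbase : e.base = f.base) :
    (e :: rest).Pairwise (Sink.After r) := by
  refine List.pairwise_cons.2 ⟨fun e' he' => ?_, J.order⟩
  obtain ⟨h1, h2, h3, h4⟩ := J.after e' he'
  exact ⟨hsrc ▸ h1, hsrc ▸ h2, by rw [hbase, hfn]; exact h3, hfn ▸ h4⟩

/-- The join of an attached block `a` and an unattached block `b`. -/
theorem one (J : JoinAt r n L a b f rest) (hr : StrandOrder r) (h : Core r n L fut D)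
    (haa : D.isAttached a.snk = true) (hba : D.isAttached b.snk = false)
    (hmov : ∀ x ≤ n, D.isAttached f.snk = false → D.find x = D.find f.snk →
      D'.find x = D.find a.src)
    (hstay : ∀ x ≤ n, ¬ (D.isAttached f.snk = false ∧ D.find x = D.find f.snk) →
      D'.find x = D.find x)
    (hnew : D'.find (n + 1) = D.find a.snk)
    (hatt : D'.attached = D.attached) (hpred : D'.attPred = D.attPred)
    (hsucc : D'.attSucc = Function.update D.attSucc (D.find b.snk) (some (D.find a.snk)))
    (hR : D'.R = D.R) {e : Sink} (hfn : e.fn = f.fn) (hsrc : e.src = f.src) (hsnk : e.snk = n + 1)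
    (hbase : e.base = f.base) (hexits : e.exits = []) :
    Core r (n + 1) (e :: rest) fut D' ∧
      ∀ x ≤ n, D.isAttached x = true → D'.isAttached x = true := by
  have hD := h.nsp
  have hF := h.sink f J.mem_f
  have hA := h.sink a J.mem_a
  have hB := h.sink b J.mem_b
  have hsa : D.isAttached a.src = true := hA.att haa
  have hasn := hA.src_le hr
  have hbsn := hB.src_le hr
  obtain ⟨hbs, hbsucc⟩ := hB.unatt hba
  have hfa : r f.snk a.src := (hF.exits _ ((J.exits_f _).2 (Or.inl rfl))).1
  have hap : ∀ x, r x a.src → x = a.src ∨ r x f.snk :=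
    (hF.exits _ ((J.exits_f _).2 (Or.inl rfl))).2
  have hbp : ∀ x, r x b.src → x = b.src ∨ r x f.snk :=
    (hF.exits _ ((J.exits_f _).2 (Or.inr rfl))).2
  have han : r a.snk (n + 1) := (J.new _).2 (Or.inr (Or.inl (hr.refl _)))
  have hbn : r b.snk (n + 1) := (J.new _).2 (Or.inr (Or.inr (hr.refl _)))
  have hfn' : r f.snk a.snk := hr.trans hfa hA.rel
  -- the sink sets are closed under live successors
  have ha_out : ∀ x ≤ n, ∀ y ≤ n, D.find x = D.find a.snk → r x y → D.Live y →
      D.find y = D.find a.snk := fun x hx y hy h1 h2 h3 => by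
    simpa [J.exits_a] using hA.out x hx y hy h1 h2 h3
  have hb_out : ∀ x ≤ n, ∀ y ≤ n, D.find x = D.find b.snk → r x y → D.Live y →
      D.find y = D.find b.snk := fun x hx y hy h1 h2 h3 => by
    simpa [J.exits_b] using hB.out x hx y hy h1 h2 h3
  have hf_out : ∀ x ≤ n, ∀ y ≤ n, D.find x = D.find f.snk → r x y → D.Live y →
      D.find y = D.find f.snk ∨ r a.src y ∨ D.find y = D.find b.snk := by
    intro x hx y hy h1 h2 h3
    rcases hF.out x hx y hy h1 h2 h3 with h4 | ⟨s, hs, hsy⟩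
    · exact Or.inl h4
    · rcases (J.exits_f s).1 hs with rfl | rfl
      · exact Or.inr (Or.inl hsy)
      · exact Or.inr (Or.inr (hb_out _ hbsn y hy hbs hsy h3))
  have hbf : D.find b.snk ≠ D.find f.snk := h.find_snk_inj hr J.mem_b J.mem_f (by
    have := J.lt_b; have := hr.le hB.rel; omega)
  -- moved strands
  set M : ℕ → Prop := fun x => D.isAttached f.snk = false ∧ D.find x = D.find f.snk with hM
  have hM_unatt : ∀ x, M x → D.isAttached x = false := fun x hx =>
    (DNSP.isAttached_congr hx.2).trans hx.1
  have hM_att : ∀ x, D.isAttached x = true → ¬ M x := fun x hx hm => by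
    rw [hM_unatt x hm] at hx; simp at hx
  have hM_b : ∀ x, D.find x = D.find b.snk → ¬ M x := fun x hx hm => hbf (hx.symm.trans hm.2)
  have hmov' : ∀ x ≤ n, M x → D'.find x = D.find a.src := fun x hx hm => hmov x hx hm.1 hm.2
  have hstay' : ∀ x ≤ n, ¬ M x → D'.find x = D.find x := hstay
  have hlab : ∀ A, D.attached A = true → D'.find A = A := fun A hAA => by
    rw [hstay' A (hD.label A hAA).1 (hM_att A (hD.isAttached_label hAA)), (hD.label A hAA).2]
  have hsa' : D.attached (D.find a.src) = true := hsa
  have haa' : D.attached (D.find a.snk) = true := haa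
  -- Moved strands precede the source of the block whose set they enter, so paths starting at that
  -- source extend back to them.
  have hMle : ∀ x ≤ n, M x → r x a.src := fun x hx hm => hr.trans (hF.snk_max x hx hm.2) hfa
  have split : ∀ x ≤ n + 1, (x ≤ n ∧ ¬ M x ∧ D'.find x = D.find x) ∨
      (x ≤ n ∧ M x ∧ D'.find x = D.find a.src) ∨ (x = n + 1 ∧ D'.find x = D.find a.snk) := by
    intro x hx
    by_cases hxn : x ≤ n
    · by_cases hm : M x
      · exact Or.inr (Or.inl ⟨hxn, hm, hmov' x hxn hm⟩)
      · exact Or.inl ⟨hxn, hm, hstay' x hxn hm⟩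
    · obtain rfl : x = n + 1 := by omega
      exact Or.inr (Or.inr ⟨rfl, hnew⟩)
  have att_stay : ∀ x, D'.find x = D.find x → D'.isAttached x = D.isAttached x := fun x hx => by
    rw [DNSP.isAttached, hx, hatt, DNSP.isAttached]
  have att_mov : ∀ x, D'.find x = D.find a.src → D'.isAttached x = true := fun x hx => by
    rw [DNSP.isAttached, hx, hatt]; exact hsa
  have att_new : D'.isAttached (n + 1) = true := by
    rw [DNSP.isAttached, hnew, hatt]; exact haa
  have att_mono : ∀ x ≤ n, D.isAttached x = true → D'.isAttached x = true := fun x hx hxa => by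
    rw [att_stay x (hstay' x hx (hM_att x hxa)), hxa]
  have unatt' : ∀ x ≤ n + 1, D'.isAttached x = false →
      x ≤ n ∧ ¬ M x ∧ D'.find x = D.find x ∧ D.isAttached x = false := by
    intro x hx hxa
    rcases split x hx with ⟨h1, h2, h3⟩ | ⟨h1, h2, h3⟩ | ⟨rfl, h3⟩
    · exact ⟨h1, h2, h3, att_stay x h3 ▸ hxa⟩
    · rw [att_mov x h3] at hxa; simp at hxa
    · rw [att_new] at hxa; simp at hxa
  have succ_none : ∀ A, D'.attSucc A = none ↔ A ≠ D.find b.snk ∧ D.attSucc A = none := by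
    intro A
    rw [hsucc, Function.update_apply]
    by_cases hAb : A = D.find b.snk <;> simp [hAb]
  have live' : ∀ y ≤ n, D'.Live y → D.Live y ∧ D.find y ≠ D.find b.snk := by
    intro y hy hl
    by_cases hm : M y
    · exact ⟨(DNSP.live_congr hm.2).2 hF.live, fun hc => hM_b y hc hm⟩
    · have hst := hstay' y hy hm
      rw [DNSP.Live, att_stay y hst, hst, succ_none] at hl
      rcases hl with h1 | ⟨h1, h2⟩
      · exact ⟨Or.inl h1, fun hc => by rw [DNSP.isAttached_congr hc, hba] at h1; simp at h1⟩
      · exact ⟨Or.inr h2, h1⟩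
  have hPb := hD.pred_att _ hB.snk_le hba hbsucc
  -- The attached predecessor of `b` reaches `b.src`, which differs from it by being unattached and
  -- can be entered only from `f.snk`.
  have hPb_le : r (D.attPred (D.find b.snk)) f.snk := by
    have hPl := hD.label _ hPb
    have hbsa : D.isAttached b.src = false := (DNSP.isAttached_congr hbs).trans hba
    have := hD.pred_le b.src hbsn hbsa (by rw [hbs, hbsucc]) _ hPl.1 (by rw [hPl.2, hbs])
    rcases hbp _ this with h1 | h1
    · have h2 := hD.isAttached_label hPb
      rw [h1, hbsa] at h2; simp at h2
    · exact h1
  have sa_ta : r (D.find a.src) (D.find a.snk) := by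
    rcases hD.complete_att hasn hA.snk_le hsa hA.rel (Or.inl haa) with h1 | h1
    · rw [h1]; exact hr.refl _
    · rwa [DNSP.predOf_of_att haa] at h1
  have hnsp : D'.Inv r (n + 1) := by
    refine ⟨?_, ?_, ?_, ?_, ?_, ?_, ?_, ?_, ?_⟩
    · intro x hx
      rcases split x hx with ⟨h1, _, h3⟩ | ⟨h1, _, h3⟩ | ⟨rfl, h3⟩ <;> rw [h3]
      · exact (hD.find_le x h1).trans (by omega)
      · exact (hD.find_le _ hasn).trans (by omega)
      · exact (hD.find_le _ hA.snk_le).trans (by omega)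
    · intro x hx
      rcases split x hx with ⟨h1, h2, h3⟩ | ⟨h1, _, h3⟩ | ⟨rfl, h3⟩ <;> rw [h3]
      · rw [hstay' _ (hD.find_le x h1), hD.find_find x h1]
        intro hm
        exact h2 ⟨hm.1, (hD.find_find x h1).symm.trans hm.2⟩
      · exact hlab _ hsa'
      · exact hlab _ haa'
    · intro A hAA
      rw [hatt] at hAA
      exact ⟨(hD.label A hAA).1.trans (by omega), hlab A hAA⟩
    · intro A B
      rw [hR, hatt]; exact hD.exact A B
    · intro x hx y hy hxa hya hne hxy
      have hx' : (∃ x' ≤ n, D.isAttached x' = true ∧ D.find x' = D'.find x ∧ r x x') ∨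
          x = n + 1 := by
        rcases split x hx with ⟨h1, _, h3⟩ | ⟨h1, h2, h3⟩ | ⟨h1, _⟩
        · exact Or.inl ⟨x, h1, att_stay x h3 ▸ hxa, h3.symm, hr.refl _⟩
        · exact Or.inl ⟨a.src, hasn, hsa, h3.symm, hMle x h1 h2⟩
        · exact Or.inr h1
      rcases hx' with ⟨x', hx'n, hx'a, hx'f, hxx'⟩ | rfl
      · refine hr.trans hxx' ?_
        rw [← hx'f] at hne hxy
        rcases split y hy with ⟨h1, _, h3⟩ | ⟨h1, h2, h3⟩ | ⟨rfl, h3⟩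
        · rw [h3] at hne hxy
          exact hD.uniform x' hx'n y h1 hx'a (att_stay y h3 ▸ hya) hne hxy
        · rw [h3] at hne hxy
          have hl := hD.label _ hx'a
          have h4 : r (D.find x') a.src := hD.uniform _ hl.1 _ hasn (hD.isAttached_label hx'a) hsa
            (by rwa [hl.2]) (by rwa [hl.2])
          -- The set of `a.src` now also contains strands before `a.src`. A different attached label
          -- that reaches `a.src` comes through `f.snk`, hence through the attached predecessor of
          -- the moved set, and so precedes the moved `y` as well.
          have h5 : r (D.find x') f.snk := by
            rcases hap _ h4 with h5 | h5
            · rw [h5] at hl; exact absurd (h5.trans hl.2.symm) hne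
            · exact h5
          have hyf := h2.2
          have hyu := hM_unatt y h2
          have hys : D.attSucc (D.find y) = none := by rw [hyf]; exact (hF.unatt h2.1).2
          have hPatt := hD.pred_att y h1 hyu hys
          have hPle := hD.pred_le y h1 hyu hys
          have hPl := hD.label _ hPatt
          rcases hD.complete_label hx'a hF.snk_le h5 hF.live with h6 | h6
          · rw [DNSP.isAttached, h6] at hx'a
            have := h2.1
            rw [DNSP.isAttached, hx'a] at this
            simp at this
          · rw [DNSP.predOf_of_unatt h2.1, ← hyf] at h6
            by_cases hxP : D.find x' = D.attPred (D.find y)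
            · exact hPle x' hx'n hxP
            · refine hr.trans (hD.uniform x' hx'n _ hPl.1 hx'a (hD.isAttached_label hPatt) ?_ ?_)
                (hPle _ hPl.1 hPl.2)
              · rwa [hPl.2]
              · rwa [hPl.2]
        · rw [h3] at hne hxy
          exact hr.trans (hD.uniform x' hx'n _ hA.snk_le hx'a haa hne hxy) han
      · rw [hnew] at hne hxy
        rcases split y hy with ⟨h1, _, h3⟩ | ⟨h1, h2, h3⟩ | ⟨rfl, h3⟩
        · rw [h3] at hne hxy
          have hya' : D.isAttached y = true := att_stay y h3 ▸ hya
          have hyl := hD.label _ hya'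
          -- The sink set of `a` has no exits and therefore reaches no other attached set.
          have := ha_out _ (hD.find_le _ hA.snk_le) _ hyl.1 (hD.find_find _ hA.snk_le) hxy
            (Or.inl (hD.isAttached_label hya'))
          rw [hyl.2] at this
          exact absurd this.symm hne
        · rw [h3] at hne hxy
          exact absurd (hr.antisymm hxy sa_ta) hne
        · exact hr.refl _
    · intro v hv hva hvs
      obtain ⟨h1, h2, h3, h4⟩ := unatt' v hv hva
      rw [h3, succ_none] at hvs
      rw [hatt, hpred, h3]
      exact hD.pred_att v h1 h4 hvs.2
    · intro v hv hva hvs x hx hxv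
      obtain ⟨h1, h2, h3, h4⟩ := unatt' v hv hva
      rw [h3, succ_none] at hvs
      rw [hpred, h3] at hxv
      have hle := hD.pred_le v h1 h4 hvs.2
      rcases split x hx with ⟨h5, _, h6⟩ | ⟨h5, h7, h6⟩ | ⟨rfl, h6⟩
      · exact hle x h5 (h6 ▸ hxv)
      · exact hr.trans (hMle x h5 h7) (hle _ hasn (h6 ▸ hxv))
      · have := ha_out _ hA.snk_le v h1 rfl (hle _ hA.snk_le (h6 ▸ hxv)) (Or.inr hvs.2)
        rw [DNSP.isAttached_congr this, haa] at h4
        simp at h4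
    · intro u hu A hua hus
      obtain ⟨h1, h2, h3, h4⟩ := unatt' u hu hua
      rw [hatt]
      rw [h3, hsucc, Function.update_apply] at hus
      split_ifs at hus with hub
      · rw [Option.some.injEq] at hus
        subst hus
        -- The strand of the successor set that follows `u` is the join strand itself.
        exact ⟨haa', n + 1, le_rfl, hnew, hr.trans (hB.snk_max u h1 hub) hbn⟩
      · obtain ⟨h5, y, hy, h6, h7⟩ := hD.succ_att u h1 A h4 hus
        refine ⟨h5, y, by omega, ?_, h7⟩
        rw [hstay' y hy, h6]
        refine hM_att y ?_
        rw [DNSP.isAttached, h6, h5]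
    · intro u hu v hv A huv hl hs
      rcases split v hv with ⟨hvn, hvm, hvf⟩ | ⟨hvn, hvm, hvf⟩ | ⟨rfl, hvf⟩
      · -- old target that has not moved
        obtain ⟨hvl, hvb⟩ := live' v hvn hl
        have hpv : D'.predOf v = D.predOf v := by
          rw [DNSP.predOf, att_stay v hvf, hvf, hpred, DNSP.predOf]
        rw [hpv, hvf]
        rcases split u hu with ⟨hun, hum, huf⟩ | ⟨hun, hum, huf⟩ | ⟨rfl, _⟩
        · rw [huf]
          by_cases hub : D.find u = D.find b.snk
          · exact absurd (hb_out u hun v hvn hub huv hvl) hvb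
          · rw [DNSP.succOf, att_stay u huf, huf, hsucc, Function.update_of_ne hub] at hs
            exact hD.complete u hun v hvn A huv hvl hs
        · rw [DNSP.succOf_of_att (att_mov u huf), Option.some.injEq, huf] at hs
          subst hs
          rw [huf]
          rcases hf_out u hun v hvn hum.2 huv hvl with h1 | h1 | h1
          · exact absurd ⟨hum.1, h1⟩ hvm
          · exact hD.complete_att hasn hvn hsa h1 hvl
          · exact absurd h1 hvb
        · have := hr.le huv; omega
      · -- moved target
        rw [DNSP.predOf_of_att (att_mov v hvf), hvf]
        have hva := hMle v hvn hvm
        rcases split u hu with ⟨hun, hum, huf⟩ | ⟨hun, hum, huf⟩ | ⟨rfl, _⟩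
        · rw [huf]
          by_cases hub : D.find u = D.find b.snk
          · exact absurd (hb_out u hun v hvn hub huv
              ((DNSP.live_congr hvm.2).2 hF.live)) (fun hc => hM_b v hc hvm)
          · rw [DNSP.succOf, att_stay u huf, huf, hsucc, Function.update_of_ne hub] at hs
            have := hD.complete u hun _ hasn A (hr.trans huv hva) (Or.inl hsa) hs
            rwa [DNSP.predOf_of_att hsa] at this
        · rw [huf]; exact Or.inl rfl
        · have := hr.le huv; omega
      · -- the join strand
        rw [DNSP.predOf_of_att att_new, hnew]
        rcases split u hu with ⟨hun, hum, huf⟩ | ⟨hun, hum, huf⟩ | ⟨rfl, huf⟩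
        · rw [huf]
          by_cases hub : D.find u = D.find b.snk
          · have hua : D'.isAttached u = false := by
              rw [att_stay u huf, DNSP.isAttached_congr hub, hba]
            rw [DNSP.succOf_of_unatt hua, huf, hub, hsucc, Function.update_self,
              Option.some.injEq] at hs
            rw [← hs]
            exact Or.inr (hr.refl _)
          · rw [DNSP.succOf, att_stay u huf, huf, hsucc, Function.update_of_ne hub] at hs
            have hs : D.succOf u = some A := hs
            rcases (J.new u).1 huv with h1 | h1 | h1
            · omega
            · have := hD.complete u hun _ hA.snk_le A h1 (Or.inl haa) hs
              rwa [DNSP.predOf_of_att haa] at this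
            -- A source that reaches the join through `b` reaches the attached predecessor of `b`,
            -- which lies before the fork and thus before `a.snk`.
            · rcases hD.complete u hun _ hB.snk_le A h1 hB.live hs with h2 | h2
              · exact absurd h2 hub
              · rw [DNSP.predOf_of_unatt hba] at h2
                right
                refine hr.trans h2 ?_
                rcases hD.complete_label hPb hA.snk_le (hr.trans hPb_le hfn') (Or.inl haa)
                  with h3 | h3
                · rw [h3]; exact hr.refl _
                · rwa [DNSP.predOf_of_att haa] at h3
        · rw [DNSP.succOf_of_att (att_mov u huf), Option.some.injEq, huf] at hs
          subst hs
          exact Or.inr sa_ta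
        · exact Or.inl huf
  have hset : ∀ x ≤ n + 1, D'.find x = D.find a.snk →
      (x ≤ n ∧ D.find x = D.find a.snk) ∨ (x ≤ n ∧ M x ∧ D.find a.src = D.find a.snk) ∨
        x = n + 1 := by
    intro x hx hxf
    rcases split x hx with ⟨h1, _, h3⟩ | ⟨h1, h2, h3⟩ | ⟨h1, _⟩
    · exact Or.inl ⟨h1, h3 ▸ hxf⟩
    · exact Or.inr (Or.inl ⟨h1, h2, h3 ▸ hxf⟩)
    · exact Or.inr (Or.inr h1)
  have hsn : r f.src (n + 1) := hr.trans (hr.trans hF.rel hfn') han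
  have hfsn := hF.src_le hr
  have hsrcatt : D'.isAttached f.src = true := by
    by_cases hfa' : D.isAttached f.snk = true
    · exact att_mono _ hfsn (hF.att hfa')
    · have hfa'' : D.isAttached f.snk = false := by simpa using hfa'
      exact att_mov _ (hmov _ hfsn hfa'' (hF.unatt hfa'').1)
  refine ⟨⟨hnsp, ?_, J.after_new hfn hsrc hbase, ?_, ?_, ?_, ?_, ?_⟩, att_mono⟩
  · intro e' he'
    rcases List.mem_cons.1 he' with rfl | he'
    · constructor
      · rw [hsrc, hsnk]; exact hsn
      · rw [hsnk]
      · intro x hx hxf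
        rw [hsrc] at hxf ⊢
        rcases split x hx with ⟨h1, h2, h3⟩ | ⟨h1, h2, h3⟩ | ⟨rfl, _⟩
        · by_cases hfm : M f.src
          · rw [hmov' _ hfsn hfm, h3] at hxf
            exact hr.trans (hr.trans hF.rel hfa) (hA.src_min x h1 hxf)
          · rw [hstay' _ hfsn hfm, h3] at hxf
            exact hF.src_min x h1 hxf
        · exact hF.snk_min x h1 h2.2
        · exact hsn
      · intro x hx hxf
        rw [hsnk, hnew] at hxf
        rw [hsrc]
        rcases hset x hx hxf with ⟨h1, h2⟩ | ⟨h1, h2, _⟩ | rfl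
        · exact hr.trans (hr.trans hF.rel hfa) (hA.snk_min x h1 h2)
        · exact hF.snk_min x h1 h2.2
        · exact hsn
      · intro x hx hxf
        rw [hsnk, hnew] at hxf
        rw [hsnk]
        rcases hset x hx hxf with ⟨h1, h2⟩ | ⟨h1, h2, _⟩ | rfl
        · exact hr.trans (hA.snk_max x h1 h2) han
        · exact hr.trans (hr.trans (hMle x h1 h2) hA.rel) han
        · exact hr.refl _
      · intro hc
        rw [hsnk, att_new] at hc
        simp at hc
      · intro _
        rw [hsrc]; exact hsrcatt
      · intro x hx y hy hxf hxy hyl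
        left
        rw [hsnk, hnew] at hxf ⊢
        by_cases hyn : y ≤ n
        · obtain ⟨hyl', hyb⟩ := live' y hyn hyl
          rcases hset x hx hxf with ⟨h1, h2⟩ | ⟨h1, h2, h3⟩ | rfl
          · have := ha_out x h1 y hyn h2 hxy hyl'
            rw [hstay' y hyn (hM_att y (DNSP.isAttached_congr this ▸ haa)), this]
          · rcases hf_out x h1 y hyn h2.2 hxy hyl' with h4 | h4 | h4
            · rw [hmov' y hyn ⟨h2.1, h4⟩, h3]
            · have := ha_out _ hasn y hyn h3 h4 hyl'
              rw [hstay' y hyn (hM_att y (DNSP.isAttached_congr this ▸ haa)), this]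
            · exact absurd h4 hyb
          · have := hr.le hxy; omega
        · obtain rfl : y = n + 1 := by omega
          exact hnew
      · simp [hexits]
      · exact fun _ => hexits
    · refine J.sink_rest hr h ?_ ⟨a.snk, by simp [JoinAt.Part], hnew⟩ hatt ?_ att_mono
        (fun y hy hl => (live' y hy hl).1) he'
      · intro x hx
        by_cases hm : M x
        · exact Or.inr ⟨a.src, f.snk, by simp [JoinAt.Part], by simp [JoinAt.Part], hm.2,
            hmov' x hx hm⟩
        · exact Or.inl (hstay' x hx hm)
      · intro A hAA
        rw [hsucc, Function.update_of_ne (hAA b.snk (by simp [JoinAt.Part]))]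
  · intro u hu hua hus
    obtain ⟨h1, h2, h3, h4⟩ := unatt' u hu hua
    rw [h3, succ_none] at hus
    obtain ⟨e', he', hue⟩ := h.open_sink u h1 h4 hus.2
    rcases J.cover e' he' with rfl | rfl | rfl | h5
    · rw [DNSP.isAttached_congr hue, haa] at h4; simp at h4
    · exact absurd hue hus.1
    · exact absurd ⟨DNSP.isAttached_congr hue ▸ h4, hue⟩ h2
    · refine ⟨e', List.mem_cons_of_mem _ h5, ?_⟩
      rw [h3, hue, hstay' _ (h.sink e' he').snk_le]
      intro hm
      exact (J.find_ne hr h (z := f.snk) (by simp [JoinAt.Part]) h5).1 hm.2.symm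
  · exact fun t ht => (h.fut_le t ht).trans (by omega)
  · exact fun t ht => att_mono t (h.fut_le t ht) (h.fut_att t ht)
  · intro t ht x hx hxf
    rw [hstay' t (h.fut_le t ht) (hM_att t (h.fut_att t ht))] at hxf
    rcases split x hx with ⟨h1, _, h3⟩ | ⟨h1, h2, h3⟩ | ⟨rfl, h3⟩
    · exact h.fut_max t ht x h1 (h3 ▸ hxf)
    · exact hr.trans (hMle x h1 h2) (h.fut_max t ht _ hasn (h3 ▸ hxf))
    · exact absurd (hxf.symm.trans h3) (h.fut_find_ne hr ht J.mem_a)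
  · intro t ht e' he'
    rcases List.mem_cons.1 he' with rfl | he'
    · have := h.fut_le t ht
      omega
    · exact h.fut_ne t ht e' (J.mem_rest e' he')

end JoinAt

namespace JoinAt

variable {r : ℕ → ℕ → Prop} {n : ℕ} {L rest : List Sink} {fut : Set ℕ} {D D' : DNSP}
  {a b f : Sink}

/-- The attached predecessor of an unattached joined block precedes the fork. -/
theorem attPred_rel (J : JoinAt r n L a b f rest) (hr : StrandOrder r) (h : Core r n L fut D)
    (haa : D.isAttached a.snk = false) :
    D.attached (D.attPred (D.find a.snk)) = true ∧ r (D.attPred (D.find a.snk)) f.snk := by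
  have hD := h.nsp
  have hA := h.sink a J.mem_a
  obtain ⟨has, hasucc⟩ := hA.unatt haa
  have hP := hD.pred_att _ hA.snk_le haa hasucc
  have hPl := hD.label _ hP
  have hsa : D.isAttached a.src = false := (DNSP.isAttached_congr has).trans haa
  have := hD.pred_le a.src (hA.src_le hr) hsa (by rw [has, hasucc]) _ hPl.1 (by rw [hPl.2, has])
  rcases ((h.sink f J.mem_f).exits _ ((J.exits_f _).2 (Or.inl rfl))).2 _ this with h1 | h1
  · have h2 := hD.isAttached_label hP
    rw [h1, hsa] at h2; simp at h2
  · exact ⟨hP, h1⟩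

/-- A source with an attached successor that reaches an unattached joined block from outside
reaches the fork. -/
theorem complete_fork (J : JoinAt r n L a b f rest) (hr : StrandOrder r) (h : Core r n L fut D)
    (haa : D.isAttached a.snk = false) {u v A : ℕ} (hu : u ≤ n) (hv : v ≤ n)
    (hva : D.find v = D.find a.snk) (hua : D.find u ≠ D.find a.snk) (huv : r u v)
    (hs : D.succOf u = some A) : r A (D.predOf f.snk) := by
  have hD := h.nsp
  have hA := h.sink a J.mem_a
  have hF := h.sink f J.mem_f
  obtain ⟨hP, hPf⟩ := J.attPred_rel hr h haa
  rcases hD.complete u hu v hv A huv ((DNSP.live_congr hva).2 hA.live) hs with h1 | h1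
  · exact absurd (h1.trans hva) hua
  · rw [DNSP.predOf_congr hva, DNSP.predOf_of_unatt haa] at h1
    refine hr.trans h1 ?_
    rcases hD.complete_label hP hF.snk_le hPf hF.live with h2 | h2
    · have : D.isAttached f.snk = true := by rw [DNSP.isAttached, ← h2, hP]
      rw [DNSP.predOf_of_att this, ← h2]
      exact hr.refl _
    · exact h2

/-- The join of two unattached blocks. -/
theorem both_unattached (J : JoinAt r n L a b f rest) (hr : StrandOrder r) (h : Core r n L fut D)
    (haa : D.isAttached a.snk = false) (hba : D.isAttached b.snk = false)
    (hmov : ∀ x ≤ n, D.find x = D.find a.snk ∨ D.find x = D.find b.snk → D'.find x = D.find f.snk)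
    (hstay : ∀ x ≤ n, ¬ (D.find x = D.find a.snk ∨ D.find x = D.find b.snk) →
      D'.find x = D.find x)
    (hnew : D'.find (n + 1) = D.find f.snk)
    (hatt : D'.attached = D.attached) (hpred : D'.attPred = D.attPred)
    (hsucc : D'.attSucc = D.attSucc)
    (hR : D'.R = D.R) {e : Sink} (hfn : e.fn = f.fn) (hsrc : e.src = f.src) (hsnk : e.snk = n + 1)
    (hbase : e.base = f.base) (hexits : e.exits = []) :
    Core r (n + 1) (e :: rest) fut D' ∧
      ∀ x ≤ n, D.isAttached x = true → D'.isAttached x = true := by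
  have hD := h.nsp
  have hF := h.sink f J.mem_f
  have hA := h.sink a J.mem_a
  have hB := h.sink b J.mem_b
  have hasn := hA.src_le hr
  have hbsn := hB.src_le hr
  have hfsn := hF.src_le hr
  have hfa : r f.snk a.src := (hF.exits _ ((J.exits_f _).2 (Or.inl rfl))).1
  have hfb : r f.snk b.src := (hF.exits _ ((J.exits_f _).2 (Or.inr rfl))).1
  have han : r a.snk (n + 1) := (J.new _).2 (Or.inr (Or.inl (hr.refl _)))
  have hbn : r b.snk (n + 1) := (J.new _).2 (Or.inr (Or.inr (hr.refl _)))
  have hfn' : r f.snk (n + 1) := hr.trans (hr.trans hfa hA.rel) han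
  have hlta := hr.le hA.rel
  have hltb := hr.le hB.rel
  have haf : D.find a.snk ≠ D.find f.snk := h.find_snk_inj hr J.mem_a J.mem_f (by
    have := J.lt_a; omega)
  have hbf : D.find b.snk ≠ D.find f.snk := h.find_snk_inj hr J.mem_b J.mem_f (by
    have := J.lt_b; omega)
  -- The strands that change their set. The set of `f` may be attached or not; it keeps its label
  -- and attributes.
  set K : ℕ → Prop := fun x => D.find x = D.find a.snk ∨ D.find x = D.find b.snk with hK
  have hKf : ∀ x, D.find x = D.find f.snk → ¬ K x := fun x hx hk =>
    hk.elim (fun hk => haf (hk.symm.trans hx)) (fun hk => hbf (hk.symm.trans hx))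
  have hK_unatt : ∀ x, K x → D.isAttached x = false := fun x hk =>
    hk.elim (fun hk => (DNSP.isAttached_congr hk).trans haa)
      (fun hk => (DNSP.isAttached_congr hk).trans hba)
  have hK_att : ∀ x, D.isAttached x = true → ¬ K x := fun x hx hk => by
    rw [hK_unatt x hk] at hx; simp at hx
  have hK_live : ∀ x, K x → D.Live x := fun x hk =>
    hk.elim (fun hk => (DNSP.live_congr hk).2 hA.live) (fun hk => (DNSP.live_congr hk).2 hB.live)
  have hfK : ∀ x ≤ n, K x → r f.snk x := fun x hx hk =>
    hk.elim (fun hk => hr.trans hfa (hA.snk_min x hx hk))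
      (fun hk => hr.trans hfb (hB.snk_min x hx hk))
  have hKn : ∀ x ≤ n, K x → r x (n + 1) := fun x hx hk =>
    hk.elim (fun hk => hr.trans (hA.snk_max x hx hk) han)
      (fun hk => hr.trans (hB.snk_max x hx hk) hbn)
  have hK_out : ∀ x ≤ n, ∀ y ≤ n, K x → r x y → D.Live y → K y := by
    intro x hx y hy hk hxy hl
    rcases hk with hk | hk
    · left; simpa [J.exits_a] using hA.out x hx y hy hk hxy hl
    · right; simpa [J.exits_b] using hB.out x hx y hy hk hxy hl
  have hf_out : ∀ x ≤ n, ∀ y ≤ n, D.find x = D.find f.snk → r x y → D.Live y →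
      D.find y = D.find f.snk ∨ K y := by
    intro x hx y hy h1 h2 h3
    rcases hF.out x hx y hy h1 h2 h3 with h4 | ⟨s, hs, hsy⟩
    · exact Or.inl h4
    · rcases (J.exits_f s).1 hs with rfl | rfl
      · exact Or.inr (hK_out _ hasn y hy (Or.inl (hA.unatt haa).1) hsy h3)
      · exact Or.inr (hK_out _ hbsn y hy (Or.inr (hB.unatt hba).1) hsy h3)
  have split : ∀ x ≤ n + 1,
      (x ≤ n ∧ ¬ K x ∧ D.find x ≠ D.find f.snk ∧ D'.find x = D.find x) ∨
      (D'.find x = D.find f.snk ∧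
        ((x ≤ n ∧ D.find x = D.find f.snk) ∨ (x ≤ n ∧ K x) ∨ x = n + 1)) := by
    intro x hx
    by_cases hxn : x ≤ n
    · by_cases hk : K x
      · exact Or.inr ⟨hmov x hxn hk, Or.inr (Or.inl ⟨hxn, hk⟩)⟩
      · have := hstay x hxn hk
        by_cases hxf : D.find x = D.find f.snk
        · exact Or.inr ⟨this.trans hxf, Or.inl ⟨hxn, hxf⟩⟩
        · exact Or.inl ⟨hxn, hk, hxf, this⟩
    · obtain rfl : x = n + 1 := by omega
      exact Or.inr ⟨hnew, Or.inr (Or.inr rfl)⟩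
  have hlab : ∀ A, D.attached A = true → D'.find A = A := fun A hAA => by
    rw [hstay A (hD.label A hAA).1 (hK_att A (hD.isAttached_label hAA)), (hD.label A hAA).2]
  have att_stay : ∀ x, D'.find x = D.find x → D'.isAttached x = D.isAttached x := fun x hx => by
    rw [DNSP.isAttached, hx, hatt, DNSP.isAttached]
  have att_mov : ∀ x, D'.find x = D.find f.snk → D'.isAttached x = D.isAttached f.snk :=
    fun x hx => by rw [DNSP.isAttached, hx, hatt, DNSP.isAttached]
  have att_mono : ∀ x ≤ n, D.isAttached x = true → D'.isAttached x = true := fun x hx hxa => by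
    rw [att_stay x (hstay x hx (hK_att x hxa)), hxa]
  have live' : ∀ y ≤ n, D'.Live y → D.Live y := by
    intro y hy hl
    by_cases hk : K y
    · exact hK_live y hk
    · have hst := hstay y hy hk
      rwa [DNSP.Live, att_stay y hst, hst, hsucc] at hl
  -- no live strand outside is reached from the merged set
  have closed : ∀ x ≤ n + 1, D'.find x = D.find f.snk → ∀ y ≤ n, r x y → D.Live y →
      D'.find y = D.find f.snk := by
    intro x hx hxf y hy hxy hl
    rcases split x hx with ⟨_, _, h3, h4⟩ | ⟨_, ⟨h1, h2⟩ | ⟨h1, h2⟩ | rfl⟩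
    · exact absurd (h4.symm.trans hxf) h3
    · rcases hf_out x h1 y hy h2 hxy hl with h3 | h3
      · rw [hstay y hy (hKf y h3), h3]
      · exact hmov y hy h3
    · exact hmov y hy (hK_out x h1 y hy h2 hxy hl)
    · have := hr.le hxy; omega
  -- Paths into the old set of `f` thereby extend to the merged one: they reach the old members,
  -- among them `f.snk`, and from there everything added.
  have f_le : ∀ x ≤ n + 1, D'.find x = D.find f.snk →
      (x ≤ n ∧ D.find x = D.find f.snk) ∨ r f.snk x := by
    intro x hx hxf
    rcases split x hx with ⟨_, _, h3, h4⟩ | ⟨_, ⟨h1, h2⟩ | ⟨h1, h2⟩ | rfl⟩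
    · exact absurd (h4.symm.trans hxf) h3
    · exact Or.inl ⟨h1, h2⟩
    · exact Or.inr (hfK x h1 h2)
    · exact Or.inr hfn'
  have hnsp : D'.Inv r (n + 1) := by
    refine ⟨?_, ?_, ?_, ?_, ?_, ?_, ?_, ?_, ?_⟩
    · intro x hx
      rcases split x hx with ⟨h1, _, _, h3⟩ | ⟨h3, _⟩ <;> rw [h3]
      · exact (hD.find_le x h1).trans (by omega)
      · exact (hD.find_le _ hF.snk_le).trans (by omega)
    · intro x hx
      rcases split x hx with ⟨h1, h2, _, h3⟩ | ⟨h3, _⟩ <;> rw [h3]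
      · rw [hstay _ (hD.find_le x h1), hD.find_find x h1]
        rw [hD.find_find x h1]
        exact h2
      · have hff := hD.find_find _ hF.snk_le
        rw [hstay _ (hD.find_le _ hF.snk_le) (hKf _ hff), hff]
    · intro A hAA
      rw [hatt] at hAA
      exact ⟨(hD.label A hAA).1.trans (by omega), hlab A hAA⟩
    · intro A B
      rw [hR, hatt]; exact hD.exact A B
    · intro x hx y hy hxa hya hne hxy
      rcases split x hx with ⟨h1, _, h2, h3⟩ | ⟨h3, _⟩
      · rw [att_stay x h3] at hxa
        rw [h3] at hne hxy
        rcases split y hy with ⟨h4, _, _, h6⟩ | ⟨h6, _⟩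
        · rw [h6] at hne hxy
          exact hD.uniform x h1 y h4 hxa (att_stay y h6 ▸ hya) hne hxy
        · rw [att_mov y h6] at hya
          rw [h6] at hne hxy
          rcases f_le y hy h6 with ⟨h7, h8⟩ | h7
          · exact hD.uniform x h1 y h7 hxa (DNSP.isAttached_congr h8 ▸ hya) (h8 ▸ hne) (h8 ▸ hxy)
          · exact hr.trans (hD.uniform x h1 _ hF.snk_le hxa hya hne hxy) h7
      · rcases split y hy with ⟨h4, _, h5, h6⟩ | ⟨h6, _⟩
        · rw [h3, h6] at hxy
          have hya' : D.isAttached y = true := att_stay y h6 ▸ hya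
          have hyl := hD.label _ hya'
          have hff := hD.find_find _ hF.snk_le
          have hfn1 := hD.find_le _ hF.snk_le
          -- No attached set lies beyond the merged one, so uniformity out of it is vacuous.
          have := closed (D.find f.snk) (hfn1.trans (by omega))
            (by rw [hstay _ hfn1 (hKf _ hff), hff]) _ hyl.1 hxy
            (Or.inl (hD.isAttached_label hya'))
          rw [hlab _ hya'] at this
          exact absurd this h5
        · exact absurd (h3.trans h6.symm) hne
    · intro v hv hva hvs
      rw [hsucc] at hvs
      rw [hatt, hpred]
      rcases split v hv with ⟨h1, _, _, h3⟩ | ⟨h3, _⟩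
      · rw [h3] at hvs ⊢
        exact hD.pred_att v h1 (att_stay v h3 ▸ hva) hvs
      · rw [h3] at hvs ⊢
        exact hD.pred_att _ hF.snk_le (att_mov v h3 ▸ hva) hvs
    · intro v hv hva hvs x hx hxv
      rw [hsucc] at hvs
      rw [hpred] at hxv
      rcases split v hv with ⟨h1, _, h2, h3⟩ | ⟨h3, _⟩
      · rw [h3] at hvs hxv
        rw [att_stay v h3] at hva
        have hle := hD.pred_le v h1 hva hvs
        rcases split x hx with ⟨h4, _, _, h6⟩ | ⟨h6, _⟩
        · exact hle x h4 (h6 ▸ hxv)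
        · rw [h6] at hxv
          have := closed f.snk (hF.snk_le.trans (by omega)) (hstay _ hF.snk_le (hKf _ rfl)) v h1
            (hle _ hF.snk_le hxv) (Or.inr hvs)
          rw [h3] at this
          exact absurd this h2
      · rw [h3] at hvs hxv
        rw [att_mov v h3] at hva
        have hPatt := hD.pred_att _ hF.snk_le hva hvs
        rcases split x hx with ⟨h4, _, _, h6⟩ | ⟨h6, _⟩
        · rw [h6] at hxv
          rcases f_le v hv h3 with ⟨h7, h8⟩ | h7
          · exact hD.pred_le v h7 ((DNSP.isAttached_congr h8).trans hva) (by rw [h8, hvs]) x h4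
              (by rw [h8, hxv])
          · exact hr.trans (hD.pred_le _ hF.snk_le hva hvs x h4 hxv) h7
        · rw [← hxv, h6] at hPatt
          rw [DNSP.isAttached, hPatt] at hva
          simp at hva
    · intro u hu A hua hus
      rw [hsucc] at hus
      rw [hatt]
      rcases split u hu with ⟨h1, _, h2, h3⟩ | ⟨h3, _⟩
      · rw [h3] at hus
        obtain ⟨h5, y, hy, h6, h7⟩ := hD.succ_att u h1 A (att_stay u h3 ▸ hua) hus
        refine ⟨h5, y, by omega, ?_, h7⟩
        rw [hstay y hy, h6]
        refine hK_att y ?_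
        rw [DNSP.isAttached, h6, h5]
      · rw [h3, (hF.unatt (att_mov u h3 ▸ hua)).2] at hus
        simp at hus
    · intro u hu v hv A huv hl hs
      rcases split u hu with ⟨h1, h2, h2', h3⟩ | ⟨h3, _⟩
      · have hs' : D.succOf u = some A := by
          rwa [DNSP.succOf, att_stay u h3, h3, hsucc] at hs
        have hua : D.find u ≠ D.find a.snk := fun hc => h2 (Or.inl hc)
        have hub : D.find u ≠ D.find b.snk := fun hc => h2 (Or.inr hc)
        rcases split v hv with ⟨h4, h5, h5', h6⟩ | ⟨h6, h7⟩
        · have hpv : D'.predOf v = D.predOf v := by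
            rw [DNSP.predOf, att_stay v h6, h6, hpred, DNSP.predOf]
          rw [hpv, h6, h3]
          exact hD.complete u h1 v h4 A huv (live' v h4 hl) hs'
        · right
          have hpv : D'.predOf v = D.predOf f.snk := by
            rw [DNSP.predOf, att_mov v h6, h6, hpred, DNSP.predOf]
          rw [hpv]
          -- The merged set inherits the attached predecessor of `f`. For targets from `a`, from `b`
          -- or the join strand, `complete_fork` leads back to the fork.
          rcases h7 with ⟨h7, h8⟩ | ⟨h7, h8 | h8⟩ | rfl
          · rcases hD.complete u h1 v h7 A huv ((DNSP.live_congr h8).2 hF.live) hs' with h9 | h9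
            · exact absurd (h9.trans h8) h2'
            · rwa [DNSP.predOf_congr h8] at h9
          · exact J.complete_fork hr h haa h1 h7 h8 hua huv hs'
          · exact J.symm.complete_fork hr h hba h1 h7 h8 hub huv hs'
          · rcases (J.new u).1 huv with h9 | h9 | h9
            · omega
            · exact J.complete_fork hr h haa h1 hA.snk_le rfl hua h9 hs'
            · exact J.symm.complete_fork hr h hba h1 hB.snk_le rfl hub h9 hs'
      · rcases split v hv with ⟨h4, _, h5, h6⟩ | ⟨h6, _⟩
        · have := closed u hu h3 v h4 huv (live' v h4 hl)
          exact absurd (h6.symm.trans this) h5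
        · exact Or.inl (h3.trans h6.symm)
  have hsn : r f.src (n + 1) := hr.trans hF.rel hfn'
  have hfsK : ¬ K f.src := by
    have h1 := hr.le hF.rel
    have h2 := J.lt_a
    have h3 := J.lt_b
    rintro (hk | hk)
    · have := hr.le (hA.snk_min f.src hfsn hk); omega
    · have := hr.le (hB.snk_min f.src hfsn hk); omega
  have hfs' := hstay _ hfsn hfsK
  refine ⟨⟨hnsp, ?_, J.after_new hfn hsrc hbase, ?_, ?_, ?_, ?_, ?_⟩, att_mono⟩
  · intro e' he'
    rcases List.mem_cons.1 he' with rfl | he'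
    · constructor
      · rw [hsrc, hsnk]; exact hsn
      · rw [hsnk]
      · intro x hx hxf
        rw [hsrc, hfs'] at hxf
        rw [hsrc]
        rcases split x hx with ⟨h1, _, _, h3⟩ | ⟨h3, ⟨h1, h2⟩ | ⟨h1, h2⟩ | rfl⟩
        · exact hF.src_min x h1 (h3 ▸ hxf)
        · exact hF.snk_min x h1 h2
        · exact hr.trans hF.rel (hfK x h1 h2)
        · exact hsn
      · intro x hx hxf
        rw [hsnk, hnew] at hxf
        rw [hsrc]
        rcases f_le x hx hxf with ⟨h1, h2⟩ | h1
        · exact hF.snk_min x h1 h2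
        · exact hr.trans hF.rel h1
      · intro x hx hxf
        rw [hsnk, hnew] at hxf
        rw [hsnk]
        rcases split x hx with ⟨_, _, h3, h4⟩ | ⟨_, ⟨h1, h2⟩ | ⟨h1, h2⟩ | rfl⟩
        · exact absurd (h4.symm.trans hxf) h3
        · exact hr.trans (hF.snk_max x h1 h2) hfn'
        · exact hKn x h1 h2
        · exact hr.refl _
      · intro hc
        rw [hsnk, att_mov _ hnew] at hc
        rw [hsnk, hsrc, hnew, hfs', hsucc]
        exact hF.unatt hc
      · intro hc
        rw [hsnk, att_mov _ hnew] at hc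
        rw [hsrc]
        exact att_mono _ hfsn (hF.att hc)
      · intro x hx y hy hxf hxy hyl
        left
        rw [hsnk, hnew] at hxf ⊢
        by_cases hyn : y ≤ n
        · exact closed x hx hxf y hyn hxy (live' y hyn hyl)
        · obtain rfl : y = n + 1 := by omega
          exact hnew
      · simp [hexits]
      · exact fun _ => hexits
    · refine J.sink_rest hr h ?_ ⟨f.snk, by simp [JoinAt.Part], hnew⟩ hatt
        (fun A _ => by rw [hsucc]) att_mono live' he'
      intro x hx
      by_cases hk : K x
      · refine Or.inr ?_
        rcases id hk with h1 | h1
        · exact ⟨f.snk, a.snk, by simp [JoinAt.Part], by simp [JoinAt.Part], h1, hmov x hx hk⟩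
        · exact ⟨f.snk, b.snk, by simp [JoinAt.Part], by simp [JoinAt.Part], h1, hmov x hx hk⟩
      · exact Or.inl (hstay x hx hk)
  · intro u hu hua hus
    rw [hsucc] at hus
    rcases split u hu with ⟨h1, h2, h2', h3⟩ | ⟨h3, _⟩
    · rw [h3] at hus
      obtain ⟨e', he', hue⟩ := h.open_sink u h1 (att_stay u h3 ▸ hua) hus
      rcases J.cover e' he' with rfl | rfl | rfl | h5
      · exact absurd (Or.inl hue) h2
      · exact absurd (Or.inr hue) h2
      · exact absurd hue h2'
      · refine ⟨e', List.mem_cons_of_mem _ h5, ?_⟩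
        rw [h3, hue, hstay _ (h.sink e' he').snk_le]
        rintro (hm | hm)
        · exact (J.find_ne hr h (z := a.snk) (by simp [JoinAt.Part]) h5).1 hm.symm
        · exact (J.find_ne hr h (z := b.snk) (by simp [JoinAt.Part]) h5).1 hm.symm
    · exact ⟨e, List.mem_cons_self, by rw [h3, hsnk, hnew]⟩
  · exact fun t ht => (h.fut_le t ht).trans (by omega)
  · exact fun t ht => att_mono t (h.fut_le t ht) (h.fut_att t ht)
  · intro t ht x hx hxf
    rw [hstay t (h.fut_le t ht) (hK_att t (h.fut_att t ht))] at hxf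
    rcases split x hx with ⟨h1, _, _, h3⟩ | ⟨h3, _⟩
    · exact h.fut_max t ht x h1 (h3 ▸ hxf)
    · exact absurd (hxf.symm.trans h3) (h.fut_find_ne hr ht J.mem_f)
  · intro t ht e' he'
    rcases List.mem_cons.1 he' with rfl | he'
    · have := h.fut_le t ht
      omega
    · exact h.fut_ne t ht e' (J.mem_rest e' he')

end JoinAt

/-! ### How calls, returns and gets change the list of blocks. -/

namespace Core

variable {r : ℕ → ℕ → Prop} {n : ℕ} {L L' : List Sink} {fut fut' : Set ℕ} {D D' : DNSP}

/-- The bookkeeping common to the steps that add a singleton. By `hopen` a sink may leave the list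
only if its set is attached, which preserves `open_sink`. -/
theorem of_addSingleton (h : Core r n L fut D) (hA : DNSP.AddSingleton n D D')
    (hD' : D'.Inv r (n + 1)) (hsink : ∀ e ∈ L', e.Inv r (n + 1) D')
    (horder : L'.Pairwise (Sink.After r))
    (hopen : ∀ e ∈ L, D.isAttached e.snk = false → ∃ e' ∈ L', e'.snk = e.snk)
    (hnew : D'.attached (n + 1) = false → ∃ e' ∈ L', e'.snk = n + 1)
    (hfut : ∀ t ∈ fut', t ∈ fut ∨
      t ≤ n ∧ D.isAttached t = true ∧ ∀ x ≤ n, D.find x = D.find t → r x t)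
    (hne : ∀ t ∈ fut', ∀ e ∈ L', e.snk ≠ t) :
    Core r (n + 1) L' fut' D' := by
  have hD := h.nsp
  have hfut : ∀ t ∈ fut', t ≤ n ∧ D.isAttached t = true ∧
      ∀ x ≤ n, D.find x = D.find t → r x t := by
    intro t ht
    rcases hfut t ht with h1 | h1
    · exact ⟨h.fut_le t h1, h.fut_att t h1, h.fut_max t h1⟩
    · exact h1
  refine ⟨hD', hsink, horder, ?_, ?_, ?_, ?_, hne⟩
  · intro u hu hua hus
    by_cases hun : u ≤ n
    · rw [hA.isAttached_old hD hun] at hua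
      rw [hA.find_old u hun, hA.attSucc_old _ (hD.find_le u hun)] at hus
      obtain ⟨e, he, hue⟩ := h.open_sink u hun hua hus
      obtain ⟨e', he', hs⟩ := hopen e he ((DNSP.isAttached_congr hue).symm.trans hua)
      exact ⟨e', he', by rw [hs, hA.find_old u hun, hA.find_old _ (h.sink e he).snk_le, hue]⟩
    · obtain rfl : u = n + 1 := by omega
      rw [DNSP.isAttached, hA.find_new] at hua
      obtain ⟨e', he', hs⟩ := hnew hua
      exact ⟨e', he', by rw [hs]⟩
  · exact fun t ht => (hfut t ht).1.trans (by omega)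
  · intro t ht
    rw [hA.isAttached_old hD (hfut t ht).1]; exact (hfut t ht).2.1
  · intro t ht x hx hxt
    by_cases hxn : x ≤ n
    · rw [hA.find_old x hxn, hA.find_old t (hfut t ht).1] at hxt
      exact (hfut t ht).2.2 x hxn hxt
    · obtain rfl : x = n + 1 := by omega
      have := hD.find_le t (hfut t ht).1
      rw [hA.find_new, hA.find_old t (hfut t ht).1] at hxt
      omega

/-- A call: the callee `g` begins with the new strand. -/
theorem call {e e' g : Sink} (h : Core r n (e :: L) fut D) (hr : StrandOrder r)
    (hA : DNSP.AddSingleton n D D') (hD' : D'.Inv r (n + 1))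
    (hsucc : D'.attached (n + 1) = false → D'.attSucc (n + 1) = none)
    (hnew : NewStrand r n [n]) (hsnk : e.snk = n) (hex : e.exits = []) (hst : e.status = .running)
    (he' : e' = { e with exits := [n + 1] }) (hg : g = ⟨g.fn, n + 1, n + 1, [], true, .running⟩)
    (hfn : ∀ e₀ ∈ e :: L, g.fn ≠ e₀.fn) :
    Core r (n + 1) (g :: e' :: L) fut D' := by
  have hE := h.sink e (by simp)
  have hord := List.pairwise_cons.1 h.order
  have hgsrc : g.src = n + 1 := by rw [hg]
  have hgsnk : g.snk = n + 1 := by rw [hg]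
  have hn1 : r n (n + 1) := (hnew n).2 (Or.inr ⟨n, by simp, hr.refl n⟩)
  have hen : e.src ≤ n := hE.src_le hr
  have hsn : r e.src n := hsnk ▸ hE.rel
  have hlt : ∀ e₀ ∈ e :: L, e₀.snk ≤ n := fun e₀ h₀ => (h.sink e₀ h₀).snk_le
  refine h.of_addSingleton hA hD' ?_ ?_ ?_ ?_ (fun t ht => Or.inl ht) ?_
  · intro e₀ h₀
    simp only [List.mem_cons] at h₀
    rcases h₀ with rfl | rfl | h₀
    · exact Sink.Inv.singleton hr h.nsp hA hgsrc hgsnk (by rw [hg]) hsucc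
    -- The caller's sink set reaches the new strand, which is therefore recorded as an exit. Earlier
    -- blocks need no new exit, as `n` is outside their sink sets.
    · refine hE.addSingleton hr h.nsp hA (by rw [he']) (by rw [he']) (by simp [hex]) ?_ ?_ hnew ?_
      · intro s hs
        rw [he', List.mem_singleton] at hs
        subst hs
        rw [hsnk]
        refine ⟨hn1, fun x hx => ?_⟩
        simpa using (hnew x).1 hx
      · rw [he', hst]; simp
      · intro p hp
        rw [List.mem_singleton] at hp
        subst hp
        exact ⟨le_rfl, hsnk ▸ hE.live, Or.inr (by simp [he'])⟩
    · have hE₀ := h.sink e₀ (by simp [h₀])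
      refine hE₀.addSingleton hr h.nsp hA rfl rfl (fun _ => id) hE₀.exits hE₀.returned hnew ?_
      intro p hp
      rw [List.mem_singleton] at hp
      subst hp
      exact ⟨le_rfl, hsnk ▸ hE.live, Or.inl (hE₀.find_ne hr (hord.1 e₀ h₀) le_rfl hen)⟩
  · refine List.pairwise_cons.2 ⟨?_, List.pairwise_cons.2 ⟨?_, hord.2⟩⟩
    · intro e₀ h₀
      rcases List.mem_cons.1 h₀ with rfl | h₀
      · have hf : g.fn ≠ e₀.fn := by rw [he']; exact hfn e (by simp)
        refine ⟨?_, fun _ => ?_, fun _ => hf, fun _ => hf⟩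
        · rw [he', hgsrc]; simp only; omega
        · rw [he', hgsrc]; simp only; rw [hsnk]; exact hn1
      · have hf : g.fn ≠ e₀.fn := hfn e₀ (by simp [h₀])
        refine ⟨?_, fun hs => ?_, fun _ => hf, fun _ => hf⟩
        · have := hlt e₀ (by simp [h₀]); omega
        · rw [hgsrc]
          exact hr.trans (hr.trans ((hord.1 e₀ h₀).rel hs) hsn) hn1
    · intro e₀ h₀
      obtain ⟨h1, h2, h3, h4⟩ := hord.1 e₀ h₀
      rw [he']
      exact ⟨h1, h2, h3, h4⟩
  · intro e₀ h₀ _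
    rcases List.mem_cons.1 h₀ with rfl | h₀
    · exact ⟨e', by simp, by rw [he']⟩
    · exact ⟨e₀, by simp [h₀], rfl⟩
  · exact fun _ => ⟨g, by simp, hgsnk⟩
  · intro t ht e₀ h₀
    simp only [List.mem_cons] at h₀
    rcases h₀ with rfl | rfl | h₀
    · have := h.fut_le t ht; omega
    · rw [he']; exact h.fut_ne t ht e (by simp)
    · exact h.fut_ne t ht e₀ (by simp [h₀])

/-- The return of the spawned child `g`. -/
theorem retSpawn {e e' g g' k : Sink} (h : Core r n (g :: e :: L) fut D) (hr : StrandOrder r)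
    (hA : DNSP.AddSingleton n D D') (hD' : D'.Inv r (n + 1))
    (hsucc : D'.attached (n + 1) = false → D'.attSucc (n + 1) = none)
    (hnew : NewStrand r n [e.snk]) (hsnk : g.snk = n) (hgex : g.exits = [])
    (hgb : g.base = true) (hst : e.status = .running)
    (hg' : g' = { g with status := .returned })
    (he' : e' = { e with exits := e.exits ++ [n + 1], status := .forked })
    (hk : k = ⟨e.fn, n + 1, n + 1, [], false, .running⟩) :
    Core r (n + 1) (k :: g' :: e' :: L) fut D' := by
  have hG := h.sink g (by simp)
  have hE := h.sink e (by simp)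
  have hord := List.pairwise_cons.1 h.order
  have hord' := List.pairwise_cons.1 hord.2
  have hge := hord.1 e (by simp)
  have hn1 : r e.snk (n + 1) := (hnew _).2 (Or.inr ⟨_, by simp, hr.refl _⟩)
  have hle : ∀ e₀ ∈ g :: e :: L, e₀.snk ≤ n := fun e₀ h₀ => (h.sink e₀ h₀).snk_le
  have hen := hle e (by simp)
  refine h.of_addSingleton hA hD' ?_ ?_ ?_ ?_ (fun t ht => Or.inl ht) ?_
  · intro e₀ h₀
    simp only [List.mem_cons] at h₀
    rcases h₀ with rfl | rfl | rfl | h₀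
    · exact Sink.Inv.singleton hr h.nsp hA (by rw [hk]) (by rw [hk]) (by rw [hk]) hsucc
    · refine hG.addSingleton hr h.nsp hA (by rw [hg']) (by rw [hg']) (by simp [hgex])
        (by simp [hg', hgex]) (by simp [hg', hgex]) hnew ?_
      intro p hp
      rw [List.mem_singleton] at hp
      subst hp
      refine ⟨hen, hE.live, Or.inl (h.find_snk_inj hr (by simp) (by simp) ?_)⟩
      have := hge.lt
      have := hr.le hG.rel
      omega
    -- The continuation strand is one more exit of the caller's block, with the same sink as its
    -- only predecessor.
    · refine hE.addSingleton hr h.nsp hA (by rw [he']) (by rw [he']) (by simp +contextual [he'])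
        ?_ (by simp [he']) hnew ?_
      · intro s hs
        rw [he', List.mem_append] at hs
        rcases hs with hs | hs
        · exact hE.exits s hs
        · rw [List.mem_singleton] at hs
          subst hs
          refine ⟨hn1, fun x hx => ?_⟩
          simpa using (hnew x).1 hx
      · intro p hp
        rw [List.mem_singleton] at hp
        subst hp
        exact ⟨hen, hE.live, Or.inr (by simp [he'])⟩
    · have hE₀ := h.sink e₀ (by simp [h₀])
      refine hE₀.addSingleton hr h.nsp hA rfl rfl (fun _ => id) hE₀.exits hE₀.returned hnew ?_
      intro p hp
      rw [List.mem_singleton] at hp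
      subst hp
      exact ⟨hen, hE.live, Or.inl (hE₀.find_ne hr (hord'.1 e₀ h₀) hen (hr.le hE.rel))⟩
  · refine List.pairwise_cons.2 ⟨?_, List.pairwise_cons.2 ⟨?_, List.pairwise_cons.2 ⟨?_, hord'.2⟩⟩⟩
    · intro e₀ h₀
      rw [hk]
      simp only [List.mem_cons] at h₀
      rcases h₀ with rfl | rfl | h₀
      · rw [hg']
        refine ⟨?_, by simp, by simp, fun _ => (hge.base hgb).symm⟩
        simp only; omega
      · rw [he']
        refine ⟨?_, fun _ => hn1, by simp, by simp⟩
        simp only; omega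
      · obtain ⟨h1, h2, h3, h4⟩ := hord'.1 e₀ h₀
        refine ⟨?_, fun hs => hr.trans (hr.trans (h2 hs) hE.rel) hn1, by simp, h4⟩
        have := hle e₀ (by simp [h₀])
        simp only; omega
    · intro e₀ h₀
      rw [hg']
      rcases List.mem_cons.1 h₀ with rfl | h₀
      · rw [he']
        exact ⟨hge.lt, fun _ => hge.rel (by simp [hst]), hge.base, by simp⟩
      · obtain ⟨h1, h2, h3, h4⟩ := hord.1 e₀ (by simp [h₀])
        exact ⟨h1, h2, h3, h4⟩
    · intro e₀ h₀
      rw [he']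
      obtain ⟨h1, h2, h3, h4⟩ := hord'.1 e₀ h₀
      exact ⟨h1, h2, h3, h4⟩
  · intro e₀ h₀ _
    simp only [List.mem_cons] at h₀
    rcases h₀ with rfl | rfl | h₀
    · exact ⟨g', by simp, by rw [hg']⟩
    · exact ⟨e', by simp, by rw [he']⟩
    · exact ⟨e₀, by simp [h₀], rfl⟩
  · exact fun _ => ⟨k, by simp, by rw [hk]⟩
  · intro t ht e₀ h₀
    simp only [List.mem_cons] at h₀
    rcases h₀ with rfl | rfl | rfl | h₀
    · have := h.fut_le t ht
      rw [hk]; simp only; omega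
    · rw [hg']; exact h.fut_ne t ht g (by simp)
    · rw [he']; exact h.fut_ne t ht e (by simp)
    · exact h.fut_ne t ht e₀ (by simp [h₀])

/-- The block `e` goes on with the new strand, an attached singleton; the blocks `M`, which are
later than `e`, are closed. -/
theorem extend {M : List Sink} {e e' : Sink} (h : Core r n (M ++ e :: L) fut D)
    (hr : StrandOrder r)
    (hA : DNSP.AddSingleton n D D') (hD' : D'.Inv r (n + 1)) (hatt : D'.attached (n + 1) = true)
    {ps : List ℕ} (hnew : NewStrand r n ps)
    (hps : ∀ p ∈ ps, p ≤ n ∧ D.isAttached p = true ∧ ∀ e₀ ∈ L, D.find p ≠ D.find e₀.snk)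
    (hMa : ∀ e₀ ∈ M, D.isAttached e₀.snk = true) (hea : D.isAttached e.snk = true)
    (hen : r e.snk (n + 1))
    (he' : e' = ⟨e.fn, e.src, n + 1, [], e.base, .running⟩)
    (hfut : ∀ t ∈ fut', t ∈ fut ∨ ((∃ e₀ ∈ M, e₀.snk = t) ∧ t = n)) (hlt : ∀ e₀ ∈ L, e₀.snk < n) :
    Core r (n + 1) (e' :: L) fut' D' := by
  have hE := h.sink e (by simp)
  have hord := (List.pairwise_append.1 h.order).2.1
  have hord := List.pairwise_cons.1 hord
  have hmem : ∀ e₀ ∈ L, e₀ ∈ M ++ e :: L := fun e₀ h₀ => by simp [h₀]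
  refine h.of_addSingleton hA hD' ?_ ?_ ?_ ?_ ?_ ?_
  · intro e₀ h₀
    rcases List.mem_cons.1 h₀ with rfl | h₀
    · exact hE.extend hr h.nsp hA hatt (by rw [he']) (by rw [he']) (by rw [he']) (hE.att hea)
        (hr.trans hE.rel hen)
    · have hE₀ := h.sink e₀ (hmem e₀ h₀)
      refine hE₀.addSingleton hr h.nsp hA rfl rfl (fun _ => id) hE₀.exits hE₀.returned hnew ?_
      intro p hp
      obtain ⟨h1, h2, h3⟩ := hps p hp
      exact ⟨h1, Or.inl h2, Or.inl (h3 e₀ h₀)⟩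
  · refine List.pairwise_cons.2 ⟨?_, hord.2⟩
    intro e₀ h₀
    obtain ⟨h1, h2, h3, h4⟩ := hord.1 e₀ h₀
    rw [he']
    exact ⟨h1, h2, h3, h4⟩
  -- The blocks `M` and the old sink of `e` leave the list, which is harmless because their sets are
  -- attached.
  · intro e₀ h₀ hu
    rcases List.mem_append.1 h₀ with h₀ | h₀
    · rw [hMa e₀ h₀] at hu; simp at hu
    · rcases List.mem_cons.1 h₀ with rfl | h₀
      · rw [hea] at hu; simp at hu
      · exact ⟨e₀, by simp [h₀], rfl⟩
  · intro hc; rw [hatt] at hc; simp at hc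
  · intro t ht
    rcases hfut t ht with h1 | ⟨⟨e₀, h₀, rfl⟩, _⟩
    · exact Or.inl h1
    -- A future completed by this step ends at the sink of a block in `M`, so it is the last strand
    -- of an attached set.
    · have hE₀ := h.sink e₀ (by simp [h₀])
      exact Or.inr ⟨hE₀.snk_le, hMa e₀ h₀, hE₀.snk_max⟩
  · intro t ht e₀ h₀
    rcases List.mem_cons.1 h₀ with rfl | h₀
    · rw [he']; simp only
      rcases hfut t ht with h1 | ⟨_, h1⟩
      · have := h.fut_le t h1; omega
      · omega
    · rcases hfut t ht with h1 | ⟨_, h1⟩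
      · exact h.fut_ne t h1 e₀ (hmem e₀ h₀)
      · have := hlt e₀ h₀; omega

end Core

/-! ### Exactness of the transitively closed relation `R`. -/

namespace DNSP

variable {r : ℕ → ℕ → Prop} {n : ℕ} {D D' : DNSP}

theorem mem_arcSets {A B X Y : ℕ} : (X, Y) ∈ (D.arcSets A B).R ↔
    (X, Y) ∈ D.R ∨ (X = A ∨ (X, A) ∈ D.R) ∧ (Y = B ∨ (B, Y) ∈ D.R) := by
  simp [arcSets]

/-- The arcs of `R` join attached sets with related labels. -/
def SoundR (r : ℕ → ℕ → Prop) (D : DNSP) : Prop :=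
  ∀ A B, (A, B) ∈ D.R → D.attached A = true ∧ D.attached B = true ∧ A ≠ B ∧ r A B

/-- A new pair factors through the arc as `r X A`, `r A B`, `r B Y`. Its ends are distinct because
the middle step strictly increases the strand number. -/
theorem SoundR.arcSets (hr : StrandOrder r) (h : D.SoundR r) {A B : ℕ}
    (hA : D.attached A = true) (hB : D.attached B = true) (hne : A ≠ B) (hAB : r A B) :
    (D.arcSets A B).SoundR r := by
  intro X Y hXY
  rcases mem_arcSets.1 hXY with h1 | ⟨h1, h2⟩
  · exact h X Y h1
  · have hX : D.attached X = true ∧ r X A := by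
      rcases h1 with rfl | h1
      · exact ⟨hA, hr.refl _⟩
      · exact ⟨(h _ _ h1).1, (h _ _ h1).2.2.2⟩
    have hY : D.attached Y = true ∧ r B Y := by
      rcases h2 with rfl | h2
      · exact ⟨hB, hr.refl _⟩
      · exact ⟨(h _ _ h2).2.1, (h _ _ h2).2.2.2⟩
    refine ⟨hX.1, hY.1, ?_, hr.trans hX.2 (hr.trans hAB hY.2)⟩
    have h3 := hr.le hX.2
    have h4 := hr.le hY.2
    have h5 := hr.le hAB
    omega

theorem Inv.le_label (hD : D.Inv r n) {X B : ℕ} (hX : D.attached X = true)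
    (hB : D.attached B = true) (h : X = B ∨ r X B) : X = B ∨ (X, B) ∈ D.R := by
  by_cases he : X = B
  · exact Or.inl he
  · exact Or.inr ((hD.exact X B).2 ⟨hX, hB, he, h.resolve_left he⟩)

/-- Add the arcs from the sets of the strands `ps` to the set of `v`. -/
def arcs (D : DNSP) (ps : List ℕ) (v : ℕ) : DNSP :=
  ps.foldl (fun D p => D.arc p v) D

theorem arcs_frame (D : DNSP) (ps : List ℕ) (v : ℕ) :
    (D.arcs ps v).find = D.find ∧ (D.arcs ps v).attached = D.attached ∧
      (D.arcs ps v).attPred = D.attPred ∧ (D.arcs ps v).attSucc = D.attSucc ∧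
      D.R ⊆ (D.arcs ps v).R := by
  induction ps generalizing D with
  | nil => simp [arcs]
  | cons p ps ih =>
    obtain ⟨h1, h2, h3, h4, h5⟩ := ih (D.arc p v)
    refine ⟨h1, h2, h3, h4, Finset.Subset.trans ?_ h5⟩
    rintro ⟨X, Y⟩ hXY
    exact mem_arcSets.2 (Or.inl hXY)

theorem SoundR.arcs (hr : StrandOrder r) (h : D.SoundR r) {ps : List ℕ} {v : ℕ}
    (hv : D.attached (D.find v) = true)
    (hps : ∀ p ∈ ps, D.attached (D.find p) = true ∧ D.find p ≠ D.find v ∧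
      r (D.find p) (D.find v)) :
    (D.arcs ps v).SoundR r := by
  induction ps generalizing D with
  | nil => exact h
  | cons p ps ih =>
    obtain ⟨h1, h2, h3⟩ := hps p (by simp)
    exact ih (h.arcSets hr h1 hv h2 h3) hv fun q hq => hps q (by simp [hq])

/-- The arc from the set of `p` is closed at once over all predecessors of its tail, and later arcs
only enlarge `R`. -/
theorem mem_arcs {ps : List ℕ} {v p X : ℕ} (hp : p ∈ ps)
    (hX : X = D.find p ∨ (X, D.find p) ∈ D.R) : (X, D.find v) ∈ (D.arcs ps v).R := by
  induction ps generalizing D with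
  | nil => simp at hp
  | cons q ps ih =>
    rcases List.mem_cons.1 hp with rfl | hp
    · exact (arcs_frame (D.arc p v) ps v).2.2.2.2 (mem_arcSets.2 (Or.inr ⟨hX, Or.inl rfl⟩))
    · exact ih (D := D.arc q v) hp (hX.imp_right fun h => mem_arcSets.2 (Or.inl h))

/-- The new strand as an attached singleton with arcs from the sets of `ps`. -/
theorem Inv.makeAttached_arcs (hr : StrandOrder r) (hD : D.Inv r n) {ps : List ℕ}
    (hnew : NewStrand r n ps)
    (hp : ∀ p ∈ ps, p ≤ n ∧ D.isAttached p = true ∧ ∀ x ≤ n, D.find x = D.find p → r x p) :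
    AddSingleton n D ((D.makeAttached (n + 1)).arcs ps (n + 1)) ∧
      ((D.makeAttached (n + 1)).arcs ps (n + 1)).attached (n + 1) = true ∧
      ((D.makeAttached (n + 1)).arcs ps (n + 1)).Inv r (n + 1) := by
  set D₁ := D.makeAttached (n + 1) with hD₁
  set D' := D₁.arcs ps (n + 1) with hD'
  obtain ⟨f1, f2, f3, f4, f5⟩ := arcs_frame D₁ ps (n + 1)
  have hfo : ∀ x ≤ n, D₁.find x = D.find x := fun x hx =>
    Function.update_of_ne (by omega) _ _
  have hfn : D₁.find (n + 1) = n + 1 := Function.update_self _ _ _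
  have hao : ∀ A, A ≠ n + 1 → D₁.attached A = D.attached A := fun A hA =>
    Function.update_of_ne hA _ _
  have han : D₁.attached (n + 1) = true := Function.update_self _ _ _
  have hmono : ∀ A, D.attached A = true → D₁.attached A = true := fun A hA => by
    rw [hao A (by have := (hD.label A hA).1; omega), hA]
  have hA : AddSingleton n D D' := by
    refine ⟨by rw [f1, hfn], fun x hx => by rw [f1, hfo x hx], fun A hA => by rw [f2, hao A hA],
      fun A _ => by rw [f3]; rfl, fun A _ => by rw [f4]; rfl⟩
  have hat : D'.attached (n + 1) = true := by rw [f2, han]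
  refine ⟨hA, hat, hD.addAttached hr hA hat ?_ hnew hp⟩
  have hs₁ : D₁.SoundR r := fun A B hAB => by
    obtain ⟨h1, h2, h3⟩ := (hD.exact A B).1 hAB
    exact ⟨hmono A h1, hmono B h2, h3⟩
  have hs : D'.SoundR r := by
    refine hs₁.arcs hr (by rw [hfn, han]) fun p hpp => ?_
    obtain ⟨h1, h2, h3⟩ := hp p hpp
    have hle := hD.find_le p h1
    rw [hfo p h1, hfn]
    exact ⟨hmono _ h2, by omega,
      (hnew _).2 (Or.inr ⟨p, hpp, h3 _ hle (hD.find_find p h1)⟩)⟩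
  -- Given soundness, only completeness of `R` is left. The only pairs not yet covered end in the
  -- new label, and completeness at some predecessor `p` supplies them.
  intro A B
  refine ⟨hs A B, ?_⟩
  rintro ⟨h1, h2, h3, h4⟩
  rw [f2] at h1 h2
  have hAl := hr.le h4
  have hBn : B ≤ n + 1 := by
    by_contra hc
    have := (hD.label B (hao B (by omega) ▸ h2)).1
    omega
  have hAn : A ≠ n + 1 := by omega
  rw [hao A hAn] at h1
  by_cases hB : B = n + 1
  · subst hB
    rcases (hnew A).1 h4 with h5 | ⟨p, hpp, hAp⟩
    · exact absurd h5 hAn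
    · obtain ⟨h6, h7, _⟩ := hp p hpp
      have h8 := hD.complete_label h1 h6 hAp (Or.inl h7)
      rw [predOf_of_att h7] at h8
      have := mem_arcs (D := D₁) (v := n + 1) hpp (X := A) (by
        rw [hfo p h6]
        exact hD.le_label h1 h7 h8)
      rwa [hfn] at this
  · rw [hao B hB] at h2
    exact f5 ((hD.exact A B).2 ⟨h1, h2, h3, h4⟩)

theorem attachify_of_att {u : ℕ} (h : D.isAttached u = true) : D.attachify u = D := by
  simp [attachify, h]

theorem attachify_of_unatt {u : ℕ} (h : D.isAttached u = false) : D.attachify u =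
    { D with attached := Function.update D.attached (D.find u) true }.arcSets
      (D.attPred (D.find u)) (D.find u) := by
  simp [attachify, h]

theorem attachify_find (u : ℕ) : (D.attachify u).find = D.find := by
  unfold attachify; split <;> rfl

/-- Add the arcs from the set of `u` to the sets of the strands `ss`. -/
def outArcs (D : DNSP) (u : ℕ) (ss : List ℕ) : DNSP :=
  ss.foldl (fun D s => D.arc u s) D

theorem outArcs_frame (D : DNSP) (u : ℕ) (ss : List ℕ) :
    (outArcs D u ss).find = D.find ∧ (outArcs D u ss).attached = D.attached ∧
      (outArcs D u ss).attPred = D.attPred ∧ (outArcs D u ss).attSucc = D.attSucc ∧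
      D.R ⊆ (outArcs D u ss).R := by
  induction ss generalizing D with
  | nil => simp [outArcs]
  | cons s ss ih =>
    obtain ⟨h1, h2, h3, h4, h5⟩ := ih (D.arc u s)
    refine ⟨h1, h2, h3, h4, Finset.Subset.trans ?_ h5⟩
    rintro ⟨X, Y⟩ hXY
    exact mem_arcSets.2 (Or.inl hXY)

theorem outArcs_sound (hr : StrandOrder r) (h : D.SoundR r) {u : ℕ} {ss : List ℕ}
    (hu : D.attached (D.find u) = true)
    (hss : ∀ s ∈ ss, D.attached (D.find s) = true ∧ D.find u ≠ D.find s ∧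
      r (D.find u) (D.find s)) :
    (outArcs D u ss).SoundR r := by
  induction ss generalizing D with
  | nil => exact h
  | cons s ss ih =>
    obtain ⟨h1, h2, h3⟩ := hss s (by simp)
    exact ih (h.arcSets hr hu h1 h2 h3) hu fun q hq => hss q (by simp [hq])

/-- Dual to `mem_arcs`: the closure over the successors of the head takes place when the arc is
added. -/
theorem mem_outArcs {u s Y : ℕ} {ss : List ℕ} (hs : s ∈ ss)
    (hY : Y = D.find s ∨ (D.find s, Y) ∈ D.R) : (D.find u, Y) ∈ (outArcs D u ss).R := by
  induction ss generalizing D with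
  | nil => simp at hs
  | cons q ss ih =>
    rcases List.mem_cons.1 hs with rfl | hs
    · exact (outArcs_frame (D.arc u s) u ss).2.2.2.2
        (mem_arcSets.2 (Or.inr ⟨Or.inl rfl, hY⟩))
    · exact ih (D := D.arc u q) hs (hY.imp_right fun h => mem_arcSets.2 (Or.inl h))

theorem eq_of_fields (h₁ : D'.find = D.find) (h₂ : D'.attached = D.attached)
    (h₃ : D'.attPred = D.attPred) (h₄ : D'.attSucc = D.attSucc) (h₅ : D'.R = D.R) : D' = D := by
  cases D; cases D'; simp_all

end DNSP

namespace Core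

variable {D D' : DNSP} {r : ℕ → ℕ → Prop} {n : ℕ} {L L' : List Sink} {fut fut' : Set ℕ}

/-- Making the set of a sink attached, with arcs to the attached sets of the exits. -/
theorem attachify (h : Core r n L fut D) (hr : StrandOrder r) {e : Sink} (he : e ∈ L)
    (hex : ∀ s ∈ e.exits, s ≤ n ∧ D.isAttached s = true ∧
      ∀ x ≤ n, D.find x = D.find s → r s x) (hexlt : ∀ s ∈ e.exits, e.snk < s) :
    Core r n L fut (DNSP.outArcs (D.attachify e.snk) e.snk e.exits) ∧
      (DNSP.outArcs (D.attachify e.snk) e.snk e.exits).isAttached e.snk = true ∧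
      (∀ x, D.isAttached x = true →
        (DNSP.outArcs (D.attachify e.snk) e.snk e.exits).isAttached x = true) := by
  have hD := h.nsp
  have hE := h.sink e he
  obtain ⟨f1, f2, f3, f4, f5⟩ := DNSP.outArcs_frame (D.attachify e.snk) e.snk e.exits
  set D' := DNSP.outArcs (D.attachify e.snk) e.snk e.exits with hD'
  rw [DNSP.attachify_find] at f1
  have hUn := hD.find_le _ hE.snk_le
  have hUU := hD.find_find _ hE.snk_le
  have hUs : ∀ s ∈ e.exits, D.find e.snk ≠ D.find s ∧ r (D.find e.snk) (D.find s) := by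
    intro s hs
    obtain ⟨h1, _, h3⟩ := hex s hs
    refine ⟨fun hc => ?_, hr.trans (hr.trans (hE.snk_max _ hUn hUU) (hE.exits s hs).1)
      (h3 _ (hD.find_le s h1) (hD.find_find s h1))⟩
    have := hr.le (hE.snk_max s h1 hc.symm)
    have := hexlt s hs
    omega
  -- If the set is attached already, exactness puts the arcs to the exits in `R`, and the whole
  -- state is unchanged.
  by_cases ha : D.isAttached e.snk = true
  · rw [DNSP.attachify_of_att ha] at f2 f3 f4 f5
    have hs : D'.SoundR r := by
      rw [hD', DNSP.attachify_of_att ha]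
      exact DNSP.outArcs_sound hr (fun A B hAB => (hD.exact A B).1 hAB) ha
        fun s hs => ⟨(hex s hs).2.1, hUs s hs⟩
    have hRR : D'.R = D.R := by
      refine Finset.Subset.antisymm ?_ f5
      rintro ⟨X, Y⟩ hXY
      have := hs X Y hXY
      rw [f2] at this
      exact (hD.exact X Y).2 this
    have hDD : D' = D := DNSP.eq_of_fields f1 f2 f3 f4 hRR
    rw [hDD]
    exact ⟨h, ha, fun _ => id⟩
  · have ha : D.isAttached e.snk = false := by simpa using ha
    set U := D.find e.snk with hU
    have hnosucc : D.attSucc U = none := (hE.unatt ha).2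
    have hPatt := hD.pred_att _ hE.snk_le ha hnosucc
    rw [← hU] at hPatt
    have hPl := hD.label _ hPatt
    have hUunatt : D.isAttached U = false := by rw [DNSP.isAttached, hUU]; exact ha
    have hUlive : D.Live U := Or.inr (by rw [hUU, hnosucc])
    have hpredU : D.predOf U = D.attPred U := by rw [DNSP.predOf_of_unatt hUunatt, hUU]
    have hPU : r (D.attPred U) U := hD.pred_le U hUn hUunatt (by rw [hUU, hnosucc]) _ hPl.1
      (by rw [hPl.2, hUU])
    have hPneU : D.attPred U ≠ U := by
      intro hc
      rw [hc] at hPatt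
      rw [DNSP.isAttached, ← hU, hPatt] at ha
      simp at ha
    have hmono : ∀ A, D.attached A = true → Function.update D.attached U true A = true := by
      intro A hA
      rw [Function.update_apply]; split <;> simp [hA]
    have f2' : D'.attached = Function.update D.attached U true := by
      rw [f2, DNSP.attachify_of_unatt ha]; rfl
    rw [DNSP.attachify_of_unatt ha] at f3 f4 f5
    set D₁ : DNSP := { D with attached := Function.update D.attached U true } with hD₁
    have hs₁ : D₁.SoundR r := fun A B hAB => by
      obtain ⟨h1, h2, h3⟩ := (hD.exact A B).1 hAB
      exact ⟨hmono A h1, hmono B h2, h3⟩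
    have hs₂ : (D₁.arcSets (D.attPred U) U).SoundR r :=
      hs₁.arcSets hr (hmono _ hPatt) (Function.update_self _ _ _) hPneU hPU
    have hs : D'.SoundR r := by
      rw [hD', DNSP.attachify_of_unatt ha]
      refine DNSP.outArcs_sound hr hs₂ (Function.update_self _ _ _) ?_
      exact fun s hs => ⟨hmono _ (hex s hs).2.1, hUs s hs⟩
    have hexact : D'.ExactR r := by
      intro A B
      refine ⟨hs A B, ?_⟩
      rintro ⟨h1, h2, h3, h4⟩
      rw [f2', Function.update_apply] at h1 h2
      by_cases hAU : A = U
      · have hBU : B ≠ U := fun hc => h3 (hAU.trans hc.symm)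
        rw [if_neg hBU] at h2
        have hBl := hD.label B h2
        have hBa := hD.isAttached_label h2
        rw [hAU] at h4 ⊢
        -- Every path from `U` to another attached label passes an exit, so the arcs to the exits
        -- supply all pairs that start in `U`.
        rcases hE.out U hUn B hBl.1 hUU h4 (Or.inl hBa) with h5 | ⟨s, hs', hsB⟩
        · rw [hBl.2] at h5; exact absurd h5 hBU
        · obtain ⟨h6, h7, _⟩ := hex s hs'
          have h8 := hD.complete_att h6 hBl.1 h7 hsB (Or.inl hBa)
          rw [DNSP.predOf_of_att hBa, hBl.2] at h8
          have h9 := hD.le_label h7 h2 h8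
          rw [hD', DNSP.attachify_of_unatt ha]
          refine DNSP.mem_outArcs (D := D₁.arcSets (D.attPred U) U) (u := e.snk) hs' ?_
          rcases h9 with h9 | h9
          · exact Or.inl h9.symm
          · exact Or.inr (DNSP.mem_arcSets.2 (Or.inl h9))
      · rw [if_neg hAU] at h1
        apply f5
        by_cases hBU : B = U
        · rw [hBU] at h4 ⊢
          -- Pairs that end in `U` are supplied by the arc from its attached predecessor.
          rcases hD.complete_label h1 hUn h4 hUlive with h5 | h5
          · rw [hUU] at h5; exact absurd h5 hAU
          · rw [hpredU] at h5
            exact DNSP.mem_arcSets.2 (Or.inr ⟨hD.le_label h1 hPatt (Or.inr h5), Or.inl rfl⟩)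
        · rw [if_neg hBU] at h2
          exact DNSP.mem_arcSets.2 (Or.inl ((hD.exact A B).2 ⟨h1, h2, h3, h4⟩))
    refine ⟨h.attach hr he ha hex f1 f2' f3 f4 hexact, ?_, fun x hx => ?_⟩
    · rw [DNSP.isAttached, f1, f2', ← hU, Function.update_self]
    · rw [DNSP.isAttached, f1, f2']
      exact hmono _ hx

end Core

/-! ### The invariant of the bags. -/

/-- The invariant of `D_SP` with respect to the blocks `L` and the number `N` of function
instances. -/
structure Bags (r : ℕ → ℕ → Prop) (n : ℕ) (L : List Sink) (N : ℕ) (P : DSP) (D : DNSP) :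
    Prop where
  -- Without gaps between blocks, a join of three of them covers one interval of strands.
  contig : L.IsChain fun e e' => e.src = e'.snk + 1
  -- Not claimed for attached blocks: these may contain futures, whose bags are never merged.
  unatt : ∀ e ∈ L, D.isAttached e.snk = false → ∀ x, e.src ≤ x → x ≤ e.snk → P.find x = e.fn
  -- A forked block is excluded because a later block of the same instance shares its bag.
  rel : ∀ e ∈ L, e.status ≠ .forked → ∀ x ≤ n, P.find x = e.fn → r x e.snk
  kind : ∀ e ∈ L, P.kind e.fn = .S ↔ e.status ≠ .returned
  cover : ∀ x ≤ n, P.kind (P.find x) = .S → ∃ e ∈ L, e.status = .running ∧ e.fn = P.find x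
  fn_lt : ∀ e ∈ L, e.fn < N
  find_lt : ∀ x ≤ n, P.find x < N

namespace Bags

variable {r : ℕ → ℕ → Prop} {n N : ℕ} {L : List Sink} {P : DSP} {D D' : DNSP}

/-- The label `N` is fresh for strands and blocks, so no old bag is touched. -/
theorem call {e g e' : Sink} (h : Bags r n (e :: L) N P D) (hr : StrandOrder r)
    (hle : ∀ e₀ ∈ e :: L, e₀.snk ≤ n)
    (hgrow : ∀ x ≤ n, D.isAttached x = true → D'.isAttached x = true) (hsnk : e.snk = n)
    (he' : e' = { e with exits := [n + 1] }) (hg : g = ⟨N, n + 1, n + 1, [], true, .running⟩) :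
    Bags r (n + 1) (g :: e' :: L) (N + 1) (P.makeS N (n + 1)) D' := by
  have hold : ∀ x ≤ n, (P.makeS N (n + 1)).find x = P.find x := fun x hx =>
    Function.update_of_ne (by omega) _ _
  have hnew : (P.makeS N (n + 1)).find (n + 1) = N := Function.update_self _ _ _
  have hkold : ∀ F < N, (P.makeS N (n + 1)).kind F = P.kind F := fun F hF =>
    Function.update_of_ne (by omega) _ _
  have hknew : (P.makeS N (n + 1)).kind N = .S := Function.update_self _ _ _
  have hmem : ∀ e₀ ∈ g :: e' :: L, e₀ = g ∨ ∃ e₁ ∈ e :: L, e₀.fn = e₁.fn ∧ e₀.src = e₁.src ∧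
      e₀.snk = e₁.snk ∧ e₀.status = e₁.status := by
    intro e₀ h₀
    simp only [List.mem_cons] at h₀
    rcases h₀ with h₀ | rfl | h₀
    · exact Or.inl h₀
    · exact Or.inr ⟨e, by simp, by simp [he']⟩
    · exact Or.inr ⟨e₀, by simp [h₀], rfl, rfl, rfl, rfl⟩
  refine ⟨?_, ?_, ?_, ?_, ?_, ?_, ?_⟩
  · have hc := h.contig
    rw [List.isChain_cons_cons]
    refine ⟨by rw [hg, he']; simp [hsnk], ?_⟩
    rw [List.isChain_cons] at hc ⊢
    rw [he']
    exact hc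
  · intro e₀ h₀ ha x hx hx'
    rcases hmem e₀ h₀ with rfl | ⟨e₁, h₁, h2, h3, h4, h5⟩
    · rw [hg] at hx hx' ⊢
      simp only at hx hx' ⊢
      obtain rfl : x = n + 1 := by omega
      exact hnew
    · have hl := hle e₁ h₁
      rw [h4] at ha hx'
      rw [h2, hold x (by omega)]
      refine h.unatt e₁ h₁ ?_ x (h3 ▸ hx) hx'
      by_contra hc
      rw [hgrow _ hl (by simpa using hc)] at ha
      simp at ha
  · intro e₀ h₀ hs x hx hf
    rcases hmem e₀ h₀ with rfl | ⟨e₁, h₁, h2, h3, h4, h5⟩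
    · by_cases hxn : x ≤ n
      · rw [hold x hxn, hg] at hf
        have := h.find_lt x hxn
        simp only at hf
        omega
      · obtain rfl : x = n + 1 := by omega
        rw [hg]; exact hr.refl _
    · rw [h2] at hf
      rw [h4]
      by_cases hxn : x ≤ n
      · rw [hold x hxn] at hf
        exact h.rel e₁ h₁ (h5 ▸ hs) x hxn hf
      · obtain rfl : x = n + 1 := by omega
        rw [hnew] at hf
        have := h.fn_lt e₁ h₁
        omega
  · intro e₀ h₀
    rcases hmem e₀ h₀ with rfl | ⟨e₁, h₁, h2, h3, h4, h5⟩
    · rw [hg]; simp [hknew]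
    · rw [h2, h5, hkold _ (h.fn_lt e₁ h₁)]
      exact h.kind e₁ h₁
  · intro x hx hk
    by_cases hxn : x ≤ n
    · rw [hold x hxn] at hk ⊢
      rw [hkold _ (h.find_lt x hxn)] at hk
      obtain ⟨e₀, h₀, h1, h2⟩ := h.cover x hxn hk
      rcases List.mem_cons.1 h₀ with rfl | h₀
      · exact ⟨e', by simp, by simp [he', h1, h2]⟩
      · exact ⟨e₀, by simp [h₀], h1, h2⟩
    · obtain rfl : x = n + 1 := by omega
      exact ⟨g, by simp, by rw [hg], by rw [hg, hnew]⟩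
  · intro e₀ h₀
    rcases hmem e₀ h₀ with rfl | ⟨e₁, h₁, h2, _⟩
    · rw [hg]; simp
    · rw [h2]; have := h.fn_lt e₁ h₁; omega
  · intro x hx
    by_cases hxn : x ≤ n
    · rw [hold x hxn]; have := h.find_lt x hxn; omega
    · obtain rfl : x = n + 1 := by omega
      rw [hnew]; omega

/-- The base block of the child is its only listed block, so turning its bag into a `P`-bag affects
no other block. -/
theorem retSpawn {g e g' e' k : Sink} (h : Bags r n (g :: e :: L) N P D) (hr : StrandOrder r)
    (hord : (g :: e :: L).Pairwise (Sink.After r))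
    (hle : ∀ e₀ ∈ g :: e :: L, e₀.snk ≤ n)
    (hgrow : ∀ x ≤ n, D.isAttached x = true → D'.isAttached x = true) (hsnk : g.snk = n)
    (hgb : g.base = true) (hgs : g.status = .running) (hst : e.status = .running)
    (hen : r e.snk (n + 1))
    (hg' : g' = { g with status := .returned })
    (he' : e' = { e with exits := e.exits ++ [n + 1], status := .forked })
    (hk : k = ⟨e.fn, n + 1, n + 1, [], false, .running⟩) :
    Bags r (n + 1) (k :: g' :: e' :: L) N ((P.toP g.fn).add e.fn (n + 1)) D' := by
  have hord := List.pairwise_cons.1 hord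
  have hord' := List.pairwise_cons.1 hord.2
  set P' := (P.toP g.fn).add e.fn (n + 1) with hP'
  have hold : ∀ x ≤ n, P'.find x = P.find x := fun x hx => Function.update_of_ne (by omega) _ _
  have hnew : P'.find (n + 1) = e.fn := Function.update_self _ _ _
  have hkold : ∀ F, F ≠ g.fn → P'.kind F = P.kind F := fun F hF =>
    Function.update_of_ne hF _ _
  have hknew : P'.kind g.fn = .P := Function.update_self _ _ _
  have hge : e.fn ≠ g.fn := ((hord.1 e (by simp)).base hgb).symm
  have hgL : ∀ e₀ ∈ L, e₀.fn ≠ g.fn := fun e₀ h₀ => ((hord.1 e₀ (by simp [h₀])).base hgb).symm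
  have hmem : ∀ e₀ ∈ k :: g' :: e' :: L, e₀ = k ∨ ∃ e₁ ∈ g :: e :: L, e₀.fn = e₁.fn ∧
      e₀.src = e₁.src ∧ e₀.snk = e₁.snk := by
    intro e₀ h₀
    simp only [List.mem_cons] at h₀
    rcases h₀ with h₀ | rfl | rfl | h₀
    · exact Or.inl h₀
    · exact Or.inr ⟨g, by simp, by simp [hg']⟩
    · exact Or.inr ⟨e, by simp, by simp [he']⟩
    · exact Or.inr ⟨e₀, by simp [h₀], rfl, rfl, rfl⟩
  refine ⟨?_, ?_, ?_, ?_, ?_, ?_, ?_⟩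
  · have hc := h.contig
    rw [List.isChain_cons_cons] at hc
    rw [List.isChain_cons_cons, List.isChain_cons_cons]
    refine ⟨by rw [hk, hg']; simp [hsnk], by rw [hg', he']; exact hc.1, ?_⟩
    have hc := hc.2
    rw [List.isChain_cons] at hc ⊢
    rw [he']
    exact hc
  · intro e₀ h₀ ha x hx hx'
    rcases hmem e₀ h₀ with rfl | ⟨e₁, h₁, h2, h3, h4⟩
    · rw [hk] at hx hx' ⊢
      simp only at hx hx' ⊢
      obtain rfl : x = n + 1 := by omega
      exact hnew
    · have hl := hle e₁ h₁
      rw [h4] at ha hx'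
      rw [h2, hold x (by omega)]
      refine h.unatt e₁ h₁ ?_ x (h3 ▸ hx) hx'
      by_contra hc
      rw [hgrow _ hl (by simpa using hc)] at ha
      simp at ha
  · intro e₀ h₀ hs x hx hf
    simp only [List.mem_cons] at h₀
    rcases h₀ with rfl | rfl | rfl | h₀
    · rw [hk] at hf ⊢
      simp only at hf ⊢
      by_cases hxn : x ≤ n
      · rw [hold x hxn] at hf
        exact hr.trans (h.rel e (by simp) (by simp [hst]) x hxn hf) hen
      · obtain rfl : x = n + 1 := by omega
        exact hr.refl _
    · rw [hg'] at hf ⊢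
      simp only at hf ⊢
      by_cases hxn : x ≤ n
      · rw [hold x hxn] at hf
        exact h.rel g (by simp) (by simp [hgs]) x hxn hf
      · obtain rfl : x = n + 1 := by omega
        exact absurd (hnew.symm.trans hf) hge
    · simp [he'] at hs
    · by_cases hxn : x ≤ n
      · rw [hold x hxn] at hf
        exact h.rel e₀ (by simp [h₀]) hs x hxn hf
      · obtain rfl : x = n + 1 := by omega
        exact absurd (hnew.symm.trans hf) ((hord'.1 e₀ h₀).top hs)
  · intro e₀ h₀
    simp only [List.mem_cons] at h₀
    have hek := h.kind e (by simp)
    rcases h₀ with rfl | rfl | rfl | h₀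
    · rw [hk]; simp only
      rw [hkold _ hge, hek, hst]
    · rw [hg']; simp [hknew]
    · rw [he']; simp only
      rw [hkold _ hge, hek, hst]; simp
    · rw [hkold _ (hgL e₀ h₀)]
      exact h.kind e₀ (by simp [h₀])
  · intro x hx hkx
    by_cases hxn : x ≤ n
    · rw [hold x hxn] at hkx ⊢
      have hxg : P.find x ≠ g.fn := by
        intro hc
        rw [hc, hknew] at hkx
        simp at hkx
      rw [hkold _ hxg] at hkx
      obtain ⟨e₀, h₀, h1, h2⟩ := h.cover x hxn hkx
      simp only [List.mem_cons] at h₀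
      rcases h₀ with rfl | rfl | h₀
      · exact absurd h2.symm hxg
      · exact ⟨k, by simp, by simp [hk], by simp [hk, h2]⟩
      · exact ⟨e₀, by simp [h₀], h1, h2⟩
    · obtain rfl : x = n + 1 := by omega
      exact ⟨k, by simp, by simp [hk], by simp [hk, hnew]⟩
  · intro e₀ h₀
    rcases hmem e₀ h₀ with rfl | ⟨e₁, h₁, h2, _⟩
    · rw [hk]; exact h.fn_lt e (by simp)
    · rw [h2]; exact h.fn_lt e₁ h₁
  · intro x hx
    by_cases hxn : x ≤ n
    · rw [hold x hxn]; exact h.find_lt x hxn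
    · obtain rfl : x = n + 1 := by omega
      rw [hnew]; exact h.fn_lt e (by simp)

/-- The new strand is put into the bag of the block `e`, which goes on; the blocks `M`, which are
later than `e`, are closed. -/
theorem extend {M : List Sink} {e e' : Sink} {P' : DSP} (h : Bags r n (M ++ e :: L) N P D)
    (hr : StrandOrder r) (hord : (e :: L).Pairwise (Sink.After r))
    (hle : ∀ e₀ ∈ L, e₀.snk ≤ n)
    (hgrow : ∀ x ≤ n, D.isAttached x = true → D'.isAttached x = true)
    (he' : e' = ⟨e.fn, e.src, n + 1, [], e.base, .running⟩)
    (hst : e.status ≠ .returned)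
    (hun : D'.isAttached (n + 1) = false → ∀ x ≤ n, e.src ≤ x → P'.find x = e.fn)
    -- The second alternative occurs at a sync, which moves the bag of the joined child.
    (hold : ∀ x ≤ n, P'.find x = P.find x ∨
      P'.find x = e.fn ∧ ∀ e₀ ∈ L, P.find x ≠ e₀.fn)
    (hnew : P'.find (n + 1) = e.fn)
    (hkold : ∀ e₀ ∈ e :: L, P'.kind e₀.fn = P.kind e₀.fn)
    (hk : ∀ F, P'.kind F = .S → P.kind F = .S)
    -- A running block that is closed belongs to the instance of `e`, or else its bag has ceased to
    -- be an `S`-bag.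
    (hM : ∀ x ≤ n, ∀ e₀ ∈ M, e₀.status = .running → e₀.fn = P'.find x → P'.kind e₀.fn = .S →
      e₀.fn = e.fn)
    (hrel : ∀ x ≤ n, P'.find x = e.fn → r x (n + 1)) :
    Bags r (n + 1) (e' :: L) N P' D' := by
  have hord := List.pairwise_cons.1 hord
  have hsub : ∀ e₀ ∈ e :: L, e₀ ∈ M ++ e :: L := fun e₀ h₀ => List.mem_append_right _ h₀
  have hsub' : ∀ e₀ ∈ L, e₀ ∈ M ++ e :: L := fun e₀ h₀ => hsub e₀ (by simp [h₀])
  refine ⟨?_, ?_, ?_, ?_, ?_, ?_, ?_⟩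
  · have hc := h.contig.right_of_append
    rw [List.isChain_cons] at hc ⊢
    rw [he']
    exact hc
  · intro e₀ h₀ ha x hx hx'
    rcases List.mem_cons.1 h₀ with rfl | h₀
    · rw [he'] at ha hx hx' ⊢
      simp only at ha hx hx' ⊢
      by_cases hxn : x ≤ n
      · exact hun ha x hxn hx
      · obtain rfl : x = n + 1 := by omega
        exact hnew
    · have hl := hle e₀ h₀
      have ha' : D.isAttached e₀.snk = false := by
        by_contra hc
        rw [hgrow _ hl (by simpa using hc)] at ha
        simp at ha
      have := h.unatt e₀ (hsub' e₀ h₀) ha' x hx hx'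
      rcases hold x (by omega) with h1 | ⟨h1, h2⟩
      · rw [h1, this]
      · exact absurd this (h2 e₀ h₀)
  · intro e₀ h₀ hs x hx hf
    rcases List.mem_cons.1 h₀ with rfl | h₀
    · rw [he'] at hf ⊢
      simp only at hf ⊢
      by_cases hxn : x ≤ n
      · exact hrel x hxn hf
      · obtain rfl : x = n + 1 := by omega
        exact hr.refl _
    · have hne := (hord.1 e₀ h₀).top hs
      by_cases hxn : x ≤ n
      · rcases hold x hxn with h1 | ⟨h1, h2⟩
        · exact h.rel e₀ (hsub' e₀ h₀) hs x hxn (h1.symm.trans hf)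
        · exact absurd (h1.symm.trans hf) hne
      · obtain rfl : x = n + 1 := by omega
        exact absurd (hnew.symm.trans hf) hne
  · intro e₀ h₀
    rcases List.mem_cons.1 h₀ with rfl | h₀
    · rw [he']; simp only
      rw [hkold e (by simp), h.kind e (hsub e (by simp))]
      simp [hst]
    · rw [hkold e₀ (by simp [h₀]), h.kind e₀ (hsub' e₀ h₀)]
  · intro x hx hkx
    by_cases hxe : P'.find x = e.fn
    · exact ⟨e', by simp, by simp [he'], by simp [he', hxe]⟩
    · have hxn : x ≤ n := by
        by_contra hc
        obtain rfl : x = n + 1 := by omega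
        exact hxe hnew
      rcases hold x hxn with h1 | ⟨h1, _⟩
      · have h0 := hk _ hkx
        rw [h1] at h0
        obtain ⟨e₀, h₀, h2, h3⟩ := h.cover x hxn h0
        rw [← h1] at h3
        rcases List.mem_append.1 h₀ with h₀ | h₀
        · exact absurd (h3.symm.trans (hM x hxn e₀ h₀ h2 h3 (h3 ▸ hkx))) hxe
        · rcases List.mem_cons.1 h₀ with rfl | h₀
          · exact absurd h3.symm hxe
          · exact ⟨e₀, by simp [h₀], h2, h3⟩
      · exact absurd h1 hxe
  · intro e₀ h₀
    rcases List.mem_cons.1 h₀ with rfl | h₀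
    · rw [he']; exact h.fn_lt e (hsub e (by simp))
    · exact h.fn_lt e₀ (hsub' e₀ h₀)
  · intro x hx
    by_cases hxn : x ≤ n
    · rcases hold x hxn with h1 | ⟨h1, _⟩ <;> rw [h1]
      · exact h.find_lt x hxn
      · exact h.fn_lt e (hsub e (by simp))
    · obtain rfl : x = n + 1 := by omega
      rw [hnew]; exact h.fn_lt e (hsub e (by simp))

end Bags

/-! ### The blocks of an execution and the correctness of the query. -/

/-- The blocks of a function instance `F` with first strand `first` and unjoined children, when its
last strand is `t`. -/
def blocks (first F t : ℕ) (exits : List ℕ) (st : Status) : List Fork → List Sink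
  | [] => [⟨F, first, t, exits, true, st⟩]
  | k :: ks => ⟨F, k.s₂, t, exits, false, st⟩ :: ⟨k.child, k.s₁, k.t₁, [], true, .returned⟩ ::
      blocks first F k.f [k.s₁, k.s₂] .forked ks

/-- The first strand of the current block. -/
def blockSrc (first : ℕ) : List Fork → ℕ
  | [] => first
  | k :: _ => k.s₂

/-- The blocks but the current one. -/
def blockTail (first F : ℕ) : List Fork → List Sink
  | [] => []
  | k :: ks => ⟨k.child, k.s₁, k.t₁, [], true, .returned⟩ ::
      blocks first F k.f [k.s₁, k.s₂] .forked ks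

theorem blocks_eq (first F t : ℕ) (exits : List ℕ) (st : Status) (ks : List Fork) :
    blocks first F t exits st ks =
      ⟨F, blockSrc first ks, t, exits, ks.isEmpty, st⟩ :: blockTail first F ks := by
  cases ks <;> rfl

/-- The first strand of the function instance above the stack. -/
def firstOf : List Frame → ℕ
  | [] => 0
  | fr :: _ => fr.first

/-- The blocks of the suspended function instances. -/
def stackBlocks : List Frame → List Sink
  | [] => []
  | fr :: st => blocks (firstOf st) fr.fn fr.caller [fr.first] .running fr.pending ++ stackBlocks st

variable {Loc : Type*}

/-- The blocks of an execution, the most recent one first. -/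
def Exec.sinks (E : Exec Loc) : List Sink :=
  blocks (firstOf E.stack) E.fn E.cur [] .running E.pending ++ stackBlocks E.stack

/-- The current block of an execution. -/
def Exec.headSink (E : Exec Loc) : Sink :=
  ⟨E.fn, blockSrc (firstOf E.stack) E.pending, E.cur, [], E.pending.isEmpty, .running⟩

/-- The other blocks of an execution. -/
def Exec.tailSinks (E : Exec Loc) : List Sink :=
  blockTail (firstOf E.stack) E.fn E.pending ++ stackBlocks E.stack

theorem Exec.sinks_eq (E : Exec Loc) : E.sinks = E.headSink :: E.tailSinks := by
  rw [sinks, blocks_eq]; rfl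

/-- The last strands of the completed futures. -/
def Exec.futs (E : Exec Loc) : Set ℕ := {t | ∃ h, E.futureLast h = some t}

/-- The invariant of the reachability structures of the detector. -/
structure Detector.Inv (r : ℕ → ℕ → Prop) (E : Exec Loc) (sp : DSP) (nsp : DNSP) : Prop where
  core : Core r E.cur E.sinks E.futs nsp
  bags : Bags r E.cur E.sinks E.numFns sp nsp
  -- Needed when a future returns: the continuation gets an arc from the caller with no further
  -- Attachify, and the last strand of the future is attached because its first one is.
  create : ∀ fr ∈ E.stack, fr.kind = .create →
    (fr.caller ≤ E.cur ∧ nsp.isAttached fr.caller = true) ∧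
      fr.first ≤ E.cur ∧ nsp.isAttached fr.first = true
  edges : ∀ ed ∈ E.edges, ed.dst ≤ E.cur

namespace Detector

variable {r : ℕ → ℕ → Prop} {E E' : Exec Loc} {sp : DSP} {nsp : DNSP}

/-- The query answers whether a strand precedes the current one. -/
theorem Inv.query (hr : StrandOrder r) {D : Detector Loc} (h : Inv r E D.sp D.nsp) {u : ℕ}
    (hu : u ≤ E.cur) : D.query u E.cur = true ↔ r u E.cur := by
  have hc := h.core
  have hb := h.bags
  have hD := hc.nsp
  rw [E.sinks_eq] at hc hb
  have hH := hc.sink E.headSink (by simp)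
  have hord := List.pairwise_cons.1 hc.order
  have hsnk : E.headSink.snk = E.cur := rfl
  have hsrc : r E.headSink.src E.cur := hH.rel
  have hcur : D.nsp.Live E.cur := hH.live
  unfold Detector.query
  by_cases hS : D.sp.kind (D.sp.find u) = .S
  · rw [if_pos hS]
    simp only [true_iff]
    -- An `S`-bag belongs to an instance with a running block. Its strands precede the sink of that
    -- block, and with it the current strand.
    obtain ⟨e, he, h1, h2⟩ := hb.cover u hu hS
    have hue := hb.rel e he (by simp [h1]) u hu h2.symm
    rcases List.mem_cons.1 he with rfl | he
    · exact hue
    · exact hr.trans hue (hr.trans ((hord.1 e he).rel (by simp [h1])) hsrc)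
  rw [if_neg hS]
  -- the sets that stand for the current strand consist of predecessors of it
  have hpred : D.nsp.attached (D.nsp.predOf E.cur) = true ∧
      ∀ y ≤ E.cur, D.nsp.find y = D.nsp.predOf E.cur → r y E.cur := by
    by_cases ha : D.nsp.isAttached E.cur = true
    · rw [DNSP.predOf_of_att ha]
      exact ⟨ha, hH.snk_max⟩
    · have ha' : D.nsp.isAttached E.cur = false := by simpa using ha
      have hs := hcur.resolve_left ha
      rw [DNSP.predOf_of_unatt ha']
      exact ⟨hD.pred_att _ le_rfl ha' hs, hD.pred_le _ le_rfl ha' hs⟩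
  cases hsu : D.nsp.succOf u with
  | none =>
    simp only [Bool.false_eq_true, false_iff]
    intro huv
    have hua : D.nsp.isAttached u = false := by
      by_contra hne
      rw [DNSP.succOf_of_att (by simpa using hne)] at hsu
      simp at hsu
    rw [DNSP.succOf_of_unatt hua] at hsu
    -- Here `u` lies in an open sink set. A returned block has no exits and cannot reach the current
    -- strand; the strands of any other unattached block are in an `S`-bag, which is excluded.
    obtain ⟨e, he, hue⟩ := hc.open_sink u hu hua hsu
    have hE := hc.sink e he
    by_cases hret : e.status = .returned
    · have := hE.out u hu E.cur le_rfl hue huv hcur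
      rw [hE.returned hret] at this
      have := hr.le (hE.snk_max _ le_rfl (by simpa using this))
      rcases List.mem_cons.1 he with rfl | he
      · simp [Exec.headSink] at hret
      · have := (hord.1 e he).lt
        have := hr.le hsrc
        omega
    · apply hS
      rw [hb.unatt e he ((DNSP.isAttached_congr hue).symm.trans hua) u (hr.le (hE.snk_min u hu hue))
        (hr.le (hE.snk_max u hu hue)), hb.kind e he]
      exact hret
  | some A =>
    simp only [decide_eq_true_eq]
    have hA : D.nsp.attached A = true ∧ ∃ y ≤ E.cur, D.nsp.find y = A ∧ r u y := by
      by_cases ha : D.nsp.isAttached u = true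
      · rw [DNSP.succOf_of_att ha, Option.some.injEq] at hsu
        subst hsu
        exact ⟨ha, u, hu, rfl, hr.refl _⟩
      · have ha' : D.nsp.isAttached u = false := by simpa using ha
        rw [DNSP.succOf_of_unatt ha'] at hsu
        exact hD.succ_att u hu A ha' hsu
    obtain ⟨hAa, y, hy, hyA, huy⟩ := hA
    obtain ⟨hPa, hPle⟩ := hpred
    have hPl := hD.label _ hPa
    constructor
    · rintro (h1 | h1)
      · exact hr.trans huy (hPle y hy (hyA.trans h1))
      · obtain ⟨_, _, h2, h3⟩ := (hD.exact _ _).1 h1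
        refine hr.trans huy (hr.trans (hD.uniform y hy _ hPl.1 ?_ (hD.isAttached_label hPa) ?_ ?_)
          (hPle _ hPl.1 hPl.2))
        · rw [DNSP.isAttached, hyA, hAa]
        · rwa [hyA, hPl.2]
        · rwa [hyA, hPl.2]
    · intro huv
      -- If `u` shares the set of the current strand, that set is attached, since a live unattached
      -- set offers no attached successor.
      rcases hD.complete u hu _ le_rfl A huv hcur hsu with h1 | h1
      · rw [DNSP.succOf_congr h1] at hsu
        by_cases ha : D.nsp.isAttached E.cur = true
        · rw [DNSP.succOf_of_att ha, Option.some.injEq] at hsu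
          rw [DNSP.predOf_of_att ha]
          exact Or.inl hsu.symm
        · rw [DNSP.succOf_of_unatt (by simpa using ha), hcur.resolve_left ha] at hsu
          simp at hsu
      · exact hD.le_label hAa hPa (Or.inr h1)

end Detector

/-! ### Preservation of the invariants by the control instructions. -/

namespace DNSP

variable {r : ℕ → ℕ → Prop} {n : ℕ} {D : DNSP}

/-- The new strand as an unattached singleton. -/
theorem Inv.onSpawnEdge (hr : StrandOrder r) (hD : D.Inv r n) {p : ℕ} (hnew : NewStrand r n [p])
    (hpn : p ≤ n) (hpl : D.Live p) (hpm : ∀ x ≤ n, D.find x = D.find p → r x p) :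
    AddSingleton n D (D.onSpawnEdge p (n + 1)) ∧
      (D.onSpawnEdge p (n + 1)).attSucc (n + 1) = none ∧
      (D.onSpawnEdge p (n + 1)).Inv r (n + 1) := by
  have hA : AddSingleton n D (D.onSpawnEdge p (n + 1)) := by
    refine ⟨Function.update_self _ _ _, fun x hx => Function.update_of_ne (by omega) _ _,
      fun A hA => Function.update_of_ne hA _ _, fun A hA => Function.update_of_ne (by omega) _ _,
      fun A hA => Function.update_of_ne (by omega) _ _⟩
  have hs : (D.onSpawnEdge p (n + 1)).attSucc (n + 1) = none := Function.update_self _ _ _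
  exact ⟨hA, hs, hD.addUnattached hr hA (Function.update_self _ _ _) rfl
    (Function.update_self _ _ _) hs hnew hpn hpl hpm⟩

theorem AddSingleton.grow {D' : DNSP} (hD : D.Inv r n) (hA : AddSingleton n D D') :
    ∀ x ≤ n, D.isAttached x = true → D'.isAttached x = true := fun x hx hxa => by
  rw [hA.isAttached_old hD hx, hxa]

theorem AddSingleton.isAttached_new {D' : DNSP} (hA : AddSingleton n D D')
    (h : D'.attached (n + 1) = true) : D'.isAttached (n + 1) = true := by
  rw [isAttached, hA.find_new, h]

end DNSP

namespace Detector.Inv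

variable {r : ℕ → ℕ → Prop} {E E' : Exec Loc} {sp : DSP} {nsp nsp' : DNSP}

/-- The immediate predecessors of the new strand are the sources of the new edges. -/
theorem newStrand (h : Inv r E sp nsp) {new : List Edge}
    (hnew : ∀ ed ∈ new, ed.dst = E.cur + 1)
    (hN : ∀ x, r x (E.cur + 1) ↔
      x = E.cur + 1 ∨ ∃ ed ∈ new ++ E.edges, ed.dst = E.cur + 1 ∧ r x ed.src) :
    NewStrand r E.cur (new.map Edge.src) := by
  intro x
  rw [hN]
  refine or_congr_right ⟨?_, ?_⟩
  · rintro ⟨ed, hed, hd, hx⟩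
    rcases List.mem_append.1 hed with h1 | h1
    · exact ⟨ed.src, List.mem_map_of_mem h1, hx⟩
    · have := h.edges ed h1; omega
  · rintro ⟨p, hp, hx⟩
    obtain ⟨ed, hed, rfl⟩ := List.mem_map.1 hp
    exact ⟨ed, List.mem_append_left _ hed, hnew ed hed, hx⟩

/-- The current block has no exits, so `Core.attachify` reduces to Attachify without outgoing arcs.
-/
theorem attachify_cur (h : Inv r E sp nsp) (hr : StrandOrder r) :
    Inv r E sp (nsp.attachify E.cur) ∧ (nsp.attachify E.cur).isAttached E.cur = true := by
  have hmem : E.headSink ∈ E.sinks := by rw [E.sinks_eq]; simp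
  have hex : E.headSink.exits = [] := rfl
  obtain ⟨h1, h2, h3⟩ := h.core.attachify hr hmem (by simp [hex]) (by simp [hex])
  rw [hex] at h1 h2 h3
  refine ⟨⟨h1, ?_, ?_, h.edges⟩, h2⟩
  · have hb := h.bags
    refine ⟨hb.contig, fun e he ha => hb.unatt e he ?_, hb.rel, hb.kind, hb.cover, hb.fn_lt,
      hb.find_lt⟩
    by_contra hc
    have : (nsp.attachify E.cur).isAttached e.snk = true := h3 _ (by simpa using hc)
    rw [ha] at this
    simp at this
  · intro fr hfr hk
    obtain ⟨⟨h4, h5⟩, h6, h7⟩ := h.create fr hfr hk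
    exact ⟨⟨h4, h3 _ h5⟩, h6, h3 _ h7⟩

/-- A call, once the new strand is entered into `D_NSP`. -/
theorem call (h : Inv r E sp nsp) (hr : StrandOrder r) {k : CallKind} {e : EdgeKind}
    (hN : NewStrand r E.cur [E.cur]) (hA : DNSP.AddSingleton E.cur nsp nsp')
    (hD' : nsp'.Inv r (E.cur + 1))
    (hsucc : nsp'.attached (E.cur + 1) = false → nsp'.attSucc (E.cur + 1) = none)
    (hk : k = .create → nsp.isAttached E.cur = true ∧ nsp'.attached (E.cur + 1) = true) :
    Inv r (E.call k e) (sp.makeS E.numFns (E.cur + 1)) nsp' := by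
  have hc := h.core
  have hb := h.bags
  rw [E.sinks_eq] at hc hb
  have hg := hA.grow hc.nsp
  have hsinks : (E.call k e).sinks = ⟨E.numFns, E.cur + 1, E.cur + 1, [], true, .running⟩ ::
      { E.headSink with exits := [E.cur + 1] } :: E.tailSinks := by
    change _ :: (blocks (firstOf E.stack) E.fn E.cur [E.cur + 1] .running E.pending ++
      stackBlocks E.stack) = _
    rw [blocks_eq]; rfl
  refine ⟨?_, ?_, ?_, ?_⟩
  · rw [hsinks]
    refine hc.call hr hA hD' hsucc hN rfl rfl rfl rfl rfl ?_
    intro e₀ h₀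
    have := hb.fn_lt e₀ h₀
    simp only; omega
  · rw [hsinks]
    exact hb.call hr (fun e₀ h₀ => (hc.sink e₀ h₀).snk_le) hg rfl rfl rfl
  · intro fr hfr hkk
    rcases List.mem_cons.1 hfr with rfl | hfr
    · obtain ⟨h1, h2⟩ := hk hkk
      refine ⟨⟨Nat.le_succ _, hg _ le_rfl h1⟩, le_rfl, ?_⟩
      simp only
      rw [DNSP.isAttached, hA.find_new, h2]
    · obtain ⟨⟨h4, h5⟩, h6, h7⟩ := h.create fr hfr hkk
      exact ⟨⟨h4.trans (Nat.le_succ _), hg _ h4 h5⟩, h6.trans (Nat.le_succ _), hg _ h6 h7⟩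
  · intro ed hed
    rcases List.mem_cons.1 hed with rfl | hed
    · exact le_rfl
    · exact (h.edges ed hed).trans (Nat.le_succ _)

theorem create_mono (h : Inv r E sp nsp)
    (hg : ∀ x ≤ E.cur, nsp.isAttached x = true → nsp'.isAttached x = true)
    {st : List Frame} (hst : ∀ fr ∈ st, fr ∈ E.stack) :
    ∀ fr ∈ st, fr.kind = .create →
      (fr.caller ≤ E.cur + 1 ∧ nsp'.isAttached fr.caller = true) ∧
        fr.first ≤ E.cur + 1 ∧ nsp'.isAttached fr.first = true := by
  intro fr hfr hkk
  obtain ⟨⟨h4, h5⟩, h6, h7⟩ := h.create fr (hst fr hfr) hkk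
  exact ⟨⟨h4.trans (Nat.le_succ _), hg _ h4 h5⟩, h6.trans (Nat.le_succ _), hg _ h6 h7⟩

theorem edges_mono (h : Inv r E sp nsp) {new : List Edge} (hnew : ∀ ed ∈ new, ed.dst = E.cur + 1) :
    ∀ ed ∈ new ++ E.edges, ed.dst ≤ E.cur + 1 := by
  intro ed hed
  rcases List.mem_append.1 hed with h1 | h1
  · exact (hnew ed h1).le
  · exact (h.edges ed h1).trans (Nat.le_succ _)

end Detector.Inv

namespace DNSP

variable {D : DNSP}

/-- The side conditions ensure that moving the set of `f` moves neither sink, so all later labels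
can be read off in `D`. -/
theorem joinOne_spec {f sA tA tU n : ℕ} (hA : D.isAttached f = false → D.find tA ≠ D.find f)
    (hU : D.find tU ≠ D.find f) (htU : tU ≤ n) :
    let D' := D.joinOne f sA tA tU (n + 1)
    (∀ x ≤ n, D.isAttached f = false → D.find x = D.find f → D'.find x = D.find sA) ∧
    (∀ x ≤ n, ¬ (D.isAttached f = false ∧ D.find x = D.find f) → D'.find x = D.find x) ∧
    D'.find (n + 1) = D.find tA ∧ D'.attached = D.attached ∧ D'.attPred = D.attPred ∧
    D'.attSucc = Function.update D.attSucc (D.find tU) (some (D.find tA)) ∧ D'.R = D.R := by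
  intro D'
  have htU' : tU ≠ n + 1 := by omega
  by_cases hf : D.isAttached f = true
  · have hD' : D' = { D.add tA (n + 1) with
        attSucc := Function.update D.attSucc (D.find tU) (some (D.find tA)) } := by
      simp [D', joinOne, hf, add, htU']
    rw [hD']
    refine ⟨by simp [hf], fun x hx _ => Function.update_of_ne (by omega) _ _,
      Function.update_self _ _ _, rfl, rfl, rfl, rfl⟩
  · have hf : D.isAttached f = false := by simpa using hf
    have htA' := hA hf
    have hD' : D' = { (D.union sA f).add tA (n + 1) with
        attSucc := Function.update D.attSucc (D.find tU) (some (D.find tA)) } := by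
      simp [D', joinOne, hf, add, union, htU', relabel, hU, htA']
    rw [hD']
    refine ⟨fun x hx _ hxf => ?_, fun x hx hxf => ?_, ?_, rfl, rfl, rfl, rfl⟩
    · have : x ≠ n + 1 := by omega
      simp [add, union, this, relabel, hxf]
    · have : x ≠ n + 1 := by omega
      have hxf : D.find x ≠ D.find f := fun hc => hxf ⟨hf, hc⟩
      simp [add, union, this, relabel, hxf]
    · simp [add, union, relabel, htA']

/-- The second merge reads the labels of `f` and `t₂`; the hypotheses say that the first one has not
changed them. -/
theorem mergeBoth_spec {f t₁ t₂ n : ℕ} (h₁ : D.find t₁ ≠ D.find f)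
    (h₁₂ : D.find t₁ ≠ D.find t₂) :
    let D' := ((D.union f t₁).union f t₂).add f (n + 1)
    (∀ x ≤ n, D.find x = D.find t₁ ∨ D.find x = D.find t₂ → D'.find x = D.find f) ∧
    (∀ x ≤ n, ¬ (D.find x = D.find t₁ ∨ D.find x = D.find t₂) → D'.find x = D.find x) ∧
    D'.find (n + 1) = D.find f := by
  intro D'
  refine ⟨fun x hx hxt => ?_, fun x hx hxt => ?_, ?_⟩
  · have : x ≠ n + 1 := by omega
    rcases hxt with hxt | hxt
    · simp [D', add, union, this, relabel, hxt, h₁.symm, h₁₂.symm]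
    · simp [D', add, union, this, relabel, hxt, h₁.symm, h₁₂.symm]
  · have : x ≠ n + 1 := by omega
    push Not at hxt
    simp [D', add, union, this, relabel, hxt, h₁.symm, h₁₂.symm]
  · simp [D', add, union, relabel, h₁.symm, h₁₂.symm]

end DNSP

namespace Detector.Inv

variable {r : ℕ → ℕ → Prop} {E : Exec Loc} {sp : DSP} {nsp : DNSP}

theorem spawn (h : Inv r E sp nsp) (hr : StrandOrder r)
    (hN : ∀ x, r x (E.cur + 1) ↔ x = E.cur + 1 ∨
      ∃ ed ∈ (E.call .spawn .spawn).edges, ed.dst = E.cur + 1 ∧ r x ed.src) :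
    Inv r (E.call .spawn .spawn) (sp.makeS E.numFns (E.cur + 1))
      (nsp.onSpawnEdge E.cur (E.cur + 1)) := by
  have hnew := h.newStrand (new := [⟨E.cur, .spawn, E.cur + 1⟩]) (by simp) hN
  have hH := h.core.sink E.headSink (by rw [E.sinks_eq]; simp)
  obtain ⟨h1, h2, h3⟩ := h.core.nsp.onSpawnEdge hr hnew le_rfl hH.live hH.snk_max
  exact h.call hr hnew h1 h3 (fun _ => h2) (by simp)

theorem createFuture (h : Inv r E sp nsp) (hr : StrandOrder r)
    (hN : ∀ x, r x (E.cur + 1) ↔ x = E.cur + 1 ∨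
      ∃ ed ∈ (E.call .create .create).edges, ed.dst = E.cur + 1 ∧ r x ed.src) :
    Inv r (E.call .create .create) (sp.makeS E.numFns (E.cur + 1))
      (nsp.onCreate E.cur (E.cur + 1)) := by
  have hnew := h.newStrand (new := [⟨E.cur, .create, E.cur + 1⟩]) (by simp) hN
  obtain ⟨h', ha⟩ := h.attachify_cur hr
  have hH := h'.core.sink E.headSink (by rw [E.sinks_eq]; simp)
  obtain ⟨h1, h2, h3⟩ := h'.core.nsp.makeAttached_arcs hr hnew (by
    intro p hp
    simp only [List.map_cons, List.map_nil, List.mem_singleton] at hp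
    subst hp
    exact ⟨le_rfl, ha, hH.snk_max⟩)
  exact h'.call hr hnew h1 h3 (fun hc => absurd (h2.symm.trans hc) (by simp)) (fun _ => ⟨ha, h2⟩)

/-- The future's last strand is a legitimate second predecessor: it is attached, it is last in its
set, and it lies outside all sink sets. -/
theorem get (h : Inv r E sp nsp) (hr : StrandOrder r) {E' : Exec Loc} {t : ℕ} {f : ℕ}
    (ht : E.futureLast f = some t)
    (hE' : E' = { E with
        cur := E.cur + 1
        edges := ⟨E.cur, .cont, E.cur + 1⟩ :: ⟨t, .get, E.cur + 1⟩ :: E.edges })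
    (hN : ∀ x, r x (E.cur + 1) ↔ x = E.cur + 1 ∨
      ∃ ed ∈ E'.edges, ed.dst = E.cur + 1 ∧ r x ed.src) :
    Inv r E' (sp.add E.fn (E.cur + 1)) (nsp.onGet E.cur t (E.cur + 1)) := by
  subst hE'
  have hnewd : ∀ ed ∈ [(⟨E.cur, .cont, E.cur + 1⟩ : Edge), ⟨t, .get, E.cur + 1⟩],
      ed.dst = E.cur + 1 := by simp
  have hnew := h.newStrand hnewd hN
  obtain ⟨h', ha⟩ := h.attachify_cur hr
  have hH := h'.core.sink E.headSink (by rw [E.sinks_eq]; simp)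
  have htf : t ∈ E.futs := ⟨f, ht⟩
  obtain ⟨h1, h2, h3⟩ := h'.core.nsp.makeAttached_arcs hr hnew (by
    intro p hp
    simp only [List.map_cons, List.map_nil, List.mem_cons, List.not_mem_nil, or_false] at hp
    rcases hp with rfl | rfl
    · exact ⟨le_rfl, ha, hH.snk_max⟩
    · exact ⟨h'.core.fut_le p htf, h'.core.fut_att p htf, h'.core.fut_max p htf⟩)
  have hc := h'.core
  have hb := h'.bags
  have hg := h1.grow hc.nsp
  rw [E.sinks_eq] at hc hb
  have hord := List.pairwise_cons.1 hc.order
  have hcn : r E.cur (E.cur + 1) := (hnew _).2 (Or.inr ⟨E.cur, by simp, hr.refl _⟩)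
  have hsl : E.headSink.src ≤ E.cur := hH.src_le hr
  refine ⟨?_, ?_, h'.create_mono hg fun _ => id, h'.edges_mono hnewd⟩
  · rw [Exec.sinks_eq]
    refine hc.extend (M := []) (e := E.headSink) hr h1 h3 h2 hnew ?_ (by simp) ha hcn rfl
      (fun t ht => Or.inl ht) ?_
    · intro p hp
      simp only [List.map_cons, List.map_nil, List.mem_cons, List.not_mem_nil, or_false] at hp
      rcases hp with rfl | rfl
      · exact ⟨le_rfl, ha, fun e₀ h₀ => (hc.sink e₀ (by simp [h₀])).find_ne hr (hord.1 e₀ h₀)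
          le_rfl hsl⟩
      · exact ⟨hc.fut_le p htf, hc.fut_att p htf, fun e₀ h₀ => hc.fut_find_ne hr htf (by simp [h₀])⟩
    · intro e₀ h₀
      have := (hord.1 e₀ h₀).lt
      omega
  · rw [Exec.sinks_eq]
    have hold : ∀ x ≤ E.cur, (sp.add E.fn (E.cur + 1)).find x = sp.find x := fun x hx =>
      Function.update_of_ne (by omega) _ _
    refine hb.extend (M := []) (e := E.headSink) hr hc.order
      (fun e₀ h₀ => (hc.sink e₀ (by simp [h₀])).snk_le) hg rfl (by simp [Exec.headSink]) ?_
      (fun x hx => Or.inl (hold x hx)) (Function.update_self _ _ _) (fun _ _ => rfl)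
      (fun _ => id) (by simp) ?_
    · intro hc'
      exact absurd ((h1.isAttached_new h2).symm.trans hc') (by simp)
    · intro x hx hxf
      rw [hold x hx] at hxf
      exact hr.trans (hb.rel E.headSink (by simp) (by simp [Exec.headSink]) x hx hxf) hcn

theorem retSpawn (h : Inv r E sp nsp) (hr : StrandOrder r) {E' : Exec Loc} {fr : Frame}
    {st : List Frame} (hp : E.pending = []) (hst : E.stack = fr :: st)
    (hE' : E' = { E with
          cur := E.cur + 1
          fn := fr.fn
          pending := ⟨E.fn, fr.caller, fr.first, E.cur, E.cur + 1⟩ :: fr.pending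
          stack := st
          edges := ⟨fr.caller, .cont, E.cur + 1⟩ :: E.edges })
    (hN : ∀ x, r x (E.cur + 1) ↔ x = E.cur + 1 ∨
      ∃ ed ∈ E'.edges, ed.dst = E.cur + 1 ∧ r x ed.src) :
    Inv r E' ((sp.toP E.fn).add fr.fn (E.cur + 1)) (nsp.onSpawnEdge fr.caller (E.cur + 1)) := by
  subst hE'
  have hnewd : ∀ ed ∈ [(⟨fr.caller, .cont, E.cur + 1⟩ : Edge)], ed.dst = E.cur + 1 := by simp
  have hnew := h.newStrand hnewd hN
  set g : Sink := ⟨E.fn, fr.first, E.cur, [], true, .running⟩ with hg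
  set e : Sink := ⟨fr.fn, blockSrc (firstOf st) fr.pending, fr.caller, [fr.first],
    fr.pending.isEmpty, .running⟩ with he
  set L : List Sink := blockTail (firstOf st) fr.fn fr.pending ++ stackBlocks st with hL
  have hs : E.sinks = g :: e :: L := by
    rw [Exec.sinks, hp, hst, stackBlocks, blocks_eq, blocks_eq]; rfl
  have hc := h.core
  have hb := h.bags
  rw [hs] at hc hb
  have hEe := hc.sink e (by simp)
  have hen : r fr.caller (E.cur + 1) := (hnew _).2 (Or.inr ⟨fr.caller, by simp, hr.refl _⟩)
  obtain ⟨h1, h2, h3⟩ := hc.nsp.onSpawnEdge hr hnew hEe.snk_le hEe.live hEe.snk_max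
  have hgr := h1.grow hc.nsp
  refine ⟨?_, ?_, h.create_mono hgr fun f hf => by rw [hst]; simp [hf], h.edges_mono hnewd⟩
  · rw [Exec.sinks, blocks, blocks_eq]
    exact hc.retSpawn hr h1 h3 (fun _ => h2) hnew rfl rfl rfl rfl rfl rfl rfl
  · rw [Exec.sinks, blocks, blocks_eq]
    exact hb.retSpawn hr hc.order (fun e₀ h₀ => (hc.sink e₀ h₀).snk_le) hgr rfl rfl rfl rfl hen
      rfl rfl rfl

/-- The caller's block absorbs the future: its block `g` leaves the list, and its sink, attached
like its source, becomes the last strand of a completed future. -/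
theorem retCreate (h : Inv r E sp nsp) (hr : StrandOrder r) {E' : Exec Loc} {fr : Frame}
    {st : List Frame} (hp : E.pending = []) (hst : E.stack = fr :: st) (hk : fr.kind = .create)
    (hE' : E' = { E with
          cur := E.cur + 1
          fn := fr.fn
          pending := fr.pending
          stack := st
          futureLast := Function.update E.futureLast E.fn (some E.cur)
          edges := ⟨fr.caller, .cont, E.cur + 1⟩ :: E.edges })
    (hN : ∀ x, r x (E.cur + 1) ↔ x = E.cur + 1 ∨
      ∃ ed ∈ E'.edges, ed.dst = E.cur + 1 ∧ r x ed.src) :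
    Inv r E' ((sp.toP E.fn).add fr.fn (E.cur + 1)) (nsp.onCreateCont fr.caller (E.cur + 1)) := by
  subst hE'
  have hnewd : ∀ ed ∈ [(⟨fr.caller, .cont, E.cur + 1⟩ : Edge)], ed.dst = E.cur + 1 := by simp
  have hnew := h.newStrand hnewd hN
  set g : Sink := ⟨E.fn, fr.first, E.cur, [], true, .running⟩ with hg
  set e : Sink := ⟨fr.fn, blockSrc (firstOf st) fr.pending, fr.caller, [fr.first],
    fr.pending.isEmpty, .running⟩ with he
  set L : List Sink := blockTail (firstOf st) fr.fn fr.pending ++ stackBlocks st with hL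
  have hs : E.sinks = g :: e :: L := by
    rw [Exec.sinks, hp, hst, stackBlocks, blocks_eq, blocks_eq]; rfl
  obtain ⟨⟨_, hca⟩, _, hfa⟩ := h.create fr (by rw [hst]; simp) hk
  have hc := h.core
  have hb := h.bags
  rw [hs] at hc hb
  have hGg := hc.sink g (by simp)
  have hEe := hc.sink e (by simp)
  have hen : r fr.caller (E.cur + 1) := (hnew _).2 (Or.inr ⟨fr.caller, by simp, hr.refl _⟩)
  obtain ⟨h1, h2, h3⟩ := hc.nsp.makeAttached_arcs hr hnew (by
    intro p hp
    simp only [List.map_cons, List.map_nil, List.mem_singleton] at hp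
    subst hp
    exact ⟨hEe.snk_le, hca, hEe.snk_max⟩)
  have hgr := h1.grow hc.nsp
  have hord := List.pairwise_cons.1 hc.order
  have hord' := List.pairwise_cons.1 hord.2
  have hsinks : blocks (firstOf st) fr.fn (E.cur + 1) [] .running fr.pending ++ stackBlocks st =
      ⟨e.fn, e.src, E.cur + 1, [], e.base, .running⟩ :: L := by
    rw [blocks_eq]; rfl
  refine ⟨?_, ?_, h.create_mono hgr fun f hf => by rw [hst]; simp [hf], h.edges_mono hnewd⟩
  · rw [Exec.sinks]
    simp only
    rw [hsinks]
    refine Core.extend (M := [g]) (e := e) hc hr h1 h3 h2 hnew ?_ ?_ hca hen rfl ?_ ?_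
    · intro p hp
      simp only [List.map_cons, List.map_nil, List.mem_singleton] at hp
      subst hp
      exact ⟨hEe.snk_le, hca, fun e₀ h₀ => (hc.sink e₀ (by simp [h₀])).find_ne hr (hord'.1 e₀ h₀)
        hEe.snk_le (hr.le hEe.rel)⟩
    · intro e₀ h₀
      rw [List.mem_singleton] at h₀
      subst h₀
      rw [← hGg.att_iff]
      exact hfa
    · rintro t ⟨i, hi⟩
      simp only [Function.update_apply] at hi
      split_ifs at hi with hif
      · rw [Option.some.injEq] at hi
        exact Or.inr ⟨⟨g, by simp, hi⟩, hi.symm⟩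
      · exact Or.inl ⟨i, hi⟩
    · intro e₀ h₀
      have h4 := (hord.1 e₀ (by simp [h₀])).lt
      have h5 : g.src ≤ E.cur := hGg.src_le hr
      omega
  · rw [Exec.sinks]
    simp only
    rw [hsinks]
    have hold : ∀ x ≤ E.cur, ((sp.toP E.fn).add fr.fn (E.cur + 1)).find x = sp.find x :=
      fun x hx => Function.update_of_ne (by omega) _ _
    have hgne : ∀ e₀ ∈ e :: L, e₀.fn ≠ E.fn := fun e₀ h₀ => ((hord.1 e₀ h₀).base rfl).symm
    have hkP : ((sp.toP E.fn).add fr.fn (E.cur + 1)).kind E.fn = .P := Function.update_self _ _ _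
    have hkne : ∀ F, F ≠ E.fn → ((sp.toP E.fn).add fr.fn (E.cur + 1)).kind F = sp.kind F :=
      fun F hF => Function.update_of_ne hF _ _
    refine Bags.extend (M := [g]) (e := e) hb hr hord.2
      (fun e₀ h₀ => (hc.sink e₀ (by simp [h₀])).snk_le) hgr rfl (by simp [he]) ?_
      (fun x hx => Or.inl (hold x hx)) (Function.update_self _ _ _)
      (fun e₀ h₀ => hkne _ (hgne e₀ h₀)) ?_ ?_ ?_
    · intro hc'
      exact absurd ((h1.isAttached_new h2).symm.trans hc') (by simp)
    · intro F hF
      by_cases hFe : F = E.fn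
      · rw [hFe, hkP] at hF; simp at hF
      · rwa [hkne F hFe] at hF
    · intro x hx e₀ h₀ _ _ hkk
      rw [List.mem_singleton] at h₀
      subst h₀
      exact absurd (hkP.symm.trans hkk) (by simp)
    · intro x hx hxf
      rw [hold x hx] at hxf
      exact hr.trans (hb.rel e (by simp) (by simp [he]) x hx hxf) hen

/-- The three topmost blocks are the continuation `b`, the child `a` and the fork `f`. The cases of
attachedness are settled by `JoinAt.both_unattached`, by `JoinAt.one` in both orientations, and by
`Core.attachify` followed by `Core.extend`. -/
theorem sync (h : Inv r E sp nsp) (hr : StrandOrder r) {E' : Exec Loc} {k : Fork}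
    {ks : List Fork} (hp : E.pending = k :: ks)
    (hE' : E' = { E with
        cur := E.cur + 1
        pending := ks
        edges := ⟨E.cur, .cont, E.cur + 1⟩ :: ⟨k.t₁, .join, E.cur + 1⟩ :: E.edges })
    (hN : ∀ x, r x (E.cur + 1) ↔ x = E.cur + 1 ∨
      ∃ ed ∈ E'.edges, ed.dst = E.cur + 1 ∧ r x ed.src) :
    Inv r E' ((sp.union E.fn k.child).add E.fn (E.cur + 1))
      (nsp.onSync k.f k.s₁ k.t₁ k.s₂ E.cur (E.cur + 1)) := by
  subst hE'
  have hnewd : ∀ ed ∈ [(⟨E.cur, .cont, E.cur + 1⟩ : Edge), ⟨k.t₁, .join, E.cur + 1⟩],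
      ed.dst = E.cur + 1 := by simp
  have hnew := h.newStrand hnewd hN
  set b : Sink := ⟨E.fn, k.s₂, E.cur, [], false, .running⟩ with hb_def
  set a : Sink := ⟨k.child, k.s₁, k.t₁, [], true, .returned⟩ with ha_def
  set f : Sink := ⟨E.fn, blockSrc (firstOf E.stack) ks, k.f, [k.s₁, k.s₂], ks.isEmpty, .forked⟩
    with hf_def
  set L : List Sink := blockTail (firstOf E.stack) E.fn ks ++ stackBlocks E.stack with hL
  have hs : E.sinks = b :: a :: f :: L := by
    rw [Exec.sinks, hp, blocks, blocks_eq]; rfl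
  have hsinks : blocks (firstOf E.stack) E.fn (E.cur + 1) [] .running ks ++ stackBlocks E.stack =
      ⟨f.fn, f.src, E.cur + 1, [], f.base, .running⟩ :: L := by
    rw [blocks_eq]; rfl
  have hc := h.core
  have hb := h.bags
  rw [hs] at hc hb
  have hB := hc.sink b (by simp)
  have hA := hc.sink a (by simp)
  have hF := hc.sink f (by simp)
  have hord := List.pairwise_cons.1 hc.order
  have hord' := List.pairwise_cons.1 hord.2
  have hord'' := List.pairwise_cons.1 hord'.2
  have hba := (hord.1 a (by simp)).lt
  have hbf := (hord.1 f (by simp)).lt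
  have haf := (hord'.1 f (by simp)).lt
  have hbl := hr.le hB.rel
  have hal := hr.le hA.rel
  have hfl := hr.le hF.rel
  have hnew' : ∀ x, r x (E.cur + 1) ↔ x = E.cur + 1 ∨ r x a.snk ∨ r x b.snk := by
    intro x
    rw [hnew x]
    simp [hb_def, ha_def, or_comm]
  have J : JoinAt r E.cur (b :: a :: f :: L) a b f L := by
    refine ⟨by simp, by simp, by simp, by simp +contextual, ?_, rfl, rfl,
      by simp [hf_def, ha_def, hb_def], haf, hbf, ?_, hord''.1, hord''.2, hnew'⟩
    · intro e he
      simp only [List.mem_cons] at he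
      tauto
    · intro hc'
      omega
  have han : r a.snk (E.cur + 1) := (hnew' _).2 (Or.inr (Or.inl (hr.refl _)))
  have hbn : r b.snk (E.cur + 1) := (hnew' _).2 (Or.inr (Or.inr (hr.refl _)))
  have hfa : r f.snk a.src := (hF.exits a.src (by simp [hf_def, ha_def])).1
  have hafn : nsp.find a.snk ≠ nsp.find f.snk := hc.find_snk_inj hr (by simp) (by simp) (by omega)
  have hbfn : nsp.find b.snk ≠ nsp.find f.snk := hc.find_snk_inj hr (by simp) (by simp) (by omega)
  have habn : nsp.find a.snk ≠ nsp.find b.snk := hc.find_snk_inj hr (by simp) (by simp) J.ne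
  -- the result of the join on `D_NSP`
  have key : Core r (E.cur + 1) (⟨f.fn, f.src, E.cur + 1, [], f.base, .running⟩ :: L) E.futs
        (nsp.onSync k.f k.s₁ k.t₁ k.s₂ E.cur (E.cur + 1)) ∧
      (∀ x ≤ E.cur, nsp.isAttached x = true →
        (nsp.onSync k.f k.s₁ k.t₁ k.s₂ E.cur (E.cur + 1)).isAttached x = true) ∧
      -- An unattached join strand forces all three blocks to be unattached, so their bags are
      -- known.
      ((nsp.onSync k.f k.s₁ k.t₁ k.s₂ E.cur (E.cur + 1)).isAttached (E.cur + 1) = false →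
        nsp.isAttached f.snk = false ∧ nsp.isAttached a.snk = false ∧
          nsp.isAttached b.snk = false) := by
    cases h₁ : nsp.isAttached k.t₁ <;> cases h₂ : nsp.isAttached E.cur
    · obtain ⟨s1, s2, s3⟩ := DNSP.mergeBoth_spec (n := E.cur) hafn habn
      have hD' : nsp.onSync k.f k.s₁ k.t₁ k.s₂ E.cur (E.cur + 1) =
          ((nsp.union k.f k.t₁).union k.f E.cur).add k.f (E.cur + 1) := by
        simp only [DNSP.onSync, h₁, h₂]
      rw [hD']
      obtain ⟨c1, c2⟩ := J.both_unattached (e := ⟨f.fn, f.src, E.cur + 1, [], f.base, .running⟩)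
        hr hc h₁ h₂ s1 s2 s3 rfl rfl rfl rfl rfl rfl rfl rfl rfl
      refine ⟨c1, c2, fun hu => ⟨?_, rfl, rfl⟩⟩
      rw [DNSP.isAttached] at hu
      erw [s3] at hu
      exact hu
    · obtain ⟨s1, s2, s3, s4, s5, s6, s7⟩ := DNSP.joinOne_spec (sA := k.s₂) (n := E.cur)
        (fun _ => hbfn) hafn hA.snk_le
      have hD' : nsp.onSync k.f k.s₁ k.t₁ k.s₂ E.cur (E.cur + 1) =
          nsp.joinOne k.f k.s₂ E.cur k.t₁ (E.cur + 1) := by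
        simp only [DNSP.onSync, h₁, h₂]
      rw [hD']
      obtain ⟨c1, c2⟩ := J.symm.one (e := ⟨f.fn, f.src, E.cur + 1, [], f.base, .running⟩)
        hr hc h₂ h₁ s1 s2 s3 s4 s5 s6 s7 rfl rfl rfl rfl rfl
      refine ⟨c1, c2, fun hu => ?_⟩
      have h₂' : nsp.attached (nsp.find E.cur) = true := h₂
      rw [DNSP.isAttached] at hu
      erw [s3, s4] at hu
      exact absurd (h₂'.symm.trans hu) (by simp)
    · obtain ⟨s1, s2, s3, s4, s5, s6, s7⟩ := DNSP.joinOne_spec (sA := k.s₁) (n := E.cur)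
        (fun _ => hafn) hbfn le_rfl
      have hD' : nsp.onSync k.f k.s₁ k.t₁ k.s₂ E.cur (E.cur + 1) =
          nsp.joinOne k.f k.s₁ k.t₁ E.cur (E.cur + 1) := by
        simp only [DNSP.onSync, h₁, h₂]
      rw [hD']
      obtain ⟨c1, c2⟩ := J.one (e := ⟨f.fn, f.src, E.cur + 1, [], f.base, .running⟩)
        hr hc h₁ h₂ s1 s2 s3 s4 s5 s6 s7 rfl rfl rfl rfl rfl
      refine ⟨c1, c2, fun hu => ?_⟩
      have h₁' : nsp.attached (nsp.find k.t₁) = true := h₁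
      rw [DNSP.isAttached] at hu
      erw [s3, s4] at hu
      exact absurd (h₁'.symm.trans hu) (by simp)
    · have hD' : nsp.onSync k.f k.s₁ k.t₁ k.s₂ E.cur (E.cur + 1) =
          ((DNSP.outArcs (nsp.attachify k.f) k.f [k.s₁, k.s₂]).makeAttached (E.cur + 1)).arcs
            [k.t₁, E.cur] (E.cur + 1) := by
        simp only [DNSP.onSync, h₁, h₂]; rfl
      rw [hD']
      -- The arcs to `s₁` and `s₂` are the arcs to the exits of `f`, which lie in attached sets
      -- because they are sources of attached blocks.
      obtain ⟨c1, c2, c3⟩ := hc.attachify hr (e := f) (by simp) (by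
          intro s hs
          rcases (J.exits_f s).1 hs with rfl | rfl
          · exact ⟨hA.src_le hr, hA.att h₁, hA.src_min⟩
          · exact ⟨hB.src_le hr, hB.att h₂, hB.src_min⟩) (by
          intro s hs
          rcases (J.exits_f s).1 hs with rfl | rfl
          · exact haf
          · exact hbf)
      change Core r E.cur (b :: a :: f :: L) E.futs
        (DNSP.outArcs (nsp.attachify k.f) k.f [k.s₁, k.s₂]) at c1
      change (DNSP.outArcs (nsp.attachify k.f) k.f [k.s₁, k.s₂]).isAttached k.f = true at c2
      change ∀ x, nsp.isAttached x = true →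
        (DNSP.outArcs (nsp.attachify k.f) k.f [k.s₁, k.s₂]).isAttached x = true at c3
      set nsp₁ := DNSP.outArcs (nsp.attachify k.f) k.f [k.s₁, k.s₂] with hnsp₁
      have hnew₂ : NewStrand r E.cur [k.t₁, E.cur] := by
        intro x
        rw [hnew' x]
        simp [hb_def, ha_def]
      have hA₁ := c1.sink a (by simp)
      have hB₁ := c1.sink b (by simp)
      obtain ⟨d1, d2, d3⟩ := c1.nsp.makeAttached_arcs hr hnew₂ (by
        intro p hp
        simp only [List.mem_cons, List.not_mem_nil, or_false] at hp
        rcases hp with rfl | rfl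
        · exact ⟨hA₁.snk_le, c3 _ h₁, hA₁.snk_max⟩
        · exact ⟨le_rfl, c3 _ h₂, hB₁.snk_max⟩)
      refine ⟨?_, fun x hx hxa => d1.grow c1.nsp x hx (c3 x hxa), fun hu => ?_⟩
      · refine Core.extend (M := [b, a]) (e := f) (fut := E.futs) c1 hr d1 d3 d2 hnew₂ ?_ ?_ c2
          (hr.trans (hr.trans hfa hA.rel) han) rfl (fun t ht => Or.inl ht) ?_
        · intro p hp
          simp only [List.mem_cons, List.not_mem_nil, or_false] at hp
          rcases hp with rfl | rfl
          · exact ⟨hA₁.snk_le, c3 _ h₁, fun e₀ h₀ => (c1.sink e₀ (by simp [h₀])).find_ne hr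
              (hord'.1 e₀ (by simp [h₀])) hA₁.snk_le hal⟩
          · exact ⟨le_rfl, c3 _ h₂, fun e₀ h₀ => (c1.sink e₀ (by simp [h₀])).find_ne hr
              (hord.1 e₀ (by simp [h₀])) le_rfl hbl⟩
        · intro e₀ h₀
          simp only [List.mem_cons, List.not_mem_nil, or_false] at h₀
          rcases h₀ with rfl | rfl
          · exact c3 _ h₂
          · exact c3 _ h₁
        · intro e₀ h₀
          have h4 := (hord.1 e₀ (by simp [h₀])).lt
          have h5 : b.src ≤ E.cur := hbl
          omega
      · exact absurd ((d1.isAttached_new d2).symm.trans hu) (by simp)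
  obtain ⟨k1, k2, k3⟩ := key
  refine ⟨?_, ?_, h.create_mono k2 fun _ => id, h.edges_mono hnewd⟩
  · rw [Exec.sinks]
    simp only
    rw [hsinks]
    exact k1
  · rw [Exec.sinks]
    simp only
    rw [hsinks]
    set P' := (sp.union E.fn k.child).add E.fn (E.cur + 1) with hP'
    have hCF : k.child ≠ E.fn := (hord'.1 f (by simp)).base rfl
    have hold : ∀ x ≤ E.cur, P'.find x = relabel E.fn k.child (sp.find x) := fun x hx =>
      Function.update_of_ne (by omega) _ _
    have hold1 : ∀ x ≤ E.cur, sp.find x = k.child → P'.find x = E.fn := fun x hx hf => by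
      rw [hold x hx, hf, relabel, if_pos rfl]
    have hold2 : ∀ x ≤ E.cur, sp.find x ≠ k.child → P'.find x = sp.find x := fun x hx hf => by
      rw [hold x hx, relabel, if_neg hf]
    have hcon := hb.contig
    rw [List.isChain_cons_cons, List.isChain_cons_cons] at hcon
    obtain ⟨hcon1, hcon2, _⟩ := hcon
    refine Bags.extend (M := [b, a]) (e := f) hb hr hord'.2
      (fun e₀ h₀ => (hc.sink e₀ (by simp [h₀])).snk_le) k2 rfl (by simp [hf_def]) ?_
      ?_ (Function.update_self _ _ _) (fun _ _ => rfl) (fun _ => id) ?_ ?_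
    -- The intervals of `f`, `a` and `b` abut. The outer two are in the parent's bag, and the bag of
    -- the child in the middle has just been merged into it.
    · intro hu x hx hxs
      obtain ⟨u1, u2, u3⟩ := k3 hu
      by_cases hx1 : x ≤ f.snk
      · have := hb.unatt f (by simp) u1 x hxs hx1
        rw [hold2 x hx (by rw [this]; exact hCF.symm), this]
      · by_cases hx2 : x ≤ a.snk
        · exact hold1 x hx (hb.unatt a (by simp) u2 x (by omega) hx2)
        · have := hb.unatt b (by simp) u3 x (by omega) hx
          rw [hold2 x hx (by rw [this]; exact hCF.symm), this]
    · intro x hx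
      by_cases hxc : sp.find x = k.child
      · refine Or.inr ⟨hold1 x hx hxc, fun e₀ h₀ => ?_⟩
        rw [hxc]
        exact (hord'.1 e₀ (by simp [h₀])).base rfl
      · exact Or.inl (hold2 x hx hxc)
    · intro x hx e₀ h₀ hrun _ _
      simp only [List.mem_cons, List.not_mem_nil, or_false] at h₀
      rcases h₀ with rfl | rfl
      · rfl
      · simp [ha_def] at hrun
    · intro x hx hxf
      by_cases hxc : sp.find x = k.child
      · exact hr.trans (hb.rel a (by simp) (by simp [ha_def]) x hx hxc) han
      · rw [hold2 x hx hxc] at hxf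
        exact hr.trans (hb.rel b (by simp) (by simp [hb_def]) x hx hxf) hbn

end Detector.Inv

/-! ### Executions: edges go forward, and the past of a strand is fixed when it begins. -/

namespace Exec

/-- The strands that the next edges can leave are among those executed, and edges go forward. -/
structure Forward (E : Exec Loc) : Prop where
  pending : ∀ k ∈ E.pending, k.t₁ ≤ E.cur
  stack : ∀ fr ∈ E.stack, fr.caller ≤ E.cur ∧ ∀ k ∈ fr.pending, k.t₁ ≤ E.cur
  fut : ∀ h t, E.futureLast h = some t → t ≤ E.cur
  edges : ∀ ed ∈ E.edges, ed.src < ed.dst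

theorem Forward.init : (init : Exec Loc).Forward := by
  constructor <;> simp [Exec.init]

/-- The edges added by a step lead to the new strand. -/
def Extends (E E' : Exec Loc) : Prop :=
  E.cur ≤ E'.cur ∧ ∃ new, E'.edges = new ++ E.edges ∧ ∀ ed ∈ new, E.cur < ed.dst

theorem Extends.refl (E : Exec Loc) : E.Extends E := ⟨le_rfl, [], rfl, by simp⟩

theorem Extends.trans {E₁ E₂ E₃ : Exec Loc} (h : E₁.Extends E₂) (h' : E₂.Extends E₃) :
    E₁.Extends E₃ := by
  obtain ⟨h1, n1, h2, h3⟩ := h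
  obtain ⟨h4, n2, h5, h6⟩ := h'
  refine ⟨h1.trans h4, n2 ++ n1, by rw [h5, h2, List.append_assoc], fun ed hed => ?_⟩
  rcases List.mem_append.1 hed with hed | hed
  · have := h6 ed hed; omega
  · exact h3 ed hed

theorem Extends.step {E E' : Exec Loc} {i : Instr Loc} (h : E.step i = some E') :
    E.Extends E' := by
  cases i with
  | read l => simp only [Exec.step, Option.some.injEq] at h; subst h; exact ⟨le_rfl, [], rfl, by simp⟩
  | write l =>
    simp only [Exec.step, Option.some.injEq] at h; subst h; exact ⟨le_rfl, [], rfl, by simp⟩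
  | spawn =>
    simp only [Exec.step, Option.some.injEq] at h; subst h
    exact ⟨Nat.le_succ _, [_], rfl, by simp⟩
  | create =>
    simp only [Exec.step, Option.some.injEq] at h; subst h
    exact ⟨Nat.le_succ _, [_], rfl, by simp⟩
  | ret =>
    simp only [Exec.step] at h
    split at h
    · split at h <;>
      · simp only [Option.some.injEq] at h; subst h
        exact ⟨Nat.le_succ _, [_], rfl, by simp⟩
    · simp at h
  | sync =>
    simp only [Exec.step] at h
    split at h
    · simp only [Option.some.injEq] at h; subst h
      exact ⟨Nat.le_succ _, [_, _], rfl, by simp⟩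
    · simp at h
  | get f =>
    simp only [Exec.step] at h
    split at h
    · simp only [Option.some.injEq] at h; subst h
      exact ⟨Nat.le_succ _, [_, _], rfl, by simp⟩
    · simp at h

theorem Forward.step {E E' : Exec Loc} (hE : E.Forward) {i : Instr Loc}
    (h : E.step i = some E') : E'.Forward := by
  obtain ⟨h1, h2, h3, h4⟩ := hE
  have h1' : ∀ k ∈ E.pending, k.t₁ ≤ E.cur + 1 := fun k hk => (h1 k hk).trans (Nat.le_succ _)
  have h2' : ∀ fr ∈ E.stack, fr.caller ≤ E.cur + 1 ∧ ∀ k ∈ fr.pending, k.t₁ ≤ E.cur + 1 :=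
    fun fr hfr => ⟨(h2 fr hfr).1.trans (Nat.le_succ _),
      fun k hk => ((h2 fr hfr).2 k hk).trans (Nat.le_succ _)⟩
  have h3' : ∀ h t, E.futureLast h = some t → t ≤ E.cur + 1 := fun f t ht =>
    (h3 f t ht).trans (Nat.le_succ _)
  cases i with
  | read l => simp only [Exec.step, Option.some.injEq] at h; subst h; exact ⟨h1, h2, h3, h4⟩
  | write l => simp only [Exec.step, Option.some.injEq] at h; subst h; exact ⟨h1, h2, h3, h4⟩
  | spawn | create =>
    simp only [Exec.step, Option.some.injEq] at h; subst h
    refine ⟨by simp [call], ?_, h3', ?_⟩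
    · intro fr hfr
      rcases List.mem_cons.1 hfr with rfl | hfr
      · exact ⟨Nat.le_succ _, h1'⟩
      · exact h2' fr hfr
    · intro ed hed
      rcases List.mem_cons.1 hed with rfl | hed
      · exact Nat.lt_succ_self _
      · exact h4 ed hed
  | ret =>
    simp only [Exec.step] at h
    split at h
    · next fr st hp hst =>
      have hfr := h2 fr (by rw [hst]; simp)
      have hfr' := h2' fr (by rw [hst]; simp)
      have hst' : ∀ f ∈ st, f ∈ E.stack := fun f hf => by rw [hst]; simp [hf]
      have hed' : ∀ ed ∈ (⟨fr.caller, .cont, E.cur + 1⟩ :: E.edges : List Edge),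
          ed.src < ed.dst := by
        intro ed hed
        rcases List.mem_cons.1 hed with rfl | hed
        · exact Nat.lt_succ_of_le hfr.1
        · exact h4 ed hed
      split at h
      · simp only [Option.some.injEq] at h; subst h
        refine ⟨?_, fun f hf => h2' f (hst' f hf), h3', hed'⟩
        intro k hk
        rcases List.mem_cons.1 hk with rfl | hk
        · exact Nat.le_succ _
        · exact hfr'.2 k hk
      · simp only [Option.some.injEq] at h; subst h
        refine ⟨hfr'.2, fun f hf => h2' f (hst' f hf), ?_, hed'⟩
        intro f t ht
        simp only [Function.update_apply] at ht
        split_ifs at ht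
        · rw [Option.some.injEq] at ht; subst ht; exact Nat.le_succ _
        · exact h3' f t ht
    · simp at h
  | sync =>
    simp only [Exec.step] at h
    split at h
    · next k ks hp =>
      simp only [Option.some.injEq] at h; subst h
      refine ⟨fun k' hk' => h1' k' (by rw [hp]; simp [hk']), h2', h3', ?_⟩
      intro ed hed
      simp only [List.mem_cons] at hed
      rcases hed with rfl | rfl | hed
      · exact Nat.lt_succ_self _
      · exact Nat.lt_succ_of_le (h1 k (by rw [hp]; simp))
      · exact h4 ed hed
    · simp at h
  | get f =>
    simp only [Exec.step] at h
    split at h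
    · next t ht =>
      simp only [Option.some.injEq] at h; subst h
      refine ⟨h1', h2', h3', ?_⟩
      intro ed hed
      simp only [List.mem_cons] at hed
      rcases hed with rfl | rfl | hed
      · exact Nat.lt_succ_self _
      · exact Nat.lt_succ_of_le (h3 f t ht)
      · exact h4 ed hed
    · simp at h

theorem foldlM_step {q : List (Instr Loc)} {E E' : Exec Loc} (h : q.foldlM step E = some E') :
    E.Extends E' ∧ (E.Forward → E'.Forward) := by
  induction q generalizing E with
  | nil =>
    simp only [List.foldlM_nil, Option.pure_def, Option.some.injEq] at h
    subst h
    exact ⟨Extends.refl _, id⟩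
  | cons i q ih =>
    rw [List.foldlM_cons, Option.bind_eq_bind, Option.bind_eq_some_iff] at h
    obtain ⟨E₁, h1, h2⟩ := h
    obtain ⟨h3, h4⟩ := ih h2
    exact ⟨(Extends.step h1).trans h3, fun hE => h4 (hE.step h1)⟩

/-- The reflexive closure of `≺`. -/
def Reach (E : Exec Loc) (u v : ℕ) : Prop :=
  Relation.ReflTransGen (fun a b => ∃ e ∈ E.edges, e.src = a ∧ e.dst = b) u v

theorem Forward.strandOrder {E : Exec Loc} (h : E.Forward) : StrandOrder E.Reach where
  refl _ := Relation.ReflTransGen.refl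
  trans h₁ h₂ := Relation.ReflTransGen.trans h₁ h₂
  le {x y} hxy := by
    induction hxy with
    | refl => exact le_rfl
    | tail _ he ih =>
      obtain ⟨e, he, rfl, rfl⟩ := he
      exact ih.trans (h.edges e he).le

theorem precedes_iff {E : Exec Loc} {u v : ℕ} (hne : u ≠ v) :
    E.Precedes u v ↔ E.Reach u v := by
  rw [Reach, Relation.reflTransGen_iff_eq_or_transGen]
  simp [Precedes, hne.symm]

theorem parallel_iff {E : Exec Loc} (h : E.Forward) {u v : ℕ} :
    E.Parallel u v ↔ ¬ E.Reach u v ∧ ¬ E.Reach v u := by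
  by_cases hne : u = v
  · subst hne
    simp [Parallel, h.strandOrder.refl u]
  · rw [Parallel, precedes_iff hne, precedes_iff (Ne.symm hne)]
    simp [hne]

/-- All edges into a strand are present once it has begun. -/
theorem Extends.reach_cur {E E' : Exec Loc} (h : E.Extends E') (x : ℕ) :
    E'.Reach x E.cur ↔
      x = E.cur ∨ ∃ ed ∈ E.edges, ed.dst = E.cur ∧ E'.Reach x ed.src := by
  obtain ⟨_, new, h1, h2⟩ := h
  constructor
  · intro hx
    rcases Relation.ReflTransGen.cases_tail hx with h3 | ⟨y, hy, ed, hed, rfl, hd⟩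
    · exact Or.inl h3.symm
    · refine Or.inr ⟨ed, ?_, hd, hy⟩
      rw [h1] at hed
      -- Edges added later end beyond `E.cur`, so the last edge of a path to `E.cur` is an old one.
      rcases List.mem_append.1 hed with h3 | h3
      · have := h2 ed h3; omega
      · exact h3
  · rintro (rfl | ⟨ed, hed, hd, hx⟩)
    · exact Relation.ReflTransGen.refl
    · exact Relation.ReflTransGen.tail hx ⟨ed, by rw [h1]; simp [hed], rfl, hd⟩

end Exec

/-! ### The initial state, preservation by a step, and the access history. -/

namespace Detector

variable {r : ℕ → ℕ → Prop} {E E' : Exec Loc} {D : Detector Loc}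

theorem Inv.init (hr : StrandOrder r) :
    Inv r (Exec.init : Exec Loc) (Detector.init : Detector Loc).sp
      (Detector.init : Detector Loc).nsp := by
  have hs : (Exec.init : Exec Loc).sinks = [⟨0, 0, 0, [], true, .running⟩] := rfl
  have hcur : (Exec.init : Exec Loc).cur = 0 := rfl
  have hatt : ∀ A, (Detector.init : Detector Loc).nsp.attached A = true ↔ A = 0 := by
    simp [Detector.init]
  have hfind : ∀ x, (Detector.init : Detector Loc).nsp.find x = x := fun _ => rfl
  have ha0 : (Detector.init : Detector Loc).nsp.isAttached 0 = true := by
    rw [DNSP.isAttached, hfind, hatt]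
  refine ⟨⟨⟨?_, ?_, ?_, ?_, ?_, ?_, ?_, ?_, ?_⟩, ?_, ?_, ?_, ?_, ?_, ?_, ?_⟩, ?_, ?_, ?_⟩
  · intro x hx; rw [hfind]; exact hx
  · intro x _; rfl
  · intro A hA
    rw [hatt] at hA; subst hA
    exact ⟨le_rfl, rfl⟩
  · intro A B
    rw [hatt, hatt]
    refine iff_of_false (by simp [Detector.init]) ?_
    rintro ⟨rfl, rfl, h, _⟩
    exact h rfl
  · intro x hx y hy _ _ hne _
    rw [hcur, Nat.le_zero] at hx hy
    subst hx; subst hy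
    exact hr.refl _
  · intro v hv hva
    rw [hcur, Nat.le_zero] at hv; subst hv
    rw [ha0] at hva; simp at hva
  · intro v hv hva
    rw [hcur, Nat.le_zero] at hv; subst hv
    rw [ha0] at hva; simp at hva
  · intro v hv _ hva
    rw [hcur, Nat.le_zero] at hv; subst hv
    rw [ha0] at hva; simp at hva
  · intro u hu v hv _ _ _ _
    rw [hcur, Nat.le_zero] at hu hv
    subst hu; subst hv
    exact Or.inl rfl
  · intro e he
    rw [hs, List.mem_singleton] at he
    subst he
    have h0 : ∀ x ≤ (Exec.init : Exec Loc).cur, r 0 x ∧ r x 0 := by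
      intro x hx
      rw [hcur, Nat.le_zero] at hx; subst hx
      exact ⟨hr.refl _, hr.refl _⟩
    refine ⟨hr.refl _, le_rfl, fun x hx _ => (h0 x hx).1, fun x hx _ => (h0 x hx).1,
      fun x hx _ => (h0 x hx).2, fun hc => ?_, id, ?_, by simp, by simp⟩
    · exact absurd (ha0.symm.trans hc) (by simp)
    · intro x _ y hy _ _ _
      rw [hcur, Nat.le_zero] at hy; subst hy
      exact Or.inl rfl
  · rw [hs]; simp
  · intro u hu hua
    rw [hcur, Nat.le_zero] at hu; subst hu
    rw [ha0] at hua; simp at hua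
  · rintro t ⟨f, hf⟩; simp [Exec.init] at hf
  · rintro t ⟨f, hf⟩; simp [Exec.init] at hf
  · rintro t ⟨f, hf⟩; simp [Exec.init] at hf
  · rintro t ⟨f, hf⟩; simp [Exec.init] at hf
  · rw [hs]
    refine ⟨by simp, ?_, ?_, ?_, ?_, ?_, ?_⟩
    · intro e he _ x _ _
      rw [List.mem_singleton] at he; subst he; rfl
    · intro e he _ x hx _
      rw [List.mem_singleton] at he; subst he
      rw [hcur, Nat.le_zero] at hx; subst hx
      exact hr.refl _
    · intro e he
      rw [List.mem_singleton] at he; subst he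
      simp [Detector.init]
    · intro x _ _
      exact ⟨_, List.mem_singleton_self _, rfl, rfl⟩
    · intro e he
      rw [List.mem_singleton] at he; subst he
      simp [Exec.init]
    · intro x _
      simp [Exec.init, Detector.init]
  · intro fr hfr; simp [Exec.init] at hfr
  · intro ed hed; simp [Exec.init] at hed

/-- The invariant of the reachability structures is kept by every instruction. -/
theorem Inv.step [DecidableEq Loc] (hr : StrandOrder r) (h : Inv r E D.sp D.nsp) {i : Instr Loc}
    (hi : E.step i = some E')
    (hN : ∀ x, r x E'.cur ↔ x = E'.cur ∨ ∃ ed ∈ E'.edges, ed.dst = E'.cur ∧ r x ed.src) :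
    Inv r E' (D.step E i).sp (D.step E i).nsp := by
  cases i with
  | read l =>
    simp only [Exec.step, Option.some.injEq] at hi; subst hi
    exact ⟨h.core, h.bags, h.create, h.edges⟩
  | write l =>
    simp only [Exec.step, Option.some.injEq] at hi; subst hi
    exact ⟨h.core, h.bags, h.create, h.edges⟩
  | spawn =>
    simp only [Exec.step, Option.some.injEq] at hi; subst hi
    exact h.spawn hr hN
  | create =>
    simp only [Exec.step, Option.some.injEq] at hi; subst hi
    exact h.createFuture hr hN
  | ret =>
    simp only [Exec.step] at hi
    split at hi
    · next fr st hp hst =>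
      simp only [Detector.step, hst]
      split at hi
      · simp only [Option.some.injEq] at hi
        exact h.retSpawn hr hp hst hi.symm (by subst hi; exact hN)
      · next hk =>
        simp only [Option.some.injEq] at hi
        exact h.retCreate hr hp hst hk hi.symm (by subst hi; exact hN)
    · simp at hi
  | sync =>
    simp only [Exec.step] at hi
    split at hi
    · next k ks hp =>
      simp only [Option.some.injEq] at hi
      simp only [Detector.step, hp]
      exact h.sync hr hp hi.symm (by subst hi; exact hN)
    · simp at hi
  | get f =>
    simp only [Exec.step] at hi
    split at hi
    · next t ht =>
      simp only [Option.some.injEq] at hi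
      simp only [Detector.step, ht]
      exact h.get hr ht hi.symm (by subst hi; exact hN)
    · simp at hi

/-- The invariant of the access history and of the reported races. -/
structure History (r : ℕ → ℕ → Prop) (n : ℕ) (as : List (Access Loc)) (D : Detector Loc) :
    Prop where
  access_le : ∀ a ∈ as, a.strand ≤ n
  writer : ∀ l w, D.lastWriter l = some w →
    ∃ a ∈ as, a.strand = w ∧ a.loc = l ∧ a.isWrite = true
  reader : ∀ l, ∀ u ∈ D.readers l, ∃ a ∈ as, a.strand = u ∧ a.loc = l
  races : ∀ ρ ∈ D.races, Conflict as ρ.loc ρ.fst ρ.snd ∧ ¬ r ρ.fst ρ.snd ∧ ¬ r ρ.snd ρ.fst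
  -- Until a race on `l` is reported, the stored strands represent all accesses to it: by
  -- transitivity only they have to be compared with the current strand.
  seen : ∀ l, (∀ ρ ∈ D.races, ρ.loc ≠ l) → ∀ a ∈ as, a.loc = l →
    (∃ w, D.lastWriter l = some w ∧ r a.strand w) ∨
      (a.isWrite = false ∧ a.strand ∈ D.readers l)
  ordered : ∀ l, (∀ ρ ∈ D.races, ρ.loc ≠ l) → ∀ a ∈ as, ∀ b ∈ as, a.loc = l → b.loc = l →
    (a.isWrite = true ∨ b.isWrite = true) → r a.strand b.strand ∨ r b.strand a.strand

theorem mem_check {l : Loc} {v : ℕ} {us : List ℕ} {ρ : Race Loc} :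
    ρ ∈ D.check l v us ↔ ∃ u ∈ us, D.query u v = false ∧ ρ = ⟨l, u, v⟩ := by
  simp only [check, List.mem_map, List.mem_filter, Bool.not_eq_true']
  constructor
  · rintro ⟨u, ⟨h1, h2⟩, h3⟩; exact ⟨u, h1, h2, h3.symm⟩
  · rintro ⟨u, h1, h2, h3⟩; exact ⟨u, ⟨h1, h2⟩, h3.symm⟩

theorem conflict_cons {as : List (Access Loc)} {a : Access Loc} {l : Loc} {u v : ℕ}
    (h : Conflict as l u v) : Conflict (a :: as) l u v := by
  obtain ⟨b, hb, c, hc, h⟩ := h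
  exact ⟨b, by simp [hb], c, by simp [hc], h⟩

/-- An access by the current strand `n`, with the stored strands `us` being checked. -/
theorem History.races_access {n : ℕ} {as : List (Access Loc)} (hr : StrandOrder r)
    (h : History r n as D) (hq : ∀ u ≤ n, D.query u n = true ↔ r u n) {l : Loc} {w : Bool}
    {us : List ℕ} (hus : ∀ u ∈ us, ∃ a ∈ as, a.strand = u ∧ a.loc = l ∧
      (a.isWrite = true ∨ w = true)) :
    ∀ ρ ∈ D.check l n us ++ D.races,
      Conflict (⟨n, l, w⟩ :: as) ρ.loc ρ.fst ρ.snd ∧ ¬ r ρ.fst ρ.snd ∧ ¬ r ρ.snd ρ.fst := by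
  intro ρ hρ
  rcases List.mem_append.1 hρ with hρ | hρ
  · obtain ⟨u, hu, hqu, rfl⟩ := mem_check.1 hρ
    obtain ⟨a, ha, h1, h2, h3⟩ := hus u hu
    have hun : u ≤ n := h1 ▸ h.access_le a ha
    have hnr : ¬ r u n := by
      rw [← hq u hun, hqu]; simp
    refine ⟨⟨a, by simp [ha], ⟨n, l, w⟩, by simp, h2, rfl, h1, rfl, h3⟩, hnr, fun hc => hnr ?_⟩
    -- A path from the current strand back to `u` forces `u = n`, and reflexivity then contradicts
    -- the negative answer.
    have := hr.le hc
    simp only at this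
    obtain rfl : u = n := by omega
    exact hr.refl _
  · obtain ⟨h1, h2⟩ := h.races ρ hρ
    exact ⟨conflict_cons h1, h2⟩

/-- If no race is reported, the stored strands precede the current one. -/
theorem rel_of_check {n : ℕ} (hq : ∀ u ≤ n, D.query u n = true ↔ r u n) {l : Loc} {us : List ℕ}
    (h : ∀ ρ ∈ D.check l n us ++ D.races, ρ.loc ≠ l) {u : ℕ} (hu : u ∈ us) (hun : u ≤ n) :
    r u n := by
  rw [← hq u hun]
  by_contra hc
  exact h ⟨l, u, n⟩ (List.mem_append_left _ (mem_check.2 ⟨u, hu, by simpa using hc, rfl⟩)) rfl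

/-- Two reads never conflict, so a check of the last writer suffices: in the absence of a race every
earlier write precedes that writer. -/
theorem History.read [DecidableEq Loc] (hr : StrandOrder r) (h : History r E.cur E.accesses D)
    (hq : ∀ u ≤ E.cur, D.query u E.cur = true ↔ r u E.cur) (l : Loc) :
    History r E.cur (⟨E.cur, l, false⟩ :: E.accesses) (D.step E (.read l)) := by
  have hsub : ∀ l', (∀ ρ ∈ (D.step E (.read l)).races, ρ.loc ≠ l') →
      ∀ ρ ∈ D.races, ρ.loc ≠ l' := fun l' hl' ρ hρ => hl' ρ (List.mem_append_right _ hρ)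
  have hwle : ∀ l' w, D.lastWriter l' = some w → w ≤ E.cur := fun l' w hw => by
    obtain ⟨a, ha, h1, _⟩ := h.writer l' w hw
    exact h1 ▸ h.access_le a ha
  -- the new access is ordered with the earlier writes
  have hnew : (∀ ρ ∈ (D.step E (.read l)).races, ρ.loc ≠ l) → ∀ b ∈ E.accesses, b.loc = l →
      b.isWrite = true → r b.strand E.cur := by
    intro hl b hb hbl hbw
    rcases h.seen l (hsub l hl) b hb hbl with ⟨w, hw, hbw'⟩ | ⟨h1, _⟩
    · exact hr.trans hbw' (rel_of_check hq hl (by simp [hw]) (hwle l w hw))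
    · rw [hbw] at h1; simp at h1
  refine ⟨?_, ?_, ?_, ?_, ?_, ?_⟩
  · intro a ha
    rcases List.mem_cons.1 ha with rfl | ha
    · exact le_rfl
    · exact h.access_le a ha
  · intro l' w hw
    obtain ⟨a, ha, h1⟩ := h.writer l' w hw
    exact ⟨a, by simp [ha], h1⟩
  · intro l' u hu
    have hu' : u ∈ Function.update D.readers l (E.cur :: D.readers l) l' := hu
    rw [Function.update_apply] at hu'
    split_ifs at hu' with hll
    · rcases List.mem_cons.1 hu' with rfl | hu'
      · exact ⟨⟨E.cur, l, false⟩, by simp, rfl, hll.symm⟩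
      · obtain ⟨a, ha, h1⟩ := h.reader l u hu'
        exact ⟨a, by simp [ha], hll ▸ h1⟩
    · obtain ⟨a, ha, h1⟩ := h.reader l' u hu'
      exact ⟨a, by simp [ha], h1⟩
  · refine h.races_access hr hq ?_
    intro u hu
    rw [Option.mem_toList] at hu
    obtain ⟨a, ha, h1, h2, h3⟩ := h.writer l u hu
    exact ⟨a, ha, h1, h2, Or.inl h3⟩
  · intro l' hl' a ha hal
    change (∃ w, D.lastWriter l' = some w ∧ r a.strand w) ∨ (a.isWrite = false ∧
      a.strand ∈ Function.update D.readers l (E.cur :: D.readers l) l')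
    rw [Function.update_apply]
    rcases List.mem_cons.1 ha with rfl | ha
    · right
      simp only at hal
      simp [hal]
    · rcases h.seen l' (hsub l' hl') a ha hal with h1 | ⟨h1, h2⟩
      · exact Or.inl h1
      · refine Or.inr ⟨h1, ?_⟩
        split_ifs with hll
        · rw [hll] at h2; simp [h2]
        · exact h2
  · intro l' hl' a ha b hb hal hbl hw
    rcases List.mem_cons.1 ha with rfl | ha
    · rcases List.mem_cons.1 hb with rfl | hb
      · exact Or.inl (hr.refl _)
      · simp only at hal
        subst hal
        exact Or.inr (hnew hl' b hb hbl (by simpa using hw))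
    · rcases List.mem_cons.1 hb with rfl | hb
      · simp only at hbl
        subst hbl
        exact Or.inl (hnew hl' a ha hal (by simpa using hw))
      · exact h.ordered l' (hsub l' hl') a ha b hb hal hbl hw

/-- Emptying the list of readers loses nothing: if no race is reported, all earlier accesses precede
the new writer. -/
theorem History.write [DecidableEq Loc] (hr : StrandOrder r) (h : History r E.cur E.accesses D)
    (hq : ∀ u ≤ E.cur, D.query u E.cur = true ↔ r u E.cur) (l : Loc) :
    History r E.cur (⟨E.cur, l, true⟩ :: E.accesses) (D.step E (.write l)) := by
  have hsub : ∀ l', (∀ ρ ∈ (D.step E (.write l)).races, ρ.loc ≠ l') →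
      ∀ ρ ∈ D.races, ρ.loc ≠ l' := fun l' hl' ρ hρ => hl' ρ (List.mem_append_right _ hρ)
  have hwle : ∀ l' w, D.lastWriter l' = some w → w ≤ E.cur := fun l' w hw => by
    obtain ⟨a, ha, h1, _⟩ := h.writer l' w hw
    exact h1 ▸ h.access_le a ha
  -- the new access is ordered with all earlier ones
  have hnew : (∀ ρ ∈ (D.step E (.write l)).races, ρ.loc ≠ l) → ∀ b ∈ E.accesses, b.loc = l →
      r b.strand E.cur := by
    intro hl b hb hbl
    rcases h.seen l (hsub l hl) b hb hbl with ⟨w, hw, hbw'⟩ | ⟨_, h1⟩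
    · exact hr.trans hbw' (rel_of_check hq hl (by simp [hw]) (hwle l w hw))
    · exact rel_of_check hq hl (by simp [h1]) (h.access_le b hb)
  refine ⟨?_, ?_, ?_, ?_, ?_, ?_⟩
  · intro a ha
    rcases List.mem_cons.1 ha with rfl | ha
    · exact le_rfl
    · exact h.access_le a ha
  · intro l' w hw
    have hw' : Function.update D.lastWriter l (some E.cur) l' = some w := hw
    rw [Function.update_apply] at hw'
    split_ifs at hw' with hll
    · rw [Option.some.injEq] at hw'
      exact ⟨⟨E.cur, l, true⟩, by simp, hw', hll.symm, rfl⟩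
    · obtain ⟨a, ha, h1⟩ := h.writer l' w hw'
      exact ⟨a, by simp [ha], h1⟩
  · intro l' u hu
    have hu' : u ∈ Function.update D.readers l [] l' := hu
    rw [Function.update_apply] at hu'
    split_ifs at hu' with hll
    · simp at hu'
    · obtain ⟨a, ha, h1⟩ := h.reader l' u hu'
      exact ⟨a, by simp [ha], h1⟩
  · refine h.races_access hr hq ?_
    intro u hu
    rcases List.mem_append.1 hu with hu | hu
    · rw [Option.mem_toList] at hu
      obtain ⟨a, ha, h1, h2, h3⟩ := h.writer l u hu
      exact ⟨a, ha, h1, h2, Or.inl h3⟩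
    · obtain ⟨a, ha, h1, h2⟩ := h.reader l u hu
      exact ⟨a, ha, h1, h2, Or.inr rfl⟩
  · intro l' hl' a ha hal
    change (∃ w, Function.update D.lastWriter l (some E.cur) l' = some w ∧ r a.strand w) ∨
      (a.isWrite = false ∧ a.strand ∈ Function.update D.readers l [] l')
    rw [Function.update_apply, Function.update_apply]
    by_cases hll : l' = l
    · subst hll
      left
      refine ⟨E.cur, by simp, ?_⟩
      rcases List.mem_cons.1 ha with rfl | ha
      · exact hr.refl _
      · exact hnew hl' a ha hal
    · rw [if_neg hll, if_neg hll]
      rcases List.mem_cons.1 ha with rfl | ha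
      · exact absurd hal.symm hll
      · exact h.seen l' (hsub l' hl') a ha hal
  · intro l' hl' a ha b hb hal hbl hw
    rcases List.mem_cons.1 ha with rfl | ha
    · rcases List.mem_cons.1 hb with rfl | hb
      · exact Or.inl (hr.refl _)
      · simp only at hal
        subst hal
        exact Or.inr (hnew hl' b hb hbl)
    · rcases List.mem_cons.1 hb with rfl | hb
      · simp only at hbl
        subst hbl
        exact Or.inl (hnew hl' a ha hal)
      · exact h.ordered l' (hsub l' hl') a ha b hb hal hbl hw

theorem History.congr {n n' : ℕ} {as : List (Access Loc)} {D' : Detector Loc}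
    (h : History r n as D) (hn : n ≤ n') (hw : D'.lastWriter = D.lastWriter)
    (hrd : D'.readers = D.readers) (hrc : D'.races = D.races) : History r n' as D' := by
  obtain ⟨h1, h2, h3, h4, h5, h6⟩ := h
  exact ⟨fun a ha => (h1 a ha).trans hn, by rwa [hw], by rwa [hrd], by rwa [hrc],
    by rwa [hw, hrd, hrc], by rwa [hrc]⟩

theorem History.step [DecidableEq Loc] (hr : StrandOrder r) (h : History r E.cur E.accesses D)
    (hq : ∀ u ≤ E.cur, D.query u E.cur = true ↔ r u E.cur) {i : Instr Loc}
    (hi : E.step i = some E') : History r E'.cur E'.accesses (D.step E i) := by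
  cases i with
  | read l =>
    simp only [Exec.step, Option.some.injEq] at hi; subst hi
    exact h.read hr hq l
  | write l =>
    simp only [Exec.step, Option.some.injEq] at hi; subst hi
    exact h.write hr hq l
  | spawn | create =>
    simp only [Exec.step, Option.some.injEq] at hi; subst hi
    exact h.congr (Nat.le_succ _) rfl rfl rfl
  | ret =>
    simp only [Exec.step] at hi
    split at hi
    · next fr st hp hst =>
      simp only [Detector.step, hst]
      split at hi <;>
      · simp only [Option.some.injEq] at hi; subst hi
        exact h.congr (Nat.le_succ _) rfl rfl rfl
    · simp at hi
  | sync =>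
    simp only [Exec.step] at hi
    split at hi
    · next k ks hp =>
      simp only [Option.some.injEq] at hi; subst hi
      simp only [Detector.step, hp]
      exact h.congr (Nat.le_succ _) rfl rfl rfl
    · simp at hi
  | get f =>
    simp only [Exec.step] at hi
    split at hi
    · next t ht =>
      simp only [Option.some.injEq] at hi; subst hi
      simp only [Detector.step, ht]
      exact h.congr (Nat.le_succ _) rfl rfl rfl
    · simp at hi

/-- The detector follows the execution. -/
theorem exec_run [DecidableEq Loc] (p : List (Instr Loc)) (s : Exec Loc × Detector Loc)
    {E : Exec Loc} {D : Detector Loc}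
    (h : p.foldlM (fun s i => (s.1.step i).map fun E => (E, s.2.step s.1 i)) s = some (E, D)) :
    p.foldlM Exec.step s.1 = some E := by
  induction p generalizing s with
  | nil =>
    simp only [List.foldlM_nil, Option.pure_def, Option.some.injEq] at h
    simp [h]
  | cons i p ih =>
    rw [List.foldlM_cons, Option.bind_eq_bind, Option.bind_eq_some_iff] at h
    obtain ⟨s', h1, h2⟩ := h
    obtain ⟨E₁, h3, rfl⟩ := Option.map_eq_some_iff.1 h1
    rw [List.foldlM_cons, Option.bind_eq_bind, h3]
    exact ih _ h2

/-- Both invariants hold along an execution with full computation dag `Efull`. -/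
theorem inv_run [DecidableEq Loc] {Efull : Exec Loc} (hF : Efull.Forward)
    (p : List (Instr Loc)) : ∀ (E : Exec Loc) (D : Detector Loc) (q : List (Instr Loc)),
      run p = some (E, D) → q.foldlM Exec.step E = some Efull →
      Inv Efull.Reach E D.sp D.nsp ∧ History Efull.Reach E.cur E.accesses D := by
  have hr := hF.strandOrder
  -- The remaining instructions `q` vary with the prefix, so that the full dag and its relation stay
  -- fixed throughout the induction.
  induction p using List.reverseRecOn with
  | nil =>
    intro E D q h _
    simp only [run, List.foldlM_nil, Option.pure_def, Option.some.injEq, Prod.mk.injEq] at h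
    obtain ⟨rfl, rfl⟩ := h
    refine ⟨Inv.init hr, ?_⟩
    constructor <;> simp [Exec.init, Detector.init]
  | append_singleton p i ih =>
    intro E D q h hq
    rw [run, List.foldlM_append, Option.bind_eq_bind, Option.bind_eq_some_iff] at h
    obtain ⟨⟨E₀, D₀⟩, h1, h2⟩ := h
    rw [List.foldlM_cons, Option.bind_eq_bind, Option.bind_eq_some_iff] at h2
    obtain ⟨s', h2, h3⟩ := h2
    simp only [List.foldlM_nil, Option.pure_def, Option.some.injEq] at h3
    subst h3
    obtain ⟨E₁, h3, h4⟩ := Option.map_eq_some_iff.1 h2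
    rw [Prod.mk.injEq] at h4
    obtain ⟨rfl, rfl⟩ := h4
    simp only at h3
    obtain ⟨i1, i2⟩ := ih E₀ D₀ (i :: q) h1 (by
      rw [List.foldlM_cons, Option.bind_eq_bind, h3]; exact hq)
    -- The full dag gives the current strand the same immediate predecessors as the present one,
    -- since no later edge ends there.
    refine ⟨i1.step hr h3 (Exec.foldlM_step hq).1.reach_cur, ?_⟩
    exact i2.step hr (fun u hu => i1.query hr hu) h3

end Detector

end MultiBagsPlus

/-! ### The correctness theorem. -/

/-- `p ++ q` are the instructions issued by a depth-first eager execution, and `p` is what has been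
executed so far: `E` and `D` are the present states of the execution and of the detector, and
`Efull` holds the full computation dag. -/
theorem mainTheorem2 {Loc : Type*} [DecidableEq Loc]
    (p q : List (MultiBagsPlus.Instr Loc))
    (E Efull : MultiBagsPlus.Exec Loc) (D : MultiBagsPlus.Detector Loc)
    (hp : MultiBagsPlus.Detector.run p = some (E, D))
    (hpq : MultiBagsPlus.Exec.run (p ++ q) = some Efull) :
    (∀ u < E.cur, D.query u E.cur = true ↔ Efull.Precedes u E.cur) ∧
    (∀ r ∈ D.races,
      MultiBagsPlus.Conflict E.accesses r.loc r.fst r.snd ∧ Efull.Parallel r.fst r.snd) ∧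
    (∀ l : Loc, (∃ r ∈ D.races, r.loc = l) ↔
      ∃ u v, MultiBagsPlus.Conflict E.accesses l u v ∧ Efull.Parallel u v) := by
  have hF : Efull.Forward :=
    (MultiBagsPlus.Exec.foldlM_step hpq).2 MultiBagsPlus.Exec.Forward.init
  have hr := hF.strandOrder
  have hq : q.foldlM MultiBagsPlus.Exec.step E = some Efull := by
    have hE := MultiBagsPlus.Detector.exec_run p _ hp
    rw [MultiBagsPlus.Exec.run, List.foldlM_append, hE] at hpq
    exact hpq
  obtain ⟨h1, h2⟩ := MultiBagsPlus.Detector.inv_run hF p E D q hp hq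
  have hraces : ∀ r ∈ D.races,
      MultiBagsPlus.Conflict E.accesses r.loc r.fst r.snd ∧ Efull.Parallel r.fst r.snd := by
    intro ρ hρ
    obtain ⟨h3, h4⟩ := h2.races ρ hρ
    exact ⟨h3, (MultiBagsPlus.Exec.parallel_iff hF).2 h4⟩
  refine ⟨fun u hu => ?_, hraces, fun l => ⟨?_, ?_⟩⟩
  · rw [h1.query hr hu.le, MultiBagsPlus.Exec.precedes_iff hu.ne]
  · rintro ⟨ρ, hρ, rfl⟩
    exact ⟨_, _, hraces ρ hρ⟩
  · rintro ⟨u, v, ⟨a, ha, b, hb, hal, hbl, rfl, rfl, hw⟩, hpar⟩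
    by_contra hc
    push Not at hc
    rw [MultiBagsPlus.Exec.parallel_iff hF] at hpar
    rcases h2.ordered l hc a ha b hb hal hbl hw with h3 | h3
    · exact hpar.1 h3
    · exact hpar.2 h3
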